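/- Let $V_{\mathbb Q}$ be a finite-dimensional $\mathbb Q$-vector space with a finite increasing filtration $W_\bullet$, with nondegenerate $(-1)^k$-symmetric bilinear forms $q_k:\mathrm{Gr}^W_kV_{\mathbb Q}\otimes \mathrm{Gr}^W_kV_{\mathbb Q}\to\mathbb Q$ for all $k$, and let $\{h^{p,q}\}$ be non-negative integers. Let $\mathcal M$ be the corresponding graded-polarized mixed period domain: the set of finite decreasing filtrations $F^\bullet$ of $V_{\mathbb C}$ such that $(V_{\mathbb Q},W,F)$ is a rational mixed Hodge structure, graded-polarized by the $q_k$, with Hodge numbers $h^{p,q}$. It carries the topology of a subset of a variety of flags in $V_{\mathbb C}$. For $V=(V_{\mathbb Q},W,F)\in\mathcal M$ with Deligne splitting $V_{\mathbb C}=\bigoplus I^{p,q}$, the Deligne torus $h:\mathbf S_{\mathbb C}\to\mathbf{GL}(V_{\mathbb C})$ is the homomorphism by which $(z_1,z_2)\in\mathbf S_{\mathbb C}(\mathbb C)=\mathbb C^*\times\mathbb C^*$ acts as $z_1^pz_2^q$ on $I^{p,q}$, and the Mumford–Tate group $\mathbf{MT}(V)\subset\mathbf{GL}(V_{\mathbb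 Q})$ is the $\mathbb Q$-Zariski closure of $h$, that is, the smallest closed $\mathbb Q$-subgroup $\mathbf G$ such that $h$ takes values in $\mathbf G_{\mathbb C}$. The Noether–Lefschetz locus of $V$ is $$\mathcal{NL}(V)=\{V'\in\mathcal M\mid \mathbf{MT}(V')\subset\mathbf{MT}(V)\}\subset\mathcal M .$$ A mixed Hodge datum is a pair $(\mathbf G,X)$ of a connected linear algebraic $\mathbb Q$-group $\mathbf G$, with unipotent radical $\mathbf U$, and a $\mathbf G(\mathbb R)\mathbf U(\mathbb C)$-conjugacy class $X$ of homomorphisms $\mathbf S_{\mathbb C}\to\mathbf G_{\mathbb C}$ such that for $\chi\in X$: (1) $\mathbf S_{\mathbb C}\xrightarrow{\chi}\mathbf G_{\mathbb C}\to(\mathbf G/\mathbf U)_{\mathbb C}$ is defined over $\mathbb R$; (2) its composition with the diagonal $\mathbf G_m\to\mathbf S_{\mathbb C}$ is defined over $\mathbb Q$; (3) for the weight filtration on $\mathfrak g=\mathrm{Lie}\,\mathbf G$ given by the adjoint action through $\chi$, $W_{-1}\mathfrak g=\mathrm{Lie}\,\mathbf U$. If $\mathbf G\subset\mathbf{GL}(V_{\mathbb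 Q})$, each $\chi\in X$, with weight spaces $V^{r,s}\subset V_{\mathbb C}$ (on which $(z_1,z_2)$ acts as $z_1^rz_2^s$), gives a mixed Hodge structure on $V_{\mathbb Q}$ with $W_k=\bigoplus_{r+s\le k}V^{r,s}$ and $F^p=\bigoplus_{r\ge p}V^{r,s}$; the mixed Hodge domain $\mathcal D_{\mathbf G,X}$ is the set of mixed Hodge structures obtained in this way, and a connected mixed Hodge domain for $(\mathbf G,X)$ is a connected component of $\mathcal D_{\mathbf G,X}$. **Proposition.** Let $V\in\mathcal M$, let $\mathbf G=\mathbf{MT}(V)$ with unipotent radical $\mathbf U$, and let $X_{\mathbf G}$ be the $\mathbf G(\mathbb R)\mathbf U(\mathbb C)$-conjugacy class of the Deligne torus of $V$. Then $(\mathbf G,X_{\mathbf G})$ is a mixed Hodge datum, every $\chi\in X_{\mathbf G}$ induces on $V_{\mathbb C}$ the given weight filtration $W$, $V\in\mathcal D_{\mathbf G,X_{\mathbf G}}$, and the connected component of $\mathcal{NL}(V)$ through $V$ is equal to the connected component of $\mathcal D_{\mathbf G,X_{\mathbf G}}$ containing $V$ (the connected mixed Hodge domain for $(\mathbf G,X_{\mathbf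 G})$ containing $V$). -/

import Mathlib

open scoped TensorProduct

noncomputable section

namespace MixedHodge

/-! ### Complexification of a rational vector space, Galois conjugation -/

/-- The complexification `H_ℂ = ℂ ⊗ H` of a rational vector space `H`. -/
abbrev Cx (H : Type*) [AddCommGroup H] [Module ℚ H] : Type _ := ℂ ⊗[ℚ] H

/-- The group `GL(H)(ℂ) = GL(H_ℂ)`. -/
abbrev GLC (H : Type*) [AddCommGroup H] [Module ℚ H] : Type _ := Cx H ≃ₗ[ℂ] Cx H

/-- Complex conjugation as an element of `Aut(ℂ/ℚ)`. -/
def conjQ : ℂ ≃ₐ[ℚ] ℂ := Complex.conjAe.restrictScalars ℚ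

section Galois

variable {H : Type*} [AddCommGroup H] [Module ℚ H]

/-- The `σ`-semilinear action `σ ⊗ id` of `σ ∈ Aut(ℂ/ℚ)` on `H_ℂ = ℂ ⊗ H`. -/
def gal (σ : ℂ ≃ₐ[ℚ] ℂ) : Cx H →ₛₗ[(σ : ℂ →+* ℂ)] Cx H where
  toFun := LinearMap.rTensor H σ.toLinearMap
  map_add' := map_add _
  map_smul' := by
    intro c x
    induction x using TensorProduct.induction_on with
    | zero => simp
    | tmul z v => simp [TensorProduct.smul_tmul']
    | add x y hx hy => simp only [smul_add, map_add, hx, hy]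

/-- `g'` is the Galois conjugate `σ(g) = σ ∘ g ∘ σ⁻¹` of `g ∈ GL(H_ℂ)`. -/
def IsGaloisConj (σ : ℂ ≃ₐ[ℚ] ℂ) (g g' : GLC H) : Prop :=
  ∀ x : Cx H, g' (gal σ x) = gal σ (g x)

/-- The complex conjugate of a complex subspace of `H_ℂ`. -/
def conjSubmodule (F : Submodule ℂ (Cx H)) : Submodule ℂ (Cx H) :=
  F.comap (gal conjQ)

end Galois

/-! ### Filtrations of `H_ℂ` and the topology of flag varieties -/

/-- `ℤ`-indexed families of complex subspaces of `H_ℂ`; a Hodge filtration `F^•` is a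
point of this type. -/
def CxFiltration (H : Type*) [AddCommGroup H] [Module ℚ H] : Type _ :=
  ℤ → Submodule ℂ (Cx H)

/-- The topology on the set of all subspaces of a finite-dimensional complex vector space `E`:
the disjoint union over `d` of the Grassmannians `Gr(d, E)`, each of them with the quotient
topology from the space of `d`-frames in `E`. -/
@[reducible]
def grassmannTopology (E : Type*) [AddCommGroup E] [Module ℂ E] :
    TopologicalSpace (Submodule ℂ E) :=
  letI : TopologicalSpace E := moduleTopology ℂ E
  ⨆ d : ℕ, TopologicalSpace.coinduced
    (fun v : {v : Fin d → E // LinearIndependent ℂ v} => Submodule.span ℂ (Set.range v.1))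
    inferInstance

/-- Filtrations are topologized as points of a product of Grassmannians; on a set of
filtrations with fixed dimensions this is the topology of the flag variety. -/
instance (H : Type*) [AddCommGroup H] [Module ℚ H] : TopologicalSpace (CxFiltration H) :=
  @Pi.topologicalSpace ℤ (fun _ => Submodule ℂ (Cx H)) (fun _ => grassmannTopology (Cx H))

/-- `F^p ∩ conj(F^q)`. -/
def hodgePiece {H : Type*} [AddCommGroup H] [Module ℚ H] (F : CxFiltration H) (p q : ℤ) :
    Submodule ℂ (Cx H) :=
  F p ⊓ conjSubmodule (F q)

/-! ### Weight filtrations and graded pieces -/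

/-- A finite increasing filtration of a rational vector space. -/
structure WeightFiltration (V : Type*) [AddCommGroup V] [Module ℚ V] where
  /-- the subspaces `W_k` -/
  W : ℤ → Submodule ℚ V
  mono : Monotone W
  exists_bot : ∃ m, W m = ⊥
  exists_top : ∃ m, W m = ⊤

section Graded

variable {V : Type*} [AddCommGroup V] [Module ℚ V]

/-- The complexified step `(W_k)_ℂ ⊆ V_ℂ`. -/
def WeightFiltration.cx (W : WeightFiltration V) (k : ℤ) : Submodule ℂ (Cx V) :=
  (W.W k).baseChange ℂ

/-- `W_{k-1}` as a subspace of `W_k`. -/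
abbrev WeightFiltration.prev (W : WeightFiltration V) (k : ℤ) : Submodule ℚ (W.W k) :=
  (W.W (k - 1)).comap (W.W k).subtype

/-- `Gr_k^W V = W_k / W_{k-1}`. -/
abbrev WeightFiltration.Gr (W : WeightFiltration V) (k : ℤ) : Type _ :=
  W.W k ⧸ W.prev k

/-- The filtration induced by `F` on `Gr_k^W V_ℂ`: the image of `F^p ∩ (W_k)_ℂ`. -/
def inducedFiltration (W : WeightFiltration V) (F : CxFiltration V) (k : ℤ) :
    CxFiltration (W.Gr k) := fun p =>
  ((F p).comap ((W.W k).subtype.baseChange ℂ)).map ((W.prev k).mkQ.baseChange ℂ)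

end Graded

/-- Graded polarization forms: a nondegenerate rational `(-1)^k`-symmetric bilinear form
on each `Gr_k^W V`. -/
structure GradedForms {V : Type*} [AddCommGroup V] [Module ℚ V] (W : WeightFiltration V) where
  /-- the form `q_k` -/
  form : ∀ k : ℤ, LinearMap.BilinForm ℚ (W.Gr k)
  symm : ∀ k x y, form k x y = (-1 : ℚ) ^ k * form k y x
  nondegenerate : ∀ k, (form k).Nondegenerate

/-! ### Mixed Hodge structures, polarizations, the mixed period domain -/

/-- `F` defines on the rational vector space `H` a pure Hodge structure of weight `k`. -/
def IsPureHodge {H : Type*} [AddCommGroup H] [Module ℚ H] (k : ℤ) (F : CxFiltration H) : Prop :=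
  ∀ p : ℤ, IsCompl (F p) (conjSubmodule (F (k + 1 - p)))

/-- The pure Hodge structure `F` of weight `k` is polarized by `q`: the summands
`H^{p,q} = F^p ∩ conj(F^q)`, `p + q = k`, are orthogonal for the hermitian form
`(u, v) ↦ q(C u, conj v)`, where the Weil operator `C` acts on `H^{p,q}` as `i^{p-q}`, and
the hermitian form is positive definite on each of them. -/
structure IsPolarizedBy {H : Type*} [AddCommGroup H] [Module ℚ H] (k : ℤ)
    (F : CxFiltration H) (Q : LinearMap.BilinForm ℚ H) : Prop where
  orthogonal : ∀ p p' : ℤ, p ≠ p' → ∀ u ∈ hodgePiece F p (k - p),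
    ∀ v ∈ hodgePiece F p' (k - p'), Q.baseChange ℂ u (gal conjQ v) = 0
  positive : ∀ p : ℤ, ∀ u ∈ hodgePiece F p (k - p), u ≠ 0 →
    ∃ r : ℝ, 0 < r ∧ Complex.I ^ (p - (k - p)) * Q.baseChange ℂ u (gal conjQ u) = r

section Mixed

variable {V : Type*} [AddCommGroup V] [Module ℚ V]

/-- `(V, W, F)` is a rational mixed Hodge structure. -/
structure IsMixedHodge (W : WeightFiltration V) (F : CxFiltration V) : Prop where
  anti : Antitone F
  exists_top : ∃ p, F p = ⊤
  exists_bot : ∃ p, F p = ⊥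
  pure : ∀ k, IsPureHodge k (inducedFiltration W F k)

/-- The graded-polarized mixed period domain `ℳ`: the Hodge filtrations `F` for which
`(V, W, F)` is a mixed Hodge structure graded-polarized by the given forms
and with Hodge numbers `h^{p,q}`. -/
def periodDomain (W : WeightFiltration V) (Q : GradedForms W) (h : ℤ → ℤ → ℕ) :
    Set (CxFiltration V) :=
  {F | IsMixedHodge W F ∧ (∀ k, IsPolarizedBy k (inducedFiltration W F k) (Q.form k)) ∧
    ∀ p q, Module.finrank ℂ (hodgePiece (inducedFiltration W F (p + q)) p q) = h p q}

/-! ### The Deligne splitting and the Deligne torus -/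

/-- The summand `I^{p,q}` of the Deligne splitting of `(V, W, F)`. -/
def deligneI (W : WeightFiltration V) (F : CxFiltration V) (p q : ℤ) : Submodule ℂ (Cx V) :=
  (F p ⊓ W.cx (p + q)) ⊓
    ((conjSubmodule (F q) ⊓ W.cx (p + q)) ⊔
      ⨆ j : ℕ, conjSubmodule (F (q - 1 - j)) ⊓ W.cx (p + q - 2 - j))

/-- Homomorphisms `𝕊_ℂ → GL(V_ℂ)` on complex points, `𝕊_ℂ(ℂ) = ℂˣ × ℂˣ`. -/
abbrev TorusHom (V : Type*) [AddCommGroup V] [Module ℚ V] : Type _ := ℂˣ × ℂˣ →* GLC V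

/-- `χ` is the Deligne torus of `(V, W, F)`: `(z₁, z₂)` acts as `z₁^p z₂^q` on `I^{p,q}`. -/
def IsDeligneTorus (W : WeightFiltration V) (F : CxFiltration V) (χ : TorusHom V) : Prop :=
  ∀ p q : ℤ, ∀ v ∈ deligneI W F p q, ∀ z : ℂˣ × ℂˣ,
    χ z v = ((z.1 ^ p * z.2 ^ q : ℂˣ) : ℂ) • v

open Classical in
/-- The Deligne torus of a mixed Hodge structure `(V, W, F)` (with a default value
when `(V, W, F)` is not a mixed Hodge structure and there is none). -/
def deligneTorus (W : WeightFiltration V) (F : CxFiltration V) : TorusHom V :=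
  if h : ∃ χ, IsDeligneTorus W F χ then h.choose else 1

/-- The subspace on which the torus `ℂˣ × ℂˣ`, acting through `ρ`, acts by `z₁^p z₂^q`. -/
def torusWeightSpace {E : Type*} [AddCommGroup E] [Module ℂ E]
    (ρ : ℂˣ × ℂˣ → Module.End ℂ E) (p q : ℤ) : Submodule ℂ E :=
  ⨅ z : ℂˣ × ℂˣ, Module.End.eigenspace (ρ z) ((z.1 ^ p * z.2 ^ q : ℂˣ) : ℂ)

/-- The bigrading `V^{p,q}` of `V_ℂ` given by `χ`. -/
def torusPiece (χ : TorusHom V) (p q : ℤ) : Submodule ℂ (Cx V) :=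
  torusWeightSpace (fun z => (χ z).toLinearMap) p q

/-- The homomorphism `χ` is algebraic: `V_ℂ` is the sum of its weight spaces. -/
def IsAlgebraicTorusHom (χ : TorusHom V) : Prop :=
  ⨆ p : ℤ, ⨆ q : ℤ, torusPiece χ p q = ⊤

/-- The Hodge filtration `F^p = ⨁_{r ≥ p, s} V^{r,s}` on `V` given by `χ`. -/
def hodgeFiltrationOf (χ : TorusHom V) : CxFiltration V := fun p =>
  ⨆ r : ℤ, ⨆ s : ℤ, ⨆ _ : p ≤ r, torusPiece χ r s

/-- The weight filtration `W_k = ⨁_{r + s ≤ k} V^{r,s}` on `V_ℂ` given by `χ`. -/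
def weightFiltrationOf (χ : TorusHom V) (k : ℤ) : Submodule ℂ (Cx V) :=
  ⨆ r : ℤ, ⨆ s : ℤ, ⨆ _ : r + s ≤ k, torusPiece χ r s

end Mixed

/-! ### Linear algebraic groups over `ℚ`

A closed `ℚ`-subgroup `𝐆 ⊆ 𝐆𝐋(V)` is represented by its group of complex points
`𝐆(ℂ) ⊆ GL(V_ℂ)`. -/

section AlgebraicGroups

variable {V : Type*} [AddCommGroup V] [Module ℚ V] [Module.Finite ℚ V]

/-- The basis of `V_ℂ` coming from a basis of `V`. -/
def cxBasis (V : Type*) [AddCommGroup V] [Module ℚ V] [Module.Finite ℚ V] :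
    Module.Basis (Fin (Module.finrank ℚ V)) ℂ (Cx V) :=
  Algebra.TensorProduct.basis ℂ (Module.finBasis ℚ V)

/-- The matrix entries of an endomorphism of `V_ℂ` in a rational basis. -/
def entries (X : Module.End ℂ (Cx V)) :
    Fin (Module.finrank ℚ V) × Fin (Module.finrank ℚ V) → ℂ := fun ij =>
  LinearMap.toMatrix (cxBasis V) (cxBasis V) X ij.1 ij.2

/-- Rational polynomials in the matrix entries. -/
abbrev MatPoly (V : Type*) [AddCommGroup V] [Module ℚ V] : Type :=
  MvPolynomial (Fin (Module.finrank ℚ V) × Fin (Module.finrank ℚ V)) ℚ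

/-- A `ℚ`-Zariski closed subset of `GL(V_ℂ)`. -/
def IsQClosed (Z : Set (GLC V)) : Prop :=
  ∃ S : Set (MatPoly V), Z = {g | ∀ P ∈ S, MvPolynomial.aeval (entries g.toLinearMap) P = 0}

/-- `A` is connected in the `ℚ`-Zariski topology of `GL(V_ℂ)`. -/
def IsQConnected (A : Set (GLC V)) : Prop :=
  A.Nonempty ∧ ∀ Z₁ Z₂ : Set (GLC V), IsQClosed Z₁ → IsQClosed Z₂ → A ⊆ Z₁ ∪ Z₂ →
    A ∩ (Z₁ ∩ Z₂) = ∅ → A ⊆ Z₁ ∨ A ⊆ Z₂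

/-- `G` is the group of complex points of a closed connected `ℚ`-subgroup of `𝐆𝐋(V)`. -/
structure IsConnectedQGroup (G : Subgroup (GLC V)) : Prop where
  closed : IsQClosed (G : Set (GLC V))
  connected : IsQConnected (G : Set (GLC V))

/-- The real points `𝐆(ℝ)` of a `ℚ`-group: the points that are their own complex conjugates. -/
def realPoints (G : Subgroup (GLC V)) : Subgroup (GLC V) where
  carrier := {g | g ∈ G ∧ IsGaloisConj conjQ g g}
  mul_mem' := by
    rintro a b ⟨ha, ha'⟩ ⟨hb, hb'⟩
    refine ⟨G.mul_mem ha hb, fun x => ?_⟩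
    rw [LinearEquiv.mul_apply, LinearEquiv.mul_apply, hb', ha']
  one_mem' := ⟨G.one_mem, fun _ => rfl⟩
  inv_mem' := by
    rintro a ⟨ha, ha'⟩
    refine ⟨G.inv_mem ha, fun x => ?_⟩
    have h1 : ∀ y, a (a⁻¹ y) = y := fun y => by
      rw [← LinearEquiv.mul_apply, mul_inv_cancel, LinearEquiv.coe_one, id]
    apply a.injective
    rw [h1, ha', h1]

/-- The unipotent radical of `𝐆` (its complex points): the largest
connected normal unipotent closed `ℚ`-subgroup. -/
def unipotentRadical (G : Subgroup (GLC V)) : Subgroup (GLC V) :=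
  sSup {N | N ≤ G ∧ IsConnectedQGroup N ∧ (∀ g ∈ G, ∀ n ∈ N, g * n * g⁻¹ ∈ N) ∧
    ∀ n ∈ N, IsNilpotent (n.toLinearMap - (1 : Module.End ℂ (Cx V)))}

/-- The (complexified) Lie algebra `𝔤_ℂ` of `𝐆`, i.e. the tangent space at the identity: the
`X ∈ End(V_ℂ)` along which the differentials at `1` of all rational polynomials
that vanish on `𝐆` are zero. -/
def lieAlg (G : Subgroup (GLC V)) : Submodule ℂ (Module.End ℂ (Cx V)) where
  carrier := {X | ∀ P : MatPoly V,
    (∀ g ∈ G, MvPolynomial.aeval (entries g.toLinearMap) P = 0) →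
    ∑ ij, MvPolynomial.aeval (entries (1 : Module.End ℂ (Cx V))) (MvPolynomial.pderiv ij P)
      * entries X ij = 0}
  add_mem' := by
    intro X Y hX hY P hP
    have := congrArg₂ (· + ·) (hX P hP) (hY P hP)
    simpa [entries, mul_add, Finset.sum_add_distrib] using this
  zero_mem' := by
    intro P _
    simp [entries]
  smul_mem' := by
    intro c X hX P hP
    have := congrArg (c * ·) (hX P hP)
    simpa [entries, Finset.mul_sum, mul_left_comm] using this

/-! ### Mumford–Tate groups and Noether–Lefschetz loci -/

/-- The Mumford–Tate group of `(V, W, F)`: the `ℚ`-Zariski closure of its Deligne torus in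
`𝐆𝐋(V)`, i.e. the smallest closed `ℚ`-subgroup whose complex points contain
the image of the Deligne torus. -/
def mumfordTate (W : WeightFiltration V) (F : CxFiltration V) : Subgroup (GLC V) :=
  sInf {G | IsQClosed (G : Set (GLC V)) ∧ ∀ z, deligneTorus W F z ∈ G}

/-- The Noether–Lefschetz locus of `F` in `ℳ`. -/
def noetherLefschetz (W : WeightFiltration V) (Q : GradedForms W) (h : ℤ → ℤ → ℕ)
    (F : CxFiltration V) : Set (CxFiltration V) :=
  {F' | F' ∈ periodDomain W Q h ∧ mumfordTate W F' ≤ mumfordTate W F}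

/-! ### Mixed Hodge data and mixed Hodge domains -/

/-- The `𝐆(ℝ)𝐔(ℂ)`-conjugacy class of `χ`, where `𝐔` is the unipotent radical of `𝐆`. -/
def conjClass (G : Subgroup (GLC V)) (χ : TorusHom V) : Set (TorusHom V) :=
  {χ' | ∃ g ∈ realPoints G, ∃ u ∈ unipotentRadical G, ∀ z, χ' z = (g * u) * χ z * (g * u)⁻¹}

/-- The step `W_k 𝔤_ℂ` of the weight filtration on the Lie algebra of `𝐆` induced by the
adjoint action through `χ`. -/
def lieWeight (G : Subgroup (GLC V)) (χ : TorusHom V) (k : ℤ) :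
    Submodule ℂ (Module.End ℂ (Cx V)) :=
  ⨆ r : ℤ, ⨆ s : ℤ, ⨆ _ : r + s ≤ k,
    lieAlg G ⊓ torusWeightSpace (fun z => (χ z).conj.toLinearMap) r s

/-- Mixed Hodge data `(𝐆, X)`, with `𝐆` given as a closed subgroup of `𝐆𝐋(V)`. A homomorphism
to `(𝐆/𝐔)_ℂ` is defined over a subfield `k ⊆ ℂ` exactly when it is
`Aut(ℂ/k)`-equivariant on complex points; complex conjugation acts on
`𝕊_ℂ(ℂ) = ℂˣ × ℂˣ` by `(z₁, z₂) ↦ (conj z₂, conj z₁)`. -/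
structure IsMixedHodgeDatum (G : Subgroup (GLC V)) (X : Set (TorusHom V)) : Prop where
  group : IsConnectedQGroup G
  isConjClass : ∃ χ, X = conjClass G χ
  algebraic : ∀ χ ∈ X, IsAlgebraicTorusHom χ
  mem_group : ∀ χ ∈ X, ∀ z, χ z ∈ G
  /-- `𝕊_ℂ → 𝐆_ℂ → (𝐆/𝐔)_ℂ` is defined over `ℝ`. -/
  real : ∀ χ ∈ X, ∀ z : ℂˣ × ℂˣ, ∃ u ∈ unipotentRadical G,
    IsGaloisConj conjQ (χ z)
      (χ (Units.map (conjQ : ℂ →* ℂ) z.2, Units.map (conjQ : ℂ →* ℂ) z.1) * u)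
  /-- `𝔾_m → 𝕊_ℂ → 𝐆_ℂ → (𝐆/𝐔)_ℂ` is defined over `ℚ`. -/
  weight_rational : ∀ χ ∈ X, ∀ σ : ℂ ≃ₐ[ℚ] ℂ, ∀ t : ℂˣ, ∃ u ∈ unipotentRadical G,
    IsGaloisConj σ (χ (t, t))
      (χ (Units.map (σ : ℂ →* ℂ) t, Units.map (σ : ℂ →* ℂ) t) * u)
  /-- `W_{-1} 𝔤 = 𝔲`. -/
  lie_weight : ∀ χ ∈ X, lieWeight G χ (-1) = lieAlg (unipotentRadical G)

/-- The mixed Hodge domain `𝒟_{𝐆,X}` of a mixed Hodge datum: the image of `X` in the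
space of mixed Hodge structures on the faithful representation `V`. -/
def hodgeDomain (X : Set (TorusHom V)) : Set (CxFiltration V) := hodgeFiltrationOf '' X

end AlgebraicGroups

end MixedHodge

end

open scoped TensorProduct

noncomputable section

/-! Write G = MT(V), and let Ω (`structuresIn`) be the set of mixed Hodge structures on (V, W) with
the prescribed Hodge numbers and with Mumford-Tate group inside G. The Noether-Lefschetz locus and
the mixed Hodge domain both lie in Ω. They are compared through the group G ∩ `posSim`, whose
elements preserve W, are real on the graded pieces and multiply each q_k by a positive factor. Its
orbits in Ω are relatively open, so a connected subset of Ω through V stays in the orbit of V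
(`IsPreconnected.subset_orbit`). That orbit is contained in both loci, so each of the two components
is contained in the other.

Openness of orbits (`eventually_mem_orbit`): with fixed Hodge numbers the Deligne torus depends
continuously on the Hodge filtration (`tendsto_deligneTorus`). It is evaluated at one real point (u,
conj u) of the torus at which all characters z₁^p z₂^q take distinct values. The result is an
element of G, real on the graded pieces and annihilated by a separable polynomial that is the same
for all of Ω. Near a semisimple element of a closed linear group such elements are conjugate to it
by exponentials from the Lie algebra (`eventually_conj_of_aeval_eq_zero`), and the conjugating
element carries one Hodge filtration to the other. An exponential is a square, so its similitude
factors are positive.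

The domain lies in Ω although a translate of the Deligne torus of V is in general only some
splitting of the translated structure. Deligne's construction carried out inside the Lie algebra of
G shows that the Deligne torus still takes values in G (`IsSplitting.bigrading_torus_mem`).

For the datum axioms, the unipotent radical U is identified with the elements of G acting trivially
on the graded pieces (`IsSplitting.unipotentRadical_eq`). Given a normal unipotent subgroup, its
fixed vectors in a graded piece form a real G-stable subspace; the polarization gives a complement,
and Kolchin's theorem forces this complement to vanish. Conditions modulo U thus become conditions
on the graded pieces, where the torus is real and the diagonal acts on Gr_k by t^k. Square roots of
unipotent elements show that G(ℝ)U(ℂ) is the group of all elements of G that are real on the graded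
pieces (`exists_realPoints_mul`).

Closedness over ℚ of the auxiliary groups comes from Galois descent: the fixed field of Aut(ℂ/ℚ) is
ℚ, so a Galois stable set with complex polynomial equations has rational ones. -/

namespace MixedHodge

/-! ### The Deligne splitting of a pair of opposed filtrations. -/

section Deligne

variable {E : Type*} [AddCommGroup E] [Module ℂ E] {σ : ℂ →+* ℂ}

/-- A pair of filtrations on a complex space with a real structure `c` that are opposed on the
graded pieces. The filtration `W` need not exhaust the space. -/
structure Opposed (c : E →ₛₗ[σ] E) (W F : ℤ → Submodule ℂ E) : Prop where
  invol : ∀ x, c (c x) = x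
  mono : Monotone W
  anti : Antitone F
  exists_W_bot : ∃ m, W m = ⊥
  exists_F_bot : ∃ p, F p = ⊥
  conj_mem : ∀ k, ∀ x ∈ W k, c x ∈ W k
  span : ∀ k p, ∀ w ∈ W k, ∃ x ∈ F p ⊓ W k, ∃ y ∈ F (k + 1 - p) ⊓ W k, w - x - c y ∈ W (k - 1)
  disj : ∀ k p, ∀ x ∈ F p ⊓ W k, ∀ y ∈ F (k + 1 - p) ⊓ W k, x - c y ∈ W (k - 1) → x ∈ W (k - 1)

/-- The conjugate part in the definition of the Deligne splitting. -/
def delR (c : E →ₛₗ[σ] E) (W F : ℤ → Submodule ℂ E) (p q : ℤ) : Submodule ℂ E :=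
  ((F q).comap c ⊓ W (p + q)) ⊔ ⨆ j : ℕ, (F (q - 1 - j)).comap c ⊓ W (p + q - 2 - j)

/-- The summands of the Deligne splitting. -/
def delI (c : E →ₛₗ[σ] E) (W F : ℤ → Submodule ℂ E) (p q : ℤ) : Submodule ℂ E :=
  (F p ⊓ W (p + q)) ⊓ delR c W F p q

variable {c : E →ₛₗ[σ] E} {W F : ℤ → Submodule ℂ E}

theorem mem_of_index_eq {k k' : ℤ} {x : E} (hx : x ∈ W k) (h : k = k') : x ∈ W k' := h ▸ hx

namespace Opposed

/-- Summands with j < i lie in conj F^(q-i) because F decreases; the remaining ones have weight at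
most p+q-2-i. This allows arguments that go down one weight at a time. -/
theorem delR_le (h : Opposed c W F) (p q : ℤ) (i : ℕ) :
    delR c W F p q ≤ ((F (q - i)).comap c ⊓ W (p + q)) ⊔ W (p + q - 2 - i) := by
  refine sup_le (le_sup_of_le_left (inf_le_inf_right _ (Submodule.comap_mono (h.anti (by omega)))))
    (iSup_le fun j => ?_)
  by_cases hj : j < i
  · exact le_sup_of_le_left (inf_le_inf (Submodule.comap_mono (h.anti (by omega)))
      (h.mono (by omega)))
  · exact le_sup_of_le_right (inf_le_right.trans (h.mono (by omega)))

theorem exists_of_mem_delR (h : Opposed c W F) {p q : ℤ} (i : ℕ) {x : E}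
    (hx : x ∈ delR c W F p q) :
    ∃ y ∈ F (q - i) ⊓ W (p + q), x - c y ∈ W (p + q - 2 - i) := by
  obtain ⟨u, hu, w, hw, rfl⟩ := Submodule.mem_sup.1 (h.delR_le p q i hx)
  refine ⟨c u, ⟨hu.1, h.conj_mem _ _ hu.2⟩, ?_⟩
  rw [h.invol, add_sub_cancel_left]
  exact hw

/-- In weight k = p+q-1-i the class of x lies in F^p and in conj F^(q-i). Since p + (q-i) = k+1,
opposedness makes this class zero. -/
theorem mem_W_pred_of_mem_delI (h : Opposed c W F) {p q : ℤ} (i : ℕ) {x : E}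
    (hx : x ∈ delI c W F p q) (hw : x ∈ W (p + q - 1 - i)) : x ∈ W (p + q - 2 - i) := by
  obtain ⟨y, hy, hxy⟩ := h.exists_of_mem_delR i hx.2
  have hy' : y ∈ W (p + q - 1 - i) := by
    have : c y ∈ W (p + q - 1 - i) := by
      have := Submodule.sub_mem _ hw (h.mono (by omega : p + q - 2 - i ≤ p + q - 1 - i) hxy)
      simpa using this
    simpa [h.invol] using h.conj_mem _ _ this
  have := h.disj (p + q - 1 - i) p x ⟨hx.1.1, hw⟩ y
    ⟨mem_of_index_eq hy.1 (by ring), hy'⟩ (mem_of_index_eq hxy (by ring))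
  exact mem_of_index_eq this (by ring)

theorem eq_zero_of_mem_delI (h : Opposed c W F) {p q : ℤ} {x : E}
    (hx : x ∈ delI c W F p q) (hw : x ∈ W (p + q - 1)) : x = 0 := by
  have key : ∀ i : ℕ, x ∈ W (p + q - 1 - i) := by
    intro i
    induction i with
    | zero => simpa using hw
    | succ i ih =>
      have := h.mem_W_pred_of_mem_delI i hx ih
      exact mem_of_index_eq this (by push_cast; ring)
  obtain ⟨m, hm⟩ := h.exists_W_bot
  have := h.mono (by omega : p + q - 1 - ((p + q - 1 - m).toNat : ℤ) ≤ m)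
    (key (p + q - 1 - m).toNat)
  rw [hm] at this
  simpa using this

/-- A class of type `(p, q)` in the graded piece of weight `p + q` lifts to `I^{p,q}`. -/
theorem exists_mem_delI (h : Opposed c W F) {p q : ℤ} {x y : E} (hx : x ∈ F p ⊓ W (p + q))
    (hy : y ∈ F q ⊓ W (p + q)) (hxy : x - c y ∈ W (p + q - 1)) :
    ∃ x' ∈ delI c W F p q, x - x' ∈ W (p + q - 1) := by
  -- Successive approximation. The discrepancy x' - v, of weight p+q-1-i, is split by opposedness
  -- into a part in F^p, which is subtracted from x', and a part in conj F^(q-i), which is added to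
  -- v. The shifts of indices in `delR` are exactly those of the parts that arise here.
  have key : ∀ i : ℕ, ∃ x' ∈ F p ⊓ W (p + q), ∃ v ∈ delR c W F p q,
      x - x' ∈ W (p + q - 1) ∧ x' - v ∈ W (p + q - 1 - i) := by
    intro i
    induction i with
    | zero =>
      refine ⟨x, hx, c y, Submodule.mem_sup_left
        ⟨Submodule.mem_comap.2 ?_, h.conj_mem _ _ hy.2⟩, by simp, by simpa⟩
      rw [h.invol]; exact hy.1
    | succ i ih =>
      obtain ⟨x', hx', v, hv, h1, h2⟩ := ih
      obtain ⟨a, ha, b, hb, hab⟩ := h.span _ p _ h2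
      refine ⟨x' - a, Submodule.sub_mem _ hx' ⟨ha.1, h.mono (by omega) ha.2⟩, v + c b,
        Submodule.add_mem _ hv ?_, ?_, ?_⟩
      · have hb1 : c (c b) ∈ F (q - i) := by
          rw [h.invol]; exact mem_of_index_eq hb.1 (by ring)
        have hb2 := h.conj_mem _ _ hb.2
        rcases i with - | j
        · exact Submodule.mem_sup_left ⟨by simpa using hb1, h.mono (by omega) hb2⟩
        · refine Submodule.mem_sup_right (Submodule.mem_iSup_of_mem j ⟨?_, ?_⟩)
          · exact Submodule.mem_comap.2 (mem_of_index_eq hb1 (by push_cast; ring))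
          · exact mem_of_index_eq hb2 (by push_cast; ring)
      · have := Submodule.add_mem _ h1 (h.mono (by omega : p + q - 1 - i ≤ p + q - 1) ha.2)
        convert this using 1; abel
      · have e : x' - a - (v + c b) = x' - v - a - c b := by abel
        rw [e]
        exact mem_of_index_eq hab (by push_cast; ring)
  obtain ⟨m, hm⟩ := h.exists_W_bot
  obtain ⟨x', hx', v, hv, h1, h2⟩ := key (p + q - 1 - m).toNat
  have := h.mono (by omega : p + q - 1 - ((p + q - 1 - m).toNat : ℤ) ≤ m) h2
  rw [hm, Submodule.mem_bot, sub_eq_zero] at this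
  exact ⟨x', ⟨hx', this ▸ hv⟩, h1⟩

/-- Double induction, downward in weight and upward in the Hodge filtration: from an element of F^p
∩ W_k one splits off a part in F^(p+1) and an element of I^{p,k-p}, and the rest has weight at most
k-1. -/
theorem inf_le_iSup_delI (h : Opposed c W F) (p k : ℤ) :
    F p ⊓ W k ≤ ⨆ r : ℤ, ⨆ s : ℤ, ⨆ _ : p ≤ r ∧ r + s ≤ k, delI c W F r s := by
  obtain ⟨m, hm⟩ := h.exists_W_bot
  obtain ⟨p₀, hp₀⟩ := h.exists_F_bot
  suffices H : ∀ (N : ℕ) (p k : ℤ), (k - m).toNat + (p₀ - p).toNat ≤ N →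
      F p ⊓ W k ≤ ⨆ r : ℤ, ⨆ s : ℤ, ⨆ _ : p ≤ r ∧ r + s ≤ k, delI c W F r s from H _ p k le_rfl
  have mem : ∀ {p k r s : ℤ} {x : E}, p ≤ r ∧ r + s ≤ k → x ∈ delI c W F r s →
      x ∈ ⨆ r : ℤ, ⨆ s : ℤ, ⨆ _ : p ≤ r ∧ r + s ≤ k, delI c W F r s := fun hrs hx =>
    Submodule.mem_iSup_of_mem _ (Submodule.mem_iSup_of_mem _ (Submodule.mem_iSup_of_mem hrs hx))
  have mono : ∀ {p k p' k' : ℤ}, p' ≤ p → k ≤ k' →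
      (⨆ r : ℤ, ⨆ s : ℤ, ⨆ _ : p ≤ r ∧ r + s ≤ k, delI c W F r s) ≤
        ⨆ r : ℤ, ⨆ s : ℤ, ⨆ _ : p' ≤ r ∧ r + s ≤ k', delI c W F r s := fun h1 h2 =>
    iSup_le fun r => iSup_le fun s => iSup_le fun hrs x hx =>
      mem ⟨h1.trans hrs.1, hrs.2.trans h2⟩ hx
  intro N
  induction N using Nat.strong_induction_on with
  | _ N ih =>
  intro p k hN
  by_cases hk : k ≤ m
  · have := h.mono hk
    rw [hm, le_bot_iff] at this
    simp [this]
  by_cases hp : p₀ ≤ p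
  · have := h.anti hp
    rw [hp₀, le_bot_iff] at this
    simp [this]
  intro w hw
  -- Splitting at p+1 instead of p makes w - a a class of type exactly (p, k-p) modulo W_{k-1}.
  obtain ⟨a, ha, b, hb, hab⟩ := h.span k (p + 1) w hw.2
  have hk : p + (k - p) = k := by ring
  obtain ⟨x', hx', hxx'⟩ := h.exists_mem_delI (p := p) (q := k - p) (x := w - a) (y := b)
    ⟨Submodule.sub_mem _ hw.1 (h.anti (by omega) ha.1), by
      rw [hk]; exact Submodule.sub_mem _ hw.2 ha.2⟩
    ⟨mem_of_index_eq hb.1 (by ring), by rw [hk]; exact hb.2⟩ (by rw [hk]; exact hab)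
  rw [hk] at hxx'
  have e : w = a + x' + (w - a - x') := by abel
  rw [e]
  refine Submodule.add_mem _ (Submodule.add_mem _ ?_ (mem ⟨le_rfl, hk.le⟩ hx')) ?_
  · exact mono (by omega) le_rfl (ih (N - 1) (by omega) (p + 1) k (by omega) ha)
  · refine mono le_rfl (by omega) (ih (N - 1) (by omega) p (k - 1) (by omega) ⟨?_, hxx'⟩)
    exact Submodule.sub_mem _ (Submodule.sub_mem _ hw.1 (h.anti (by omega) ha.1)) hx'.1.1

/-- Among the nonzero terms of a relation take one of maximal weight and, in that weight, of minimal
p. The other terms lie in F^(p+1) modulo lower weight, while this one lies in conj F^q modulo lower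
weight. Opposedness puts it in W_{p+q-1}, and I^{p,q} meets that space only in 0. -/
theorem delI_independent (h : Opposed c W F) (s : Finset (ℤ × ℤ)) (x : ℤ × ℤ → E)
    (hx : ∀ i ∈ s, x i ∈ delI c W F i.1 i.2) (hs : ∑ i ∈ s, x i = 0) : ∀ i ∈ s, x i = 0 := by
  classical
  by_contra! hne
  obtain ⟨i₁, hi₁⟩ := hne
  obtain ⟨⟨p, q⟩, hi₀, hmax⟩ := (s.filter (fun i => x i ≠ 0)).exists_max_image
    (fun i => toLex (i.1 + i.2, -i.1)) ⟨i₁, by simpa using hi₁⟩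
  simp only [Finset.mem_filter] at hi₀ hmax
  have e : x (p, q) = -∑ i ∈ s.erase (p, q), x i := by
    rw [← Finset.add_sum_erase s x hi₀.1] at hs
    exact eq_neg_of_add_eq_zero_left hs
  have hrest : ∑ i ∈ s.erase (p, q), x i ∈ (F (p + 1) ⊓ W (p + q)) ⊔ W (p + q - 1) := by
    refine Submodule.sum_mem _ fun i hi => ?_
    rw [Finset.mem_erase] at hi
    by_cases hxi : x i = 0
    · rw [hxi]; exact Submodule.zero_mem _
    have := hmax i ⟨hi.2, hxi⟩
    rw [Prod.Lex.toLex_le_toLex] at this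
    simp only at this
    rcases this with h1 | ⟨h1, h2⟩
    · exact Submodule.mem_sup_right (h.mono (by omega) (hx i hi.2).1.2)
    · refine Submodule.mem_sup_left ⟨h.anti ?_ (hx i hi.2).1.1, h1 ▸ (hx i hi.2).1.2⟩
      have : i.1 ≠ p := fun h3 => hi.1 (Prod.ext h3 (by simp only; omega))
      omega
  obtain ⟨r, hr, w, hw, hrw⟩ := Submodule.mem_sup.1 hrest
  obtain ⟨y, hy, hxy⟩ := h.exists_of_mem_delR 0 (hx (p, q) hi₀.1).2
  have hxy' : x (p, q) - c y ∈ W (p + q - 1) := h.mono (by push_cast; omega) hxy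
  have hr' : -r ∈ W (p + q - 1) := by
    refine h.disj (p + q) (p + 1) (-r) (Submodule.neg_mem _ hr) y
      ⟨mem_of_index_eq hy.1 (by push_cast; ring), hy.2⟩ ?_
    have := Submodule.add_mem _ hxy' hw
    rw [e, ← hrw] at this
    convert this using 1; abel
  refine hi₀.2 (h.eq_zero_of_mem_delI (hx (p, q) hi₀.1) ?_)
  rw [e, ← hrw]
  have := Submodule.sub_mem _ hr' hw
  convert this using 1; abel

end Opposed

end Deligne

/-! ### Bigradings of a vector space, their torus actions, and the bigrading of endomorphisms. -/

section Bigrading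

/-- A finite `ℤ × ℤ`-grading of a complex vector space, given by its projections. -/
structure Bigrading (E : Type*) [AddCommGroup E] [Module ℂ E] where
  proj : ℤ × ℤ → Module.End ℂ E
  supp : Finset (ℤ × ℤ)
  proj_proj : ∀ i j x, proj i (proj j x) = if i = j then proj j x else 0
  sum_proj : ∀ x, ∑ i ∈ supp, proj i x = x

namespace Bigrading

variable {E : Type*} [AddCommGroup E] [Module ℂ E] (B : Bigrading E)

theorem proj_self (i : ℤ × ℤ) (x : E) : B.proj i (B.proj i x) = B.proj i x := by
  rw [B.proj_proj, if_pos rfl]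

theorem proj_ne {i j : ℤ × ℤ} (h : i ≠ j) (x : E) : B.proj i (B.proj j x) = 0 := by
  rw [B.proj_proj, if_neg h]

theorem proj_eq_zero {i : ℤ × ℤ} (h : i ∉ B.supp) (x : E) : B.proj i x = 0 := by
  conv_lhs => rw [← B.sum_proj x]
  rw [map_sum]
  exact Finset.sum_eq_zero fun j hj => B.proj_ne (by rintro rfl; exact h hj) x

theorem sum_proj_of_subset {S : Finset (ℤ × ℤ)} (h : B.supp ⊆ S) (x : E) :
    ∑ i ∈ S, B.proj i x = x := by
  rw [← Finset.sum_subset h fun i _ hi => B.proj_eq_zero hi x, B.sum_proj]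

theorem mem_of_proj_mem {L : Submodule ℂ E} {x : E} (h : ∀ i, B.proj i x ∈ L) : x ∈ L := by
  rw [← B.sum_proj x]
  exact Submodule.sum_mem _ fun i _ => h i

theorem linearMap_ext {M : Type*} [AddCommGroup M] {τ : ℂ →+* ℂ} [Module ℂ M] {f g : E →ₛₗ[τ] M}
    (h : ∀ i x, f (B.proj i x) = g (B.proj i x)) : f = g := by
  ext x
  rw [← B.sum_proj x, map_sum, map_sum]
  exact Finset.sum_congr rfl fun i _ => h i x

/-- The operator acting as `f i` on the `i`-th summand. -/
def scalar (f : ℤ × ℤ → ℂ) : Module.End ℂ E := ∑ i ∈ B.supp, f i • B.proj i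

theorem scalar_proj (f : ℤ × ℤ → ℂ) (i : ℤ × ℤ) (x : E) :
    B.scalar f (B.proj i x) = f i • B.proj i x := by
  by_cases hi : i ∈ B.supp
  · rw [scalar, LinearMap.sum_apply, Finset.sum_eq_single i]
    · rw [LinearMap.smul_apply, B.proj_self]
    · intro j _ hj
      rw [LinearMap.smul_apply, B.proj_ne hj, smul_zero]
    · exact fun h => absurd hi h
  · rw [B.proj_eq_zero hi, map_zero, smul_zero]

theorem proj_scalar (f : ℤ × ℤ → ℂ) (i : ℤ × ℤ) (x : E) :
    B.proj i (B.scalar f x) = f i • B.proj i x := by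
  by_cases hi : i ∈ B.supp
  · rw [scalar, LinearMap.sum_apply, map_sum, Finset.sum_eq_single i]
    · rw [LinearMap.smul_apply, map_smul, B.proj_self]
    · intro j _ hj
      rw [LinearMap.smul_apply, map_smul, B.proj_ne hj.symm, smul_zero]
    · exact fun h => absurd hi h
  · rw [B.proj_eq_zero hi, B.proj_eq_zero hi, smul_zero]

theorem scalar_mul (f g : ℤ × ℤ → ℂ) : B.scalar f * B.scalar g = B.scalar (f * g) := by
  refine B.linearMap_ext fun i x => ?_
  rw [Module.End.mul_apply, B.scalar_proj, map_smul, B.scalar_proj, B.scalar_proj, smul_smul,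
    Pi.mul_apply, mul_comm]

theorem scalar_one : B.scalar 1 = 1 := by
  refine B.linearMap_ext fun i x => ?_
  rw [B.scalar_proj, Pi.one_apply, one_smul, Module.End.one_apply]

theorem scalar_add (f g : ℤ × ℤ → ℂ) : B.scalar (f + g) = B.scalar f + B.scalar g := by
  simp [scalar, add_smul, Finset.sum_add_distrib]

theorem scalar_smul (a : ℂ) (f : ℤ × ℤ → ℂ) : B.scalar (a • f) = a • B.scalar f := by
  simp [scalar, Finset.smul_sum, smul_smul]

theorem scalar_pow (f : ℤ × ℤ → ℂ) (n : ℕ) : B.scalar f ^ n = B.scalar (f ^ n) := by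
  induction n with
  | zero => rw [pow_zero, pow_zero, scalar_one]
  | succ n ih => rw [pow_succ, pow_succ, ih, scalar_mul]

theorem aeval_scalar (f : ℤ × ℤ → ℂ) (P : Polynomial ℂ) :
    Polynomial.aeval (B.scalar f) P = B.scalar (fun i => P.eval (f i)) := by
  induction P using Polynomial.induction_on' with
  | add p q hp hq =>
    rw [map_add, hp, hq, ← scalar_add]
    congr 1; ext i; simp
  | monomial n a =>
    rw [Polynomial.aeval_monomial, scalar_pow, ← Algebra.smul_def, ← scalar_smul]
    congr 1; ext i; simp

/-- A projection is a polynomial in an operator with distinct eigenvalues on the summands. -/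
theorem exists_polynomial_proj {f : ℤ × ℤ → ℂ} (hf : Function.Injective f) (i : ℤ × ℤ) :
    ∃ P : Polynomial ℂ, B.proj i = Polynomial.aeval (B.scalar f) P := by
  classical
  refine ⟨Lagrange.basis (insert i B.supp) f i, ?_⟩
  rw [B.aeval_scalar]
  refine B.linearMap_ext fun j x => ?_
  rw [B.scalar_proj]
  by_cases hj : j ∈ B.supp
  · by_cases hij : i = j
    · subst hij
      rw [B.proj_self, Lagrange.eval_basis_self hf.injOn (Finset.mem_insert_self _ _), one_smul]
    · rw [B.proj_ne hij, Lagrange.eval_basis_of_ne hij (Finset.mem_insert_of_mem hj), zero_smul]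
  · rw [B.proj_eq_zero hj, map_zero, smul_zero]

/-- Projections are polynomials in an operator that separates the summands. Later the operator is
the value of a torus at one generic point, so that every subspace stable under that value is graded.
-/
theorem proj_mem_of_scalar_mem {f : ℤ × ℤ → ℂ} (hf : Function.Injective f) {L : Submodule ℂ E}
    (hL : ∀ x ∈ L, B.scalar f x ∈ L) (i : ℤ × ℤ) {x : E} (hx : x ∈ L) : B.proj i x ∈ L := by
  obtain ⟨P, hP⟩ := B.exists_polynomial_proj hf i
  rw [hP]
  rw [Polynomial.aeval_eq_sum_range, LinearMap.sum_apply]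
  refine Submodule.sum_mem _ fun n hn => ?_
  clear hn
  rw [LinearMap.smul_apply]
  refine Submodule.smul_mem _ _ ?_
  induction n with
  | zero => simpa using hx
  | succ n ih => rw [pow_succ']; exact hL _ ih

/-- The character `(z₁, z₂) ↦ z₁^p z₂^q` of the torus. -/
def chr (z : ℂˣ × ℂˣ) (i : ℤ × ℤ) : ℂ := ((z.1 ^ i.1 * z.2 ^ i.2 : ℂˣ) : ℂ)

theorem chr_mul (z w : ℂˣ × ℂˣ) : chr (z * w) = chr z * chr w := by
  ext i
  simp only [chr, Prod.fst_mul, Prod.snd_mul, mul_zpow, Pi.mul_apply, ← Units.val_mul]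
  congr 1
  exact mul_mul_mul_comm _ _ _ _

theorem chr_one : chr 1 = 1 := by
  ext i; simp [chr]

/-- The torus action attached to a bigrading. -/
def torus : ℂˣ × ℂˣ →* (E ≃ₗ[ℂ] E) where
  toFun z := LinearEquiv.ofLinearMap (B.scalar (chr z)) (B.scalar (chr z⁻¹))
    (by
      rw [← Module.End.mul_eq_comp, scalar_mul, ← chr_mul, mul_inv_cancel, chr_one, scalar_one]
      rfl)
    (by
      rw [← Module.End.mul_eq_comp, scalar_mul, ← chr_mul, inv_mul_cancel, chr_one, scalar_one]
      rfl)
  map_one' := by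
    ext x
    change B.scalar (chr 1) x = x
    rw [chr_one, scalar_one]; rfl
  map_mul' z w := by
    ext x
    change B.scalar (chr (z * w)) x = B.scalar (chr z) (B.scalar (chr w) x)
    rw [chr_mul, ← scalar_mul]; rfl

theorem torus_apply (z : ℂˣ × ℂˣ) (x : E) : B.torus z x = B.scalar (chr z) x := rfl

/-- Two bigradings whose operators correspond under `g` correspond under `g`. -/
theorem proj_comm_of_scalar_comm {E' : Type*} [AddCommGroup E'] [Module ℂ E'] {B : Bigrading E}
    {B' : Bigrading E'} {f : ℤ × ℤ → ℂ} (hf : Function.Injective f) (g : E →ₗ[ℂ] E')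
    (hg : ∀ x, g (B.scalar f x) = B'.scalar f (g x)) (i : ℤ × ℤ) (x : E) :
    g (B.proj i x) = B'.proj i (g x) := by
  have h1 : ∀ i j x, i ≠ j → B'.proj j (g (B.proj i x)) = 0 := by
    intro i j x hij
    have h2 : f j • B'.proj j (g (B.proj i x)) = f i • B'.proj j (g (B.proj i x)) := by
      rw [← B'.proj_scalar, ← hg, B.scalar_proj, map_smul, map_smul]
    rw [← sub_eq_zero, ← sub_smul] at h2
    exact (smul_eq_zero.1 h2).resolve_left (sub_ne_zero.2 fun h => hij (hf h).symm)
  have h3 : ∀ i x, B'.proj i (g (B.proj i x)) = g (B.proj i x) := by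
    intro i x
    conv_rhs => rw [← B'.sum_proj_of_subset (Finset.subset_insert i B'.supp) (g (B.proj i x))]
    rw [Finset.sum_eq_single_of_mem i (Finset.mem_insert_self _ _) fun j _ hj => h1 i j x hj.symm]
  conv_rhs => rw [← B.sum_proj_of_subset (Finset.subset_insert i B.supp) x, map_sum, map_sum]
  rw [Finset.sum_eq_single_of_mem i (Finset.mem_insert_self _ _) fun j _ hj => h1 j i x hj, h3]

/-- The bigrading attached to a direct sum decomposition. -/
def ofIndep [FiniteDimensional ℂ E] (p : ℤ × ℤ → Submodule ℂ E) (ind : iSupIndep p)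
    (htop : ⨆ i, p i = ⊤) : Bigrading E where
  proj i := (p i).subtype ∘ₗ DFinsupp.lapply i ∘ₗ (ind.linearEquiv htop).symm.toLinearMap
  supp := (WellFoundedGT.finite_ne_bot_of_iSupIndep ind).toFinset
  proj_proj i j x := by
    simp only [LinearMap.comp_apply, LinearEquiv.coe_coe, DFinsupp.lapply_apply,
      Submodule.subtype_apply]
    rw [ind.linearEquiv_symm_apply htop (Subtype.prop _), DFinsupp.single_apply]
    split_ifs with h1 h2 h2
    · subst h1; rfl
    · exact absurd h1.symm h2
    · exact absurd h2.symm h1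
    · rfl
  sum_proj x := by
    have hx : x ∈ ⨆ i, p i := htop ▸ Submodule.mem_top
    simp only [LinearMap.comp_apply, LinearEquiv.coe_coe, DFinsupp.lapply_apply,
      Submodule.subtype_apply]
    induction hx using Submodule.iSup_induction' with
    | mem j y hy =>
      rw [ind.linearEquiv_symm_apply htop hy]
      by_cases hj : p j = ⊥
      · have : y = 0 := by rw [hj] at hy; simpa using hy
        subst this
        refine Finset.sum_eq_zero fun i _ => ?_
        rw [DFinsupp.single_apply]
        split_ifs with h
        · subst h; rfl
        · rfl
      · rw [Finset.sum_eq_single_of_mem j (by simpa using hj)]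
        · simp
        · intro i _ hi
          rw [DFinsupp.single_eq_of_ne hi]; rfl
    | zero => simp
    | add y z _ _ hy hz =>
      simp only [map_add, DFinsupp.add_apply, Submodule.coe_add, Finset.sum_add_distrib, hy, hz]

theorem ofIndep_proj_mem [FiniteDimensional ℂ E] {p : ℤ × ℤ → Submodule ℂ E} {ind : iSupIndep p}
    {htop : ⨆ i, p i = ⊤} (i : ℤ × ℤ) (x : E) : (ofIndep p ind htop).proj i x ∈ p i :=
  Subtype.prop _

theorem ofIndep_proj_of_mem [FiniteDimensional ℂ E] {p : ℤ × ℤ → Submodule ℂ E}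
    {ind : iSupIndep p} {htop : ⨆ i, p i = ⊤} {i : ℤ × ℤ} {x : E} (hx : x ∈ p i) :
    (ofIndep p ind htop).proj i x = x := by
  change (((ind.linearEquiv htop).symm x i : p i) : E) = x
  rw [ind.linearEquiv_symm_apply htop hx]
  simp

/-- Transport of a bigrading by an automorphism. -/
def conjBy (g : E ≃ₗ[ℂ] E) : Bigrading E where
  proj i := g.conj (B.proj i)
  supp := B.supp
  proj_proj i j x := by
    simp only [LinearEquiv.conj_apply_apply, LinearEquiv.symm_apply_apply, B.proj_proj]
    split_ifs <;> simp
  sum_proj x := by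
    simp only [LinearEquiv.conj_apply_apply, ← map_sum, B.sum_proj, LinearEquiv.apply_symm_apply]

theorem conjBy_proj_apply (g : E ≃ₗ[ℂ] E) (i : ℤ × ℤ) (x : E) :
    (B.conjBy g).proj i x = g (B.proj i (g.symm x)) := rfl

theorem conjBy_scalar_apply (g : E ≃ₗ[ℂ] E) (f : ℤ × ℤ → ℂ) (x : E) :
    (B.conjBy g).scalar f x = g (B.scalar f (g.symm x)) := by
  simp [scalar, conjBy, LinearEquiv.conj_apply_apply]

/-- The bigrading induced on the endomorphisms. -/
def endo : Bigrading (Module.End ℂ E) where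
  proj i :=
    { toFun := fun X => ∑ a ∈ B.supp, B.proj (a + i) * X * B.proj a
      map_add' := fun X Y => by simp [mul_add, add_mul, Finset.sum_add_distrib]
      map_smul' := fun r X => by simp [Finset.smul_sum] }
  supp := (B.supp ×ˢ B.supp).image fun ab => ab.2 - ab.1
  proj_proj i j X := by
    refine B.linearMap_ext fun a x => ?_
    have key : ∀ (k : ℤ × ℤ) (Y : Module.End ℂ E),
        (∑ b ∈ B.supp, B.proj (b + k) * Y * B.proj b) (B.proj a x) =
          B.proj (a + k) (Y (B.proj a x)) := by
      intro k Y
      by_cases ha : a ∈ B.supp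
      · rw [LinearMap.sum_apply, Finset.sum_eq_single_of_mem a ha]
        · simp [B.proj_self]
        · intro b _ hb
          simp [B.proj_ne hb]
      · simp [B.proj_eq_zero ha]
    simp only [LinearMap.coe_mk, AddHom.coe_mk]
    rw [key, key, B.proj_proj]
    by_cases hij : i = j
    · subst hij; rw [if_pos rfl, if_pos rfl, key]
    · rw [if_neg (by simpa using hij), if_neg hij, LinearMap.zero_apply]
  sum_proj X := by
    simp only [LinearMap.coe_mk, AddHom.coe_mk]
    rw [Finset.sum_comm]
    refine B.linearMap_ext fun a x => ?_
    by_cases ha : a ∈ B.supp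
    · rw [LinearMap.sum_apply, Finset.sum_eq_single_of_mem a ha]
      · rw [LinearMap.sum_apply]
        simp only [Module.End.mul_apply, B.proj_self]
        refine (Finset.sum_map _ (Equiv.addLeft a).toEmbedding
          (fun j => B.proj j (X (B.proj a x)))).symm.trans ?_
        refine B.sum_proj_of_subset (fun b hb => ?_) _
        simp only [Finset.mem_map, Finset.mem_image, Finset.mem_product, Equiv.coe_toEmbedding,
          Equiv.coe_addLeft]
        exact ⟨b - a, ⟨(a, b), ⟨ha, hb⟩, rfl⟩, by abel⟩
      · intro b _ hb
        rw [LinearMap.sum_apply]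
        simp [B.proj_ne hb]
    · simp [B.proj_eq_zero ha]

theorem endo_proj_apply_proj (i a : ℤ × ℤ) (X : Module.End ℂ E) (x : E) :
    B.endo.proj i X (B.proj a x) = B.proj (a + i) (X (B.proj a x)) := by
  change (∑ b ∈ B.supp, B.proj (b + i) * X * B.proj b) (B.proj a x) = _
  by_cases ha : a ∈ B.supp
  · rw [LinearMap.sum_apply, Finset.sum_eq_single_of_mem a ha]
    · simp [B.proj_self]
    · intro b _ hb
      simp [B.proj_ne hb]
  · simp [B.proj_eq_zero ha]

theorem endo_proj_eq_self_iff {i : ℤ × ℤ} {X : Module.End ℂ E} :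
    B.endo.proj i X = X ↔ ∀ a x, B.proj (a + i) (X (B.proj a x)) = X (B.proj a x) := by
  constructor
  · intro h a x
    rw [← endo_proj_apply_proj, h]
  · intro h
    refine B.linearMap_ext fun a x => ?_
    rw [endo_proj_apply_proj, h]

theorem endo_proj_eq_zero_iff {i : ℤ × ℤ} {X : Module.End ℂ E} :
    B.endo.proj i X = 0 ↔ ∀ a x, B.proj (a + i) (X (B.proj a x)) = 0 := by
  constructor
  · intro h a x
    rw [← endo_proj_apply_proj, h, LinearMap.zero_apply]
  · intro h
    refine B.linearMap_ext fun a x => ?_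
    rw [endo_proj_apply_proj, h, LinearMap.zero_apply]

end Bigrading

end Bigrading

/-! ### Bigradings splitting a mixed Hodge structure; uniqueness on the graded pieces. -/

section Splitting

variable {E : Type*} [AddCommGroup E] [Module ℂ E] {σ : ℂ →+* ℂ}

/-- A bigrading that splits both filtrations and is real on the graded pieces. -/
structure IsSplitting (c : E →ₛₗ[σ] E) (W F : ℤ → Submodule ℂ E) (B : Bigrading E) : Prop where
  invol : ∀ x, c (c x) = x
  mem_W : ∀ k x, x ∈ W k ↔ ∀ i : ℤ × ℤ, k < i.1 + i.2 → B.proj i x = 0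
  mem_F : ∀ p x, x ∈ F p ↔ ∀ i : ℤ × ℤ, i.1 < p → B.proj i x = 0
  real : ∀ (i j : ℤ × ℤ) (x : E), i.1 + i.2 ≤ j.1 + j.2 → j ≠ i.swap →
    B.proj j (c (B.proj i x)) = 0

namespace IsSplitting

variable {c : E →ₛₗ[σ] E} {W F : ℤ → Submodule ℂ E} {B : Bigrading E}

theorem proj_mem_W (h : IsSplitting c W F B) {i : ℤ × ℤ} {k : ℤ} (hi : i.1 + i.2 ≤ k) (x : E) :
    B.proj i x ∈ W k :=
  (h.mem_W _ _).2 fun j hj => B.proj_ne (by rintro rfl; omega) x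

theorem proj_mem_F (h : IsSplitting c W F B) {i : ℤ × ℤ} {p : ℤ} (hi : p ≤ i.1) (x : E) :
    B.proj i x ∈ F p :=
  (h.mem_F _ _).2 fun j hj => B.proj_ne (by rintro rfl; omega) x

theorem proj_mem_W_of_mem (h : IsSplitting c W F B) {k : ℤ} {x : E} (hx : x ∈ W k) (i : ℤ × ℤ) :
    B.proj i x ∈ W k := by
  by_cases hi : i.1 + i.2 ≤ k
  · exact h.proj_mem_W hi x
  · rw [(h.mem_W _ _).1 hx i (by omega)]; exact Submodule.zero_mem _

theorem mono (h : IsSplitting c W F B) : Monotone W := fun k l hkl x hx =>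
  (h.mem_W _ _).2 fun i hi => (h.mem_W _ _).1 hx i (by omega)

theorem anti (h : IsSplitting c W F B) : Antitone F := fun k l hkl x hx =>
  (h.mem_F _ _).2 fun i hi => (h.mem_F _ _).1 hx i (by omega)

theorem exists_bounds (B : Bigrading E) : ∃ N : ℤ, ∀ i ∈ B.supp, |i.1| + |i.2| < N := by
  induction B.supp using Finset.induction_on with
  | empty => exact ⟨0, by simp⟩
  | insert a s _ ih =>
    obtain ⟨N, hN⟩ := ih
    refine ⟨max N (|a.1| + |a.2| + 1), fun i hi => ?_⟩
    rcases Finset.mem_insert.1 hi with rfl | hi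
    · omega
    · exact (hN i hi).trans_le (le_max_left _ _)

theorem exists_W_bot (h : IsSplitting c W F B) : ∃ m, W m = ⊥ := by
  obtain ⟨N, hN⟩ := exists_bounds B
  refine ⟨-N, (Submodule.eq_bot_iff _).2 fun x hx => ?_⟩
  rw [← B.sum_proj x]
  refine Finset.sum_eq_zero fun i hi => (h.mem_W _ _).1 hx i ?_
  have := hN i hi
  have := neg_abs_le i.1; have := neg_abs_le i.2
  omega

theorem exists_F_bot (h : IsSplitting c W F B) : ∃ m, F m = ⊥ := by
  obtain ⟨N, hN⟩ := exists_bounds B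
  refine ⟨N, (Submodule.eq_bot_iff _).2 fun x hx => ?_⟩
  rw [← B.sum_proj x]
  refine Finset.sum_eq_zero fun i hi => (h.mem_F _ _).1 hx i ?_
  have := hN i hi
  have := le_abs_self i.1; have := abs_nonneg i.2
  omega

theorem exists_F_top (h : IsSplitting c W F B) : ∃ m, F m = ⊤ := by
  obtain ⟨N, hN⟩ := exists_bounds B
  refine ⟨-N, eq_top_iff.2 fun x _ => (h.mem_F _ _).2 fun i hi => B.proj_eq_zero (fun hi' => ?_) x⟩
  have := hN i hi'
  have := neg_abs_le i.1; have := abs_nonneg i.2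
  omega

theorem conj_mem (h : IsSplitting c W F B) {k : ℤ} {x : E} (hx : x ∈ W k) : c x ∈ W k := by
  rw [← B.sum_proj x, map_sum]
  refine Submodule.sum_mem _ fun i _ => (h.mem_W _ _).2 fun j hj => ?_
  by_cases hi : i.1 + i.2 ≤ k
  · refine h.real i j x (by omega) ?_
    rintro rfl
    simp only [Prod.fst_swap, Prod.snd_swap] at hj
    omega
  · rw [(h.mem_W _ _).1 hx i (by omega), map_zero, map_zero]

/-- The conjugate of a vector of type `i` is of type `i.swap` modulo lower weight. -/
theorem conj_proj_sub (h : IsSplitting c W F B) {i : ℤ × ℤ} {k : ℤ} (hk : i.1 + i.2 ≤ k + 1)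
    (x : E) : c (B.proj i x) - B.proj i.swap (c (B.proj i x)) ∈ W k := by
  refine (h.mem_W _ _).2 fun j hj => ?_
  rw [map_sub]
  by_cases hji : j = i.swap
  · rw [hji, B.proj_self, sub_self]
  · rw [B.proj_ne hji, sub_zero, h.real i j x (by omega) hji]

/-- Modulo lower weight, `W k` is the sum of the pieces of weight `k`. -/
theorem mem_W_pred (h : IsSplitting c W F B) {k : ℤ} {x : E} (hx : x ∈ W k)
    (hx' : ∀ i : ℤ × ℤ, i.1 + i.2 = k → B.proj i x ∈ W (k - 1)) : x ∈ W (k - 1) := by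
  refine (h.mem_W _ _).2 fun i hi => ?_
  by_cases hik : i.1 + i.2 = k
  · rw [← B.proj_self]
    exact (h.mem_W _ _).1 (hx' i hik) i hi
  · exact (h.mem_W _ _).1 hx i (by omega)

/-- A subspace stable under the projections and the conjugation inherits opposed filtrations. -/
theorem opposed_inf (h : IsSplitting c W F B) {L : Submodule ℂ E}
    (hL : ∀ i, ∀ x ∈ L, B.proj i x ∈ L) (hc : ∀ x ∈ L, c x ∈ L) :
    Opposed c (fun k => W k ⊓ L) F where
  invol := h.invol
  mono k l hkl := inf_le_inf_right _ (h.mono hkl)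
  anti := h.anti
  exists_W_bot := h.exists_W_bot.imp fun m hm => by rw [hm, bot_inf_eq]
  exists_F_bot := h.exists_F_bot
  conj_mem k x hx := ⟨h.conj_mem hx.1, hc x hx.2⟩
  span k p w hw := by
    classical
    -- The components in T already lie in F^p. Those in S have weight k and first index below p, so
    -- their conjugates have second type index k - i.1 ≥ k+1-p as first index, up to lower weight.
    -- Those in U have weight below k or vanish.
    set S := B.supp.filter (fun i => i.1 < p ∧ i.1 + i.2 = k)
    set T := B.supp.filter (fun i => p ≤ i.1)
    set U := B.supp.filter (fun i => i.1 < p ∧ i.1 + i.2 ≠ k)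
    have e : w = ∑ i ∈ T, B.proj i w + (∑ i ∈ S, B.proj i w + ∑ i ∈ U, B.proj i w) := by
      conv_lhs => rw [← B.sum_proj w, ← Finset.sum_filter_add_sum_filter_not _ (fun i => p ≤ i.1)]
      congr 1
      rw [← Finset.sum_filter_add_sum_filter_not _ (fun i : ℤ × ℤ => i.1 + i.2 = k),
        Finset.filter_filter, Finset.filter_filter]
      simp only [not_le, S, U, ne_eq]
    refine ⟨∑ i ∈ T, B.proj i w, ⟨Submodule.sum_mem _ fun i hi => h.proj_mem_F ?_ w,
        Submodule.sum_mem _ fun i _ => ⟨h.proj_mem_W_of_mem hw.1 i, hL i _ hw.2⟩⟩,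
      ∑ i ∈ S, B.proj i.swap (c (B.proj i w)), ⟨Submodule.sum_mem _ fun i hi => ?_,
        Submodule.sum_mem _ fun i hi => ⟨h.proj_mem_W ?_ _, hL _ _ (hc _ (hL _ _ hw.2))⟩⟩, ?_⟩
    · exact (Finset.mem_filter.1 hi).2
    · have := (Finset.mem_filter.1 hi).2
      exact h.proj_mem_F (by simp only [Prod.fst_swap]; omega) _
    · have := (Finset.mem_filter.1 hi).2
      simp only [Prod.fst_swap, Prod.snd_swap]; omega
    · have e2 : w - ∑ i ∈ T, B.proj i w - c (∑ i ∈ S, B.proj i.swap (c (B.proj i w))) =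
          ∑ i ∈ S, c (c (B.proj i w) - B.proj i.swap (c (B.proj i w))) +
            ∑ i ∈ U, B.proj i w := by
        simp only [map_sub, h.invol, Finset.sum_sub_distrib, map_sum]
        nth_rewrite 1 [e]
        abel
      rw [e2]
      refine Submodule.add_mem _ (Submodule.sum_mem _ fun i hi => ?_)
        (Submodule.sum_mem _ fun i hi => ?_)
      · have := (Finset.mem_filter.1 hi).2
        have h3 : c (B.proj i w) ∈ L := hc _ (hL _ _ hw.2)
        exact ⟨h.conj_mem (h.conj_proj_sub (by omega) w),
          hc _ (Submodule.sub_mem _ h3 (hL _ _ h3))⟩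
      · have := (Finset.mem_filter.1 hi).2
        refine ⟨?_, hL _ _ hw.2⟩
        by_cases hik : i.1 + i.2 ≤ k - 1
        · exact h.proj_mem_W hik w
        · rw [(h.mem_W _ _).1 hw.1 i (by omega)]; exact Submodule.zero_mem _
  disj k p x hx y hy hxy := by
    refine ⟨(h.mem_W _ _).2 fun i hi => ?_, hx.2.2⟩
    by_cases hik : k < i.1 + i.2
    · exact (h.mem_W _ _).1 hx.2.1 i hik
    by_cases hip : i.1 < p
    · exact (h.mem_F _ _).1 hx.1 i hip
    have h1 := (h.mem_W _ _).1 hxy.1 i hi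
    rw [map_sub, sub_eq_zero] at h1
    rw [h1, ← B.sum_proj y, map_sum, map_sum]
    refine Finset.sum_eq_zero fun j _ => ?_
    by_cases hjk : k < j.1 + j.2
    · rw [(h.mem_W _ _).1 hy.2.1 j hjk, map_zero, map_zero]
    by_cases hjp : j.1 < k + 1 - p
    · rw [(h.mem_F _ _).1 hy.1 j hjp, map_zero, map_zero]
    refine h.real j i y (by omega) ?_
    rintro rfl
    simp only [Prod.fst_swap, Prod.snd_swap] at hik hip hi
    omega

theorem opposed (h : IsSplitting c W F B) : Opposed c W F := by
  have := h.opposed_inf (L := ⊤) (fun _ _ _ => trivial) (fun _ _ => trivial)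
  simpa using this

/-- A vector whose class in the graded piece is of type `(p, q)` has only a component of type
`(p, q)` in that weight. -/
theorem proj_eq_zero_of_type (h : IsSplitting c W F B) {p q k : ℤ} {u v : E} (hu : u ∈ F p ⊓ W k)
    (hv : v ∈ F q ⊓ W k) (huv : u - c v ∈ W (k - 1)) (hk : p + q = k) {l : ℤ × ℤ}
    (hl : k ≤ l.1 + l.2) (hlj : l ≠ (p, q)) : B.proj l u = 0 := by
  by_cases hlp : l.1 < p
  · exact (h.mem_F _ _).1 hu.1 l hlp
  by_cases hlk : k < l.1 + l.2
  · exact (h.mem_W _ _).1 hu.2 l hlk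
  have h1 := (h.mem_W _ _).1 huv l (by omega)
  rw [map_sub, sub_eq_zero] at h1
  rw [h1, ← B.sum_proj v, map_sum, map_sum]
  refine Finset.sum_eq_zero fun m _ => ?_
  by_cases hmk : k < m.1 + m.2
  · rw [(h.mem_W _ _).1 hv.2 m hmk, map_zero, map_zero]
  by_cases hmp : m.1 < q
  · rw [(h.mem_F _ _).1 hv.1 m hmp, map_zero, map_zero]
  refine h.real m l v (by omega) ?_
  rintro rfl
  simp only [Prod.fst_swap, Prod.snd_swap] at hlp hl hlk
  apply hlj
  ext <;> simp only [Prod.fst_swap, Prod.snd_swap] <;> omega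

/-- Two splittings agree on the graded pieces. -/
theorem proj_sub_proj_mem {B' : Bigrading E} (h : IsSplitting c W F B)
    (h' : IsSplitting c W F B') {i : ℤ × ℤ} {k : ℤ} (hi : k ≤ i.1 + i.2) {x : E} (hx : x ∈ W k) :
    B.proj i x - B'.proj i x ∈ W (k - 1) := by
  have key : ∀ j, B.proj i (B'.proj j x) - B'.proj i (B'.proj j x) ∈ W (k - 1) := by
    intro j
    by_cases hjk : k < j.1 + j.2
    · rw [(h'.mem_W _ _).1 hx j hjk, map_zero, map_zero, sub_zero]; exact Submodule.zero_mem _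
    by_cases hjk' : j.1 + j.2 < k
    · refine Submodule.sub_mem _ ?_ ?_
      · exact h.proj_mem_W_of_mem (h'.proj_mem_W (by omega) _) _
      · exact h'.proj_mem_W_of_mem (h'.proj_mem_W (by omega) _) _
    set u := B'.proj j x with hu
    have huW : u ∈ W k := h'.proj_mem_W (by omega) _
    have huF : u ∈ F j.1 := h'.proj_mem_F le_rfl _
    set v := B'.proj j.swap (c u) with hv
    have hvF : v ∈ F j.2 := h'.proj_mem_F (i := j.swap) le_rfl _
    have hvW : v ∈ W k := h'.proj_mem_W (by simp only [Prod.fst_swap, Prod.snd_swap]; omega) _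
    have huv : u - c v ∈ W (k - 1) := by
      have := h.conj_mem (h'.conj_proj_sub (i := j) (k := k - 1) (by omega) x)
      rwa [map_sub, h.invol] at this
    have hzero : ∀ l : ℤ × ℤ, k ≤ l.1 + l.2 → l ≠ j → B.proj l u = 0 := fun l hl hlj =>
      h.proj_eq_zero_of_type ⟨huF, huW⟩ ⟨hvF, hvW⟩ huv (by omega) hl hlj
    by_cases hij : i = j
    · subst hij
      rw [hu, B'.proj_self, ← hu]
      refine (h.mem_W _ _).2 fun l hl => ?_
      rw [map_sub]
      by_cases hli : l = i
      · subst hli; rw [B.proj_self, sub_self]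
      · rw [B.proj_ne hli, hzero l (by omega) hli, sub_zero]
    · rw [hzero i hi hij, B'.proj_ne hij, sub_zero]; exact Submodule.zero_mem _
  rw [← B'.sum_proj x, map_sum, map_sum, ← Finset.sum_sub_distrib]
  exact Submodule.sum_mem _ fun j _ => key j

end IsSplitting

variable {c : E →ₛₗ[σ] E} {W F : ℤ → Submodule ℂ E}

namespace Opposed

theorem iSup_delI (h : Opposed c W F) (hW : ∃ m, W m = ⊤) (hF : ∃ p, F p = ⊤) :
    ⨆ i : ℤ × ℤ, delI c W F i.1 i.2 = ⊤ := by
  obtain ⟨m, hm⟩ := hW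
  obtain ⟨p, hp⟩ := hF
  have := h.inf_le_iSup_delI p m
  rw [hm, hp, inf_top_eq, top_le_iff] at this
  refine top_le_iff.1 (this ▸ ?_)
  exact iSup_le fun r => iSup_le fun s => iSup_le fun _ =>
    le_iSup (fun i : ℤ × ℤ => delI c W F i.1 i.2) (r, s)

theorem iSupIndep_delI (h : Opposed c W F) : iSupIndep fun i : ℤ × ℤ => delI c W F i.1 i.2 :=
  (iSupIndep_iff_finsetSum_eq_zero_imp_eq_zero _).2 h.delI_independent

/-- The Deligne splitting as a bigrading. -/
def bigrading [FiniteDimensional ℂ E] (h : Opposed c W F) (hW : ∃ m, W m = ⊤)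
    (hF : ∃ p, F p = ⊤) : Bigrading E :=
  Bigrading.ofIndep _ h.iSupIndep_delI (h.iSup_delI hW hF)

variable [FiniteDimensional ℂ E] (h : Opposed c W F) (hW : ∃ m, W m = ⊤) (hF : ∃ p, F p = ⊤)

theorem bigrading_proj_mem (i : ℤ × ℤ) (x : E) :
    (h.bigrading hW hF).proj i x ∈ delI c W F i.1 i.2 :=
  Bigrading.ofIndep_proj_mem (p := fun i : ℤ × ℤ => delI c W F i.1 i.2) i x

theorem bigrading_proj_of_mem {i : ℤ × ℤ} {x : E} (hx : x ∈ delI c W F i.1 i.2) :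
    (h.bigrading hW hF).proj i x = x :=
  Bigrading.ofIndep_proj_of_mem (p := fun i : ℤ × ℤ => delI c W F i.1 i.2) hx

theorem bigrading_proj_of_ne {i j : ℤ × ℤ} (hij : i ≠ j) {x : E}
    (hx : x ∈ delI c W F j.1 j.2) : (h.bigrading hW hF).proj i x = 0 := by
  rw [← h.bigrading_proj_of_mem hW hF hx]
  exact Bigrading.proj_ne _ hij x

theorem bigrading_proj_of_mem_inf {p k : ℤ} {x : E} (hx : x ∈ F p ⊓ W k) {i : ℤ × ℤ}
    (hi : i.1 < p ∨ k < i.1 + i.2) : (h.bigrading hW hF).proj i x = 0 := by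
  have : (⨆ r : ℤ, ⨆ s : ℤ, ⨆ _ : p ≤ r ∧ r + s ≤ k, delI c W F r s) ≤
      LinearMap.ker ((h.bigrading hW hF).proj i) := by
    refine iSup_le fun r => iSup_le fun s => iSup_le fun hrs y hy => ?_
    refine h.bigrading_proj_of_ne hW hF (j := (r, s)) ?_ hy
    rintro rfl
    simp only at hi
    omega
  exact this (h.inf_le_iSup_delI p k hx)

theorem isSplitting_bigrading : IsSplitting c W F (h.bigrading hW hF) where
  invol := h.invol
  mem_W k x := by
    constructor
    · intro hx i hi
      have ⟨p, hp⟩ := hF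
      exact h.bigrading_proj_of_mem_inf hW hF (p := p) (k := k) ⟨hp ▸ trivial, hx⟩ (Or.inr hi)
    · intro hx
      refine (h.bigrading hW hF).mem_of_proj_mem fun i => ?_
      by_cases hi : k < i.1 + i.2
      · rw [hx i hi]; exact Submodule.zero_mem _
      · exact h.mono (by omega) (h.bigrading_proj_mem hW hF i x).1.2
  mem_F p x := by
    constructor
    · intro hx i hi
      have ⟨m, hm⟩ := hW
      exact h.bigrading_proj_of_mem_inf hW hF (p := p) (k := m) ⟨hx, hm ▸ trivial⟩ (Or.inl hi)
    · intro hx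
      refine (h.bigrading hW hF).mem_of_proj_mem fun i => ?_
      by_cases hi : i.1 < p
      · rw [hx i hi]; exact Submodule.zero_mem _
      · exact h.anti (by omega) (h.bigrading_proj_mem hW hF i x).1.1
  real i j x hij hj := by
    set u := (h.bigrading hW hF).proj i x
    have hu : u ∈ delI c W F i.1 i.2 := h.bigrading_proj_mem hW hF i x
    obtain ⟨y, hy, huy⟩ := h.exists_of_mem_delR 0 hu.2
    have huy' : y - c u ∈ W (i.2 + i.1 - 1) := by
      have := Submodule.neg_mem _ (h.conj_mem _ _ huy)
      rw [map_sub, h.invol, neg_sub] at this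
      exact h.mono (by push_cast; omega) this
    -- Modulo lower weight the conjugate of u has type i.swap, hence agrees with some v in that
    -- summand. The difference has weight below that of i, where the projection to j vanishes.
    obtain ⟨v, hv, hyv⟩ := h.exists_mem_delI (p := i.2) (q := i.1) (x := y) (y := u)
      ⟨mem_of_index_eq hy.1 (by push_cast; ring), by rw [add_comm]; exact hy.2⟩
      ⟨hu.1.1, by rw [add_comm]; exact hu.1.2⟩ huy'
    have hcv : v - c u ∈ W (i.2 + i.1 - 1) := by
      have := Submodule.sub_mem _ huy' hyv
      convert this using 1; abel
    obtain ⟨p, hp⟩ := hF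
    have h1 := h.bigrading_proj_of_mem_inf hW ⟨p, hp⟩ (p := p) (i := j) ⟨hp ▸ trivial, hcv⟩
      (Or.inr (by omega))
    rw [map_sub, h.bigrading_proj_of_ne hW ⟨p, hp⟩ (j := i.swap) hj hv, zero_sub,
      neg_eq_zero] at h1
    exact h1

end Opposed

/-- Uniform treatment of the two kinds of summands of `delR`: n = 0 is the leading one, and n ≥ 1 is
the one with index j = n-1, whose weight drops by one more. Together with `delR_le_of_forall` it
describes `delR` by generators. -/
theorem mem_delR (hW : Monotone W) {p q b l : ℤ} (n : ℕ) (hb : b = q - n) (hl : l ≤ p + q - n)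
    (hn : n = 0 ∨ l ≤ p + q - n - 1) {x : E} (hx : x ∈ (F b).comap c ⊓ W l) :
    x ∈ delR c W F p q := by
  subst hb
  rcases n with - | n
  · exact Submodule.mem_sup_left ⟨by simpa using hx.1, hW (by simpa using hl) hx.2⟩
  · refine Submodule.mem_sup_right (Submodule.mem_iSup_of_mem n ⟨?_, hW (by omega) hx.2⟩)
    have := Submodule.mem_comap.1 hx.1
    exact Submodule.mem_comap.2 (mem_of_index_eq this (by push_cast; ring))

theorem delR_le_of_forall {p q : ℤ} {S : Submodule ℂ E}
    (hS : ∀ (n : ℕ) (l : ℤ), l ≤ p + q - n → (n = 0 ∨ l ≤ p + q - n - 1) →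
      (F (q - n)).comap c ⊓ W l ≤ S) : delR c W F p q ≤ S := by
  refine sup_le ?_ (iSup_le fun j => ?_)
  · simpa using hS 0 (p + q) (by simp) (Or.inl rfl)
  · refine le_trans (le_of_eq ?_) (hS (j + 1) (p + q - 2 - j) (by omega) (Or.inr (by omega)))
    push_cast
    congr 3; ring

/-! ### Filtrations and splittings on endomorphisms. -/

section Endo

variable [RingHomInvPair σ σ]

/-- Conjugation of endomorphisms by a real structure. -/
def conjEnd (c : E →ₛₗ[σ] E) : Module.End ℂ E →ₛₗ[σ] Module.End ℂ E where
  toFun X :=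
    { toFun := fun x => c (X (c x))
      map_add' := fun x y => by simp
      map_smul' := fun a x => by
        simp only [LinearMap.map_smulₛₗ, RingHomInvPair.comp_apply_eq, RingHom.id_apply] }
  map_add' X Y := by ext x; simp
  map_smul' a X := by ext x; simp

theorem conjEnd_apply (c : E →ₛₗ[σ] E) (X : Module.End ℂ E) (x : E) :
    conjEnd c X x = c (X (c x)) := rfl

/-- The filtration induced on endomorphisms. -/
def endFil (W : ℤ → Submodule ℂ E) (k : ℤ) : Submodule ℂ (Module.End ℂ E) where
  carrier := {X | ∀ j, ∀ x ∈ W j, X x ∈ W (j + k)}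
  add_mem' := fun hX hY j x hx => Submodule.add_mem _ (hX j x hx) (hY j x hx)
  zero_mem' := fun _ _ _ => Submodule.zero_mem _
  smul_mem' := fun a _ hX j x hx => Submodule.smul_mem _ a (hX j x hx)

/-- For reality, let Y have type i and apply its conjugate to a vector of type a. The part of the
conjugate vector of type a.swap leads to type a + i.swap modulo lower weight, and its parts of lower
weight lead to weight below that of a + i. -/
theorem IsSplitting.endo {B : Bigrading E} (h : IsSplitting c W F B) :
    IsSplitting (conjEnd c) (endFil W) (endFil F) B.endo where
  invol X := by ext x; simp [conjEnd_apply, h.invol]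
  mem_W k X := by
    simp only [B.endo_proj_eq_zero_iff]
    constructor
    · intro hX i hi a x
      exact (h.mem_W _ _).1 (hX (a.1 + a.2) _ (h.proj_mem_W le_rfl x)) _
        (by simp only [Prod.fst_add, Prod.snd_add]; omega)
    · intro hX j x hx
      rw [← B.sum_proj x, map_sum]
      refine Submodule.sum_mem _ fun a _ => ?_
      by_cases ha : j < a.1 + a.2
      · rw [(h.mem_W _ _).1 hx a ha, map_zero]; exact Submodule.zero_mem _
      refine (h.mem_W _ _).2 fun i hi => ?_
      have := hX (i - a) (by simp only [Prod.fst_sub, Prod.snd_sub]; omega) a x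
      rwa [add_sub_cancel] at this
  mem_F k X := by
    simp only [B.endo_proj_eq_zero_iff]
    constructor
    · intro hX i hi a x
      exact (h.mem_F _ _).1 (hX a.1 _ (h.proj_mem_F le_rfl x)) _
        (by simp only [Prod.fst_add]; omega)
    · intro hX j x hx
      rw [← B.sum_proj x, map_sum]
      refine Submodule.sum_mem _ fun a _ => ?_
      by_cases ha : a.1 < j
      · rw [(h.mem_F _ _).1 hx a ha, map_zero]; exact Submodule.zero_mem _
      refine (h.mem_F _ _).2 fun i hi => ?_
      have := hX (i - a) (by simp only [Prod.fst_sub]; omega) a x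
      rwa [add_sub_cancel] at this
  real i j X hij hj := by
    rw [B.endo_proj_eq_zero_iff]
    intro a x
    set Y := B.endo.proj i X
    have hY : ∀ b y, Y (B.proj b y) = B.proj (b + i) (X (B.proj b y)) :=
      fun b y => B.endo_proj_apply_proj i b X y
    rw [conjEnd_apply]
    conv_lhs => rw [← B.sum_proj (c (B.proj a x)), map_sum, map_sum, map_sum]
    refine Finset.sum_eq_zero fun b _ => ?_
    by_cases hb : b = a.swap
    · rw [hb, hY]
      refine h.real _ _ _ ?_ fun he => hj ?_
      · simp only [Prod.fst_add, Prod.snd_add, Prod.fst_swap, Prod.snd_swap]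
        omega
      rw [Prod.ext_iff] at he ⊢
      simp only [Prod.fst_add, Prod.snd_add, Prod.fst_swap, Prod.snd_swap] at he ⊢
      omega
    by_cases hab : a.1 + a.2 ≤ b.1 + b.2
    · rw [h.real a b x hab hb, map_zero, map_zero, map_zero]
    · rw [hY]
      refine (h.mem_W (a.1 + a.2 + (i.1 + i.2) - 1) _).1 (h.conj_mem (h.proj_mem_W ?_ _)) _ ?_
      · simp only [Prod.fst_add, Prod.snd_add]; omega
      · simp only [Prod.fst_add, Prod.snd_add]; omega

/-- The Deligne splittings of a space and of its endomorphisms are compatible. -/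
theorem apply_mem_delI (hinv : ∀ x, c (c x) = x) (hW : Monotone W) {p q r s : ℤ}
    {X : Module.End ℂ E}
    (hX : X ∈ delI (conjEnd c) (endFil W) (endFil F) p q) {v : E} (hv : v ∈ delI c W F r s) :
    X v ∈ delI c W F (r + p) (s + q) := by
  refine ⟨⟨hX.1.1 _ _ hv.1.1, mem_of_index_eq (hX.1.2 _ _ hv.1.2) (by ring)⟩, ?_⟩
  have step : delR c W F r s ≤ (delR c W F (r + p) (s + q)).comap X := by
    refine delR_le_of_forall fun n l hl hn w hw => ?_
    have : delR (conjEnd c) (endFil W) (endFil F) p q ≤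
        (delR c W F (r + p) (s + q)).comap (LinearMap.applyₗ w) := by
      refine delR_le_of_forall fun m k hk hm Y hY => ?_
      -- The defects n and m of the two generators add up, and the additional drop of weight is
      -- present as soon as one of them is nonzero.
      refine mem_delR hW (n + m) (b := s - n + (q - m)) (l := l + k) (by push_cast; ring)
        (by push_cast; omega) (by push_cast; omega) ⟨?_, hY.2 _ _ hw.2⟩
      have := hY.1 _ _ hw.1
      rw [conjEnd_apply, hinv] at this
      exact this
    exact this hX.2
  exact step hv.2

end Endo
end Splitting

/-! ### The semilinear Galois action on a complexification. -/

section Galois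

variable {H H' : Type*} [AddCommGroup H] [Module ℚ H] [AddCommGroup H'] [Module ℚ H']

@[simp]
theorem gal_tmul (σ : ℂ ≃ₐ[ℚ] ℂ) (z : ℂ) (v : H) : gal σ (z ⊗ₜ[ℚ] v) = σ z ⊗ₜ[ℚ] v := rfl

theorem gal_gal (σ τ : ℂ ≃ₐ[ℚ] ℂ) (x : Cx H) : gal σ (gal τ x) = gal (τ.trans σ) x := by
  induction x using TensorProduct.induction_on with
  | zero => rw [map_zero, map_zero, map_zero]
  | tmul z v => rfl
  | add x y hx hy => simp only [map_add, hx, hy]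

theorem gal_refl (x : Cx H) : gal AlgEquiv.refl x = x := by
  induction x using TensorProduct.induction_on with
  | zero => rw [map_zero]
  | tmul z v => rfl
  | add x y hx hy => simp only [map_add, hx, hy]

@[simp]
theorem gal_symm_gal (σ : ℂ ≃ₐ[ℚ] ℂ) (x : Cx H) : gal σ.symm (gal σ x) = x := by
  rw [gal_gal, AlgEquiv.self_trans_symm, gal_refl]

@[simp]
theorem gal_gal_symm (σ : ℂ ≃ₐ[ℚ] ℂ) (x : Cx H) : gal σ (gal σ.symm x) = x := by
  rw [gal_gal, AlgEquiv.symm_trans_self, gal_refl]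

theorem conjQ_apply (z : ℂ) : conjQ z = starRingEnd ℂ z := rfl

@[simp]
theorem conjQ_conjQ (z : ℂ) : conjQ (conjQ z) = z := by
  rw [conjQ_apply, conjQ_apply, Complex.conj_conj]

@[simp]
theorem gal_conjQ_gal_conjQ (x : Cx H) : gal conjQ (gal conjQ x) = x := by
  have : conjQ.trans conjQ = AlgEquiv.refl := by ext z; exact conjQ_conjQ z
  rw [gal_gal, this, gal_refl]

instance : RingHomInvPair ((conjQ : ℂ ≃ₐ[ℚ] ℂ) : ℂ →+* ℂ) ((conjQ : ℂ ≃ₐ[ℚ] ℂ) : ℂ →+* ℂ) where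
  comp_eq := by ext z; exact conjQ_conjQ z
  comp_eq₂ := by ext z; exact conjQ_conjQ z

theorem gal_smul (σ : ℂ ≃ₐ[ℚ] ℂ) (a : ℂ) (x : Cx H) : gal σ (a • x) = σ a • gal σ x :=
  (gal σ).map_smulₛₗ a x

theorem gal_baseChange (σ : ℂ ≃ₐ[ℚ] ℂ) (f : H →ₗ[ℚ] H') (x : Cx H) :
    gal σ (f.baseChange ℂ x) = f.baseChange ℂ (gal σ x) := by
  induction x using TensorProduct.induction_on with
  | zero => simp
  | tmul z v => simp
  | add x y hx hy => simp only [map_add, hx, hy]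

theorem gal_mem_baseChange (σ : ℂ ≃ₐ[ℚ] ℂ) {S : Submodule ℚ H} {x : Cx H}
    (hx : x ∈ S.baseChange ℂ) : gal σ x ∈ S.baseChange ℂ := by
  obtain ⟨y, rfl⟩ := hx
  rw [gal_baseChange]
  exact ⟨_, rfl⟩

end Galois

/-! ### Mixed Hodge structures as opposed filtrations; Hodge pieces via splittings. -/

section Graded

variable {V : Type*} [AddCommGroup V] [Module ℚ V] (W : WeightFiltration V)

namespace WeightFiltration

/-- A linear extension to `V` of the projection `W_k → Gr_k`. -/
def grMap (k : ℤ) : V →ₗ[ℚ] W.Gr k := ((W.prev k).mkQ.exists_extend).choose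

theorem grMap_comp_subtype (k : ℤ) : W.grMap k ∘ₗ (W.W k).subtype = (W.prev k).mkQ :=
  ((W.prev k).mkQ.exists_extend).choose_spec

/-- The complexification of `grMap`. On `(W_k)_ℂ` it is the projection to `(Gr_k)_ℂ`. -/
def grC (k : ℤ) : Cx V →ₗ[ℂ] Cx (W.Gr k) := (W.grMap k).baseChange ℂ

variable {W}

theorem gal_grC (σ : ℂ ≃ₐ[ℚ] ℂ) (k : ℤ) (x : Cx V) : gal σ (W.grC k x) = W.grC k (gal σ x) :=
  gal_baseChange σ _ x

theorem gal_mem_cx (σ : ℂ ≃ₐ[ℚ] ℂ) {k : ℤ} {x : Cx V} (hx : x ∈ W.cx k) : gal σ x ∈ W.cx k :=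
  gal_mem_baseChange σ hx

theorem grC_subtype (k : ℤ) (w : Cx (W.W k)) :
    W.grC k ((W.W k).subtype.baseChange ℂ w) = (W.prev k).mkQ.baseChange ℂ w := by
  rw [grC, ← LinearMap.comp_apply, ← LinearMap.baseChange_comp, grMap_comp_subtype]

theorem cx_mono : Monotone W.cx := by
  intro k l hkl x hx
  exact Submodule.baseChange_mono ℂ (W.mono hkl) hx

theorem exists_cx_bot : ∃ m, W.cx m = ⊥ := by
  obtain ⟨m, hm⟩ := W.exists_bot
  exact ⟨m, by rw [cx, hm, Submodule.baseChange_bot]⟩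

theorem exists_cx_top : ∃ m, W.cx m = ⊤ := by
  obtain ⟨m, hm⟩ := W.exists_top
  exact ⟨m, by rw [cx, hm, Submodule.baseChange_top]⟩

theorem grC_surjective (k : ℤ) (ξ : Cx (W.Gr k)) : ∃ x ∈ W.cx k, W.grC k x = ξ := by
  obtain ⟨w, rfl⟩ := LinearMap.lTensor_surjective ℂ (W.prev k).mkQ_surjective ξ
  exact ⟨_, ⟨w, rfl⟩, grC_subtype k w⟩

theorem grC_eq_zero_iff {k : ℤ} {x : Cx V} (hx : x ∈ W.cx k) :
    W.grC k x = 0 ↔ x ∈ W.cx (k - 1) := by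
  constructor
  · intro h
    obtain ⟨w, rfl⟩ := hx
    have h' : (W.prev k).mkQ.lTensor ℂ w = 0 := by
      have := grC_subtype (W := W) k w
      rw [h] at this
      exact this.symm
    obtain ⟨u, rfl⟩ := (lTensor_exact ℂ (LinearMap.exact_subtype_mkQ (W.prev k))
      (W.prev k).mkQ_surjective w).1 h'
    refine ⟨((((W.W k).subtype ∘ₗ (W.prev k).subtype).codRestrict (W.W (k - 1))
      fun v => v.2).baseChange ℂ) u, ?_⟩
    change _ = (W.W k).subtype.baseChange ℂ ((W.prev k).subtype.baseChange ℂ u)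
    rw [← LinearMap.comp_apply, ← LinearMap.comp_apply, ← LinearMap.baseChange_comp,
      ← LinearMap.baseChange_comp]
    rfl
  · rintro ⟨w, rfl⟩
    have h1 : W.grMap k ∘ₗ (W.W (k - 1)).subtype = 0 := by
      ext v
      have := LinearMap.congr_fun (W.grMap_comp_subtype k) ⟨v, W.mono (by omega) v.2⟩
      rw [LinearMap.comp_apply] at this ⊢
      rw [LinearMap.zero_apply]
      refine this.trans ?_
      rw [Submodule.mkQ_apply, Submodule.Quotient.mk_eq_zero]
      exact v.2
    rw [grC, ← LinearMap.comp_apply, ← LinearMap.baseChange_comp, h1, LinearMap.baseChange_zero,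
      LinearMap.zero_apply]

end WeightFiltration

open WeightFiltration

variable {W}

theorem mem_inducedFiltration {F : CxFiltration V} {k p : ℤ} {ξ : Cx (W.Gr k)} :
    ξ ∈ inducedFiltration W F k p ↔ ∃ x ∈ F p ⊓ W.cx k, W.grC k x = ξ := by
  constructor
  · rintro ⟨w, hw, rfl⟩
    exact ⟨_, ⟨hw, ⟨w, rfl⟩⟩, grC_subtype k w⟩
  · rintro ⟨x, ⟨hx, ⟨w, rfl⟩⟩, rfl⟩
    exact ⟨w, hx, (grC_subtype k w).symm⟩

theorem mem_conjSubmodule_inducedFiltration {F : CxFiltration V} {k p : ℤ} {ξ : Cx (W.Gr k)} :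
    ξ ∈ conjSubmodule (inducedFiltration W F k p) ↔
      ∃ y ∈ F p ⊓ W.cx k, W.grC k (gal conjQ y) = ξ := by
  rw [conjSubmodule, Submodule.mem_comap, mem_inducedFiltration]
  refine exists_congr fun y => and_congr_right fun _ => ?_
  rw [← gal_grC]
  constructor
  · intro h; rw [h, gal_conjQ_gal_conjQ]
  · intro h; rw [← h, gal_conjQ_gal_conjQ]

theorem IsMixedHodge.opposed {F : CxFiltration V} (h : IsMixedHodge W F) :
    Opposed (gal conjQ) W.cx F where
  invol := gal_conjQ_gal_conjQ
  mono := cx_mono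
  anti := h.anti
  exists_W_bot := exists_cx_bot
  exists_F_bot := h.exists_bot
  conj_mem _ _ hx := gal_mem_cx _ hx
  span k p w hw := by
    have h1 : W.grC k w ∈ inducedFiltration W F k p ⊔
        conjSubmodule (inducedFiltration W F k (k + 1 - p)) := by
      rw [(h.pure k p).sup_eq_top]; trivial
    obtain ⟨ξ, hξ, η, hη, h2⟩ := Submodule.mem_sup.1 h1
    obtain ⟨x, hx, rfl⟩ := mem_inducedFiltration.1 hξ
    obtain ⟨y, hy, rfl⟩ := mem_conjSubmodule_inducedFiltration.1 hη
    refine ⟨x, hx, y, hy, (grC_eq_zero_iff ?_).1 ?_⟩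
    · exact Submodule.sub_mem _ (Submodule.sub_mem _ hw hx.2) (gal_mem_cx _ hy.2)
    · rw [map_sub, map_sub, ← h2]; abel
  disj k p x hx y hy hxy := by
    rw [← grC_eq_zero_iff hx.2]
    have h1 := (grC_eq_zero_iff (Submodule.sub_mem _ hx.2 (gal_mem_cx _ hy.2))).2 hxy
    rw [map_sub, sub_eq_zero] at h1
    exact Submodule.disjoint_def.1 (h.pure k p).disjoint _ (mem_inducedFiltration.2 ⟨x, hx, rfl⟩)
      (mem_conjSubmodule_inducedFiltration.2 ⟨y, hy, h1.symm⟩)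

theorem IsSplitting.isMixedHodge {F : CxFiltration V} {B : Bigrading (Cx V)}
    (h : IsSplitting (gal conjQ) W.cx F B) : IsMixedHodge W F where
  anti := h.anti
  exists_top := h.exists_F_top
  exists_bot := h.exists_F_bot
  pure k p := by
    refine ⟨Submodule.disjoint_def.2 ?_, codisjoint_iff_le_sup.2 ?_⟩
    · intro ξ hξ hη
      obtain ⟨x, hx, rfl⟩ := mem_inducedFiltration.1 hξ
      obtain ⟨y, hy, hxy⟩ := mem_conjSubmodule_inducedFiltration.1 hη
      rw [grC_eq_zero_iff hx.2]
      refine h.opposed.disj k p x hx y hy ?_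
      rw [← grC_eq_zero_iff (Submodule.sub_mem _ hx.2 (gal_mem_cx _ hy.2)), map_sub, hxy, sub_self]
    · intro ξ _
      obtain ⟨w, hw, rfl⟩ := grC_surjective k ξ
      obtain ⟨x, hx, y, hy, hxy⟩ := h.opposed.span k p w hw
      have h1 := (grC_eq_zero_iff (Submodule.sub_mem _ (Submodule.sub_mem _ hw hx.2)
        (gal_mem_cx _ hy.2))).2 hxy
      rw [map_sub, map_sub, sub_sub, sub_eq_zero] at h1
      rw [h1]
      exact Submodule.add_mem_sup (mem_inducedFiltration.2 ⟨x, hx, rfl⟩)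
        (mem_conjSubmodule_inducedFiltration.2 ⟨y, hy, rfl⟩)

theorem mem_hodgePiece {F : CxFiltration V} {k p q : ℤ} {ξ : Cx (W.Gr k)} :
    ξ ∈ hodgePiece (inducedFiltration W F k) p q ↔
      ∃ x ∈ F p ⊓ W.cx k, ∃ y ∈ F q ⊓ W.cx k, x - gal conjQ y ∈ W.cx (k - 1) ∧
        W.grC k x = ξ := by
  constructor
  · rintro ⟨h1, h2⟩
    obtain ⟨x, hx, rfl⟩ := mem_inducedFiltration.1 h1
    obtain ⟨y, hy, hxy⟩ := mem_conjSubmodule_inducedFiltration.1 h2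
    refine ⟨x, hx, y, hy, ?_, rfl⟩
    rw [← grC_eq_zero_iff (Submodule.sub_mem _ hx.2 (gal_mem_cx _ hy.2)), map_sub, hxy, sub_self]
  · rintro ⟨x, hx, y, hy, hxy, rfl⟩
    refine ⟨mem_inducedFiltration.2 ⟨x, hx, rfl⟩,
      mem_conjSubmodule_inducedFiltration.2 ⟨y, hy, ?_⟩⟩
    rw [← grC_eq_zero_iff (Submodule.sub_mem _ hx.2 (gal_mem_cx _ hy.2)), map_sub,
      sub_eq_zero] at hxy
    exact hxy.symm

namespace IsSplitting

variable {F : CxFiltration V} {B : Bigrading (Cx V)}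

theorem grC_proj_mem_hodgePiece (h : IsSplitting (gal conjQ) W.cx F B) {p q k : ℤ}
    (hk : p + q = k) (x : Cx V) :
    W.grC k (B.proj (p, q) x) ∈ hodgePiece (inducedFiltration W F k) p q := by
  refine mem_hodgePiece.2 ⟨_, ⟨h.proj_mem_F (i := (p, q)) le_rfl x,
    h.proj_mem_W (i := (p, q)) hk.le x⟩, B.proj (q, p) (gal conjQ (B.proj (p, q) x)),
    ⟨h.proj_mem_F (i := (q, p)) le_rfl _, h.proj_mem_W (i := (q, p)) (by simp only; omega) _⟩,
    ?_, rfl⟩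
  have := h.conj_mem (h.conj_proj_sub (i := (p, q)) (k := k - 1) (by simp only; omega) x)
  rwa [map_sub, h.invol] at this

theorem exists_proj_of_mem_hodgePiece (h : IsSplitting (gal conjQ) W.cx F B) {p q k : ℤ}
    (hk : p + q = k) {ξ : Cx (W.Gr k)} (hξ : ξ ∈ hodgePiece (inducedFiltration W F k) p q) :
    ∃ x, W.grC k (B.proj (p, q) x) = ξ := by
  obtain ⟨x, hx, y, hy, hxy, rfl⟩ := mem_hodgePiece.1 hξ
  refine ⟨x, ?_⟩
  rw [eq_comm, ← sub_eq_zero, ← map_sub, grC_eq_zero_iff]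
  · refine (h.mem_W _ _).2 fun l hl => ?_
    rw [map_sub]
    by_cases hlp : l = (p, q)
    · subst hlp; rw [B.proj_self, sub_self]
    · rw [B.proj_ne hlp, sub_zero]
      exact h.proj_eq_zero_of_type hx hy hxy hk (by omega) hlp
  · exact Submodule.sub_mem _ hx.2 (h.proj_mem_W (i := (p, q)) hk.le x)

/-- The summand of type (p,q) maps isomorphically onto the Hodge piece in Gr_{p+q}. Hodge numbers
can thus be computed from any splitting, not only from Deligne's. -/
theorem finrank_hodgePiece (h : IsSplitting (gal conjQ) W.cx F B) (p q : ℤ) :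
    Module.finrank ℂ (hodgePiece (inducedFiltration W F (p + q)) p q) =
      Module.finrank ℂ (LinearMap.range (B.proj (p, q))) := by
  have hinj : Function.Injective
      (W.grC (p + q) ∘ₗ (LinearMap.range (B.proj (p, q))).subtype) := by
    rw [injective_iff_map_eq_zero]
    rintro ⟨_, x, rfl⟩ hx
    rw [LinearMap.comp_apply, Submodule.subtype_apply,
      grC_eq_zero_iff (h.proj_mem_W (i := (p, q)) le_rfl x)] at hx
    have := (h.mem_W _ _).1 hx (p, q) (by simp only; omega)
    rw [B.proj_self] at this
    exact Subtype.ext this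
  rw [← LinearMap.finrank_range_of_inj hinj]
  have : hodgePiece (inducedFiltration W F (p + q)) p q =
      LinearMap.range (W.grC (p + q) ∘ₗ (LinearMap.range (B.proj (p, q))).subtype) := by
    ext ξ
    constructor
    · intro hξ
      obtain ⟨x, rfl⟩ := h.exists_proj_of_mem_hodgePiece rfl hξ
      exact ⟨⟨_, x, rfl⟩, rfl⟩
    · rintro ⟨⟨_, x, rfl⟩, rfl⟩
      exact h.grC_proj_mem_hodgePiece rfl x
  rw [this]

end IsSplitting

end Graded

/-! ### The Deligne torus of a mixed Hodge structure. -/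

section Torus

variable {V : Type*} [AddCommGroup V] [Module ℚ V] [Module.Finite ℚ V]
  {W : WeightFiltration V} {F : CxFiltration V}

namespace IsMixedHodge

/-- The Deligne bigrading of a mixed Hodge structure. -/
def bigrading (h : IsMixedHodge W F) : Bigrading (Cx V) :=
  h.opposed.bigrading WeightFiltration.exists_cx_top h.exists_top

theorem isSplitting (h : IsMixedHodge W F) : IsSplitting (gal conjQ) W.cx F h.bigrading :=
  h.opposed.isSplitting_bigrading _ _

theorem proj_mem_deligneI (h : IsMixedHodge W F) (i : ℤ × ℤ) (x : Cx V) :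
    h.bigrading.proj i x ∈ deligneI W F i.1 i.2 :=
  h.opposed.bigrading_proj_mem _ _ i x

theorem proj_of_mem_deligneI (h : IsMixedHodge W F) {i : ℤ × ℤ} {x : Cx V}
    (hx : x ∈ deligneI W F i.1 i.2) : h.bigrading.proj i x = x :=
  h.opposed.bigrading_proj_of_mem _ _ hx

theorem isDeligneTorus_torus (h : IsMixedHodge W F) : IsDeligneTorus W F h.bigrading.torus := by
  intro p q v hv z
  rw [← h.proj_of_mem_deligneI (i := (p, q)) hv, Bigrading.torus_apply, Bigrading.scalar_proj]
  rfl

theorem isDeligneTorus_deligneTorus (h : IsMixedHodge W F) :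
    IsDeligneTorus W F (deligneTorus W F) := by
  have hex : ∃ χ, IsDeligneTorus W F χ := ⟨_, h.isDeligneTorus_torus⟩
  rw [deligneTorus, dif_pos hex]
  exact hex.choose_spec

/-- The I^{p,q} span, so a Deligne torus is unique and the choice made in `deligneTorus` is
immaterial. -/
theorem deligneTorus_eq (h : IsMixedHodge W F) : deligneTorus W F = h.bigrading.torus := by
  ext z x
  have : (deligneTorus W F z).toLinearMap = (h.bigrading.torus z).toLinearMap := by
    refine h.bigrading.linearMap_ext fun i x => ?_
    exact (h.isDeligneTorus_deligneTorus _ _ _ (h.proj_mem_deligneI i x) z).trans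
      (h.isDeligneTorus_torus _ _ _ (h.proj_mem_deligneI i x) z).symm
  exact LinearMap.congr_fun this x

end IsMixedHodge
end Torus

/-! ### The fixed field of Aut(ℂ/ℚ). -/

section FixedField

/-- A ring automorphism of a polynomial algebra on a transcendence basis extends to an
automorphism of an algebraically closed field. -/
theorem exists_extension_of_transcendenceBasis {R : Type*} [Field R] [Algebra R ℂ] {ι : Type*}
    {v : ι → ℂ} (hv : IsTranscendenceBasis R v) (φ : MvPolynomial ι R ≃+* MvPolynomial ι R) :
    ∃ σ : ℂ ≃+* ℂ, ∀ P, σ (MvPolynomial.aeval v P) = MvPolynomial.aeval v (φ P) := by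
  have := IsAlgClosed.isAlgClosure_of_transcendence_basis v hv
  let e : Algebra.adjoin R (Set.range v) ≃+* Algebra.adjoin R (Set.range v) :=
    (hv.1.aevalEquiv.symm.toRingEquiv.trans φ).trans hv.1.aevalEquiv.toRingEquiv
  have he : ∀ P, e (hv.1.aevalEquiv P) = hv.1.aevalEquiv (φ P) := fun P => by
    change hv.1.aevalEquiv (φ (hv.1.aevalEquiv.symm (hv.1.aevalEquiv P))) = _
    rw [AlgEquiv.symm_apply_apply]
  refine ⟨IsAlgClosure.equivOfEquiv ℂ ℂ e, fun P => ?_⟩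
  have := IsAlgClosure.equivOfEquiv_algebraMap ℂ ℂ e (hv.1.aevalEquiv P)
  rw [he] at this
  simpa using this

/-- If z is algebraic, automorphisms of the algebraic closure of ℚ extend to ℂ and Galois theory
applies. If z is transcendental, it belongs to a transcendence basis, and the shift X ↦ X+1 of all
basis elements extends to an automorphism that moves z. -/
theorem exists_rat_of_fixed {z : ℂ} (hz : ∀ σ : ℂ ≃ₐ[ℚ] ℂ, σ z = z) : ∃ q : ℚ, (q : ℂ) = z := by
  have hz' : ∀ σ : ℂ ≃+* ℂ, σ z = z := fun σ => hz (AlgEquiv.ofRingEquiv (f := σ) (by simp))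
  by_cases halg : IsAlgebraic ℚ z
  · have hzA : z ∈ algebraicClosure ℚ ℂ := mem_algebraicClosure_iff.2 halg
    have hfix : ∀ τ : algebraicClosure ℚ ℂ ≃ₐ[ℚ] algebraicClosure ℚ ℂ, τ ⟨z, hzA⟩ = ⟨z, hzA⟩ := by
      intro τ
      obtain ⟨s, hs⟩ := exists_isTranscendenceBasis (algebraicClosure ℚ ℂ) ℂ
      obtain ⟨σ, hσ⟩ := exists_extension_of_transcendenceBasis hs
        (MvPolynomial.mapEquiv _ τ.toRingEquiv)
      have := hσ (MvPolynomial.C ⟨z, hzA⟩)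
      rw [MvPolynomial.mapEquiv_apply, MvPolynomial.map_C, MvPolynomial.aeval_C,
        MvPolynomial.aeval_C] at this
      have h2 := hz' σ
      exact Subtype.ext (this.symm.trans h2)
    have : IsGalois ℚ (algebraicClosure ℚ ℂ) := by
      have : IsAlgClosure ℚ (algebraicClosure ℚ ℂ) := by
        convert algebraicClosure.isAlgClosure ℚ ℂ
        · rfl
        · exact Subsingleton.elim (α := Algebra ℚ (algebraicClosure ℚ ℂ)) _ _
      exact IsAlgClosure.isGalois ℚ _
    have := (InfiniteGalois.mem_bot_iff_fixed (k := ℚ) _).2 hfix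
    obtain ⟨q, hq⟩ := IntermediateField.mem_bot.1 this
    refine ⟨q, ?_⟩
    have := congrArg Subtype.val hq
    simpa using this
  · exfalso
    have hind : AlgebraicIndepOn ℚ id ({z} : Set ℂ) := by
      exact algebraicIndependent_unique_type_iff.2 halg
    obtain ⟨t, ht, hb⟩ := exists_isTranscendenceBasis_superset hind
    let φ : MvPolynomial t ℚ ≃ₐ[ℚ] MvPolynomial t ℚ := AlgEquiv.ofAlgHom
      (MvPolynomial.aeval fun i => MvPolynomial.X i + 1)
      (MvPolynomial.aeval fun i => MvPolynomial.X i - 1) (by ext i; simp) (by ext i; simp)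
    obtain ⟨σ, hσ⟩ := exists_extension_of_transcendenceBasis hb φ.toRingEquiv
    have := hσ (MvPolynomial.X ⟨z, ht rfl⟩)
    simp [φ, hz' σ] at this

end FixedField

/-! ### Galois descent for spaces of polynomials. -/

section Descent

/-- Galois descent for spaces of polynomials. -/
theorem mem_span_rational {τ : Type*} (N : Submodule ℂ (MvPolynomial τ ℂ))
    (hN : ∀ σ : ℂ ≃ₐ[ℚ] ℂ, ∀ P ∈ N, MvPolynomial.map (σ : ℂ →+* ℂ) P ∈ N)
    {P : MvPolynomial τ ℂ} (hP : P ∈ N) :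
    P ∈ Submodule.span ℂ {P' | P' ∈ N ∧ ∃ R, MvPolynomial.map (algebraMap ℚ ℂ) R = P'} := by
  classical
  induction hn : P.support.card using Nat.strong_induction_on generalizing P with
  | _ n ih =>
  by_cases hP0 : P = 0
  · rw [hP0]; exact Submodule.zero_mem _
  -- Take a nonzero element of N of minimal support inside that of P, normalized to have one
  -- coefficient 1. Its difference with a Galois conjugate has smaller support and must vanish, so
  -- its coefficients are rational. Subtracting a multiple of it shrinks the support of P.
  obtain ⟨Q, ⟨hQ, hQ0, hQP⟩, hmin⟩ := exists_minimalFor_of_wellFoundedLT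
    (fun Q : MvPolynomial τ ℂ => Q ∈ N ∧ Q ≠ 0 ∧ Q.support ⊆ P.support)
    (fun Q => Q.support.card) ⟨P, hP, hP0, subset_rfl⟩
  obtain ⟨m, hm⟩ := MvPolynomial.support_nonempty.2 hQ0
  have hm0 := MvPolynomial.mem_support_iff.1 hm
  set Q₁ := (Q.coeff m)⁻¹ • Q with hQ₁
  have hQ₁N : Q₁ ∈ N := N.smul_mem _ hQ
  have hQ₁m : Q₁.coeff m = 1 := by simp [hQ₁, hm0]
  have hQ₁s : ∀ d, Q.coeff d = 0 → Q₁.coeff d = 0 := fun d hd => by simp [hQ₁, hd]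
  have hfix : ∀ σ : ℂ ≃ₐ[ℚ] ℂ, MvPolynomial.map (σ : ℂ →+* ℂ) Q₁ = Q₁ := by
    intro σ
    by_contra hne
    set D := MvPolynomial.map (σ : ℂ →+* ℂ) Q₁ - Q₁ with hD
    have hDc : ∀ d, D.coeff d = σ (Q₁.coeff d) - Q₁.coeff d := fun d => by
      rw [hD, MvPolynomial.coeff_sub, MvPolynomial.coeff_map]; rfl
    have hsub : D.support ⊆ Q.support.erase m := by
      intro d hd
      rw [MvPolynomial.mem_support_iff, hDc] at hd
      refine Finset.mem_erase.2 ⟨?_, MvPolynomial.mem_support_iff.2 fun h => ?_⟩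
      · rintro rfl; simp [hQ₁m] at hd
      · simp [hQ₁s d h] at hd
    have hDmem : D ∈ N := N.sub_mem (hN σ _ hQ₁N) hQ₁N
    have := hmin ⟨hDmem, sub_ne_zero.2 hne, hsub.trans ((Finset.erase_subset _ _).trans hQP)⟩
      ((Finset.card_le_card hsub).trans (Finset.card_erase_le))
    have h2 := (Finset.card_le_card hsub).trans_lt (Finset.card_erase_lt_of_mem hm)
    simp only at this
    omega
  have hrat : ∃ R, MvPolynomial.map (algebraMap ℚ ℂ) R = Q₁ := by
    refine MvPolynomial.mem_range_map_iff_coeffs_subset.2 fun a ha => ?_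
    obtain ⟨d, _, rfl⟩ := MvPolynomial.mem_coeffs_iff.1 ha
    obtain ⟨q, hq⟩ := exists_rat_of_fixed (z := Q₁.coeff d) fun σ => by
      have := congrArg (MvPolynomial.coeff d) (hfix σ)
      rwa [MvPolynomial.coeff_map] at this
    exact ⟨q, hq⟩
  have hlt : (P - P.coeff m • Q₁).support.card < n := by
    rw [← hn]
    refine (Finset.card_le_card (t := P.support.erase m) ?_).trans_lt
      (Finset.card_erase_lt_of_mem (hQP hm))
    intro d hd
    rw [MvPolynomial.mem_support_iff, MvPolynomial.coeff_sub, MvPolynomial.coeff_smul] at hd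
    refine Finset.mem_erase.2 ⟨?_, MvPolynomial.mem_support_iff.2 fun h => ?_⟩
    · rintro rfl; simp [hQ₁m] at hd
    · have : Q.coeff d = 0 := by
        by_contra h'
        exact MvPolynomial.mem_support_iff.1 (hQP (MvPolynomial.mem_support_iff.2 h')) h
      simp [hQ₁s d this, h] at hd
  have h1 := ih _ hlt (N.sub_mem hP (N.smul_mem (P.coeff m) hQ₁N)) rfl
  have h2 := Submodule.add_mem _ h1 (Submodule.smul_mem _ (P.coeff m)
    (Submodule.subset_span ⟨hQ₁N, hrat⟩))
  rwa [sub_add_cancel] at h2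

end Descent

/-! ### Galois conjugates of automorphisms. -/

section GalConj

variable {V : Type*} [AddCommGroup V] [Module ℚ V]

/-- The Galois conjugate of an automorphism of `V_ℂ`. -/
def galConj (σ : ℂ ≃ₐ[ℚ] ℂ) (g : GLC V) : GLC V :=
  LinearEquiv.ofLinearMap
    { toFun := fun x => gal σ (g (gal σ.symm x))
      map_add' := fun x y => by simp only [map_add]
      map_smul' := fun a x => by
        rw [gal_smul, map_smul, gal_smul, AlgEquiv.apply_symm_apply]; rfl }
    { toFun := fun x => gal σ (g.symm (gal σ.symm x))
      map_add' := fun x y => by simp only [map_add]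
      map_smul' := fun a x => by
        rw [gal_smul, map_smul, gal_smul, AlgEquiv.apply_symm_apply]; rfl }
    (by ext x; simp) (by ext x; simp)

theorem galConj_apply (σ : ℂ ≃ₐ[ℚ] ℂ) (g : GLC V) (x : Cx V) :
    galConj σ g x = gal σ (g (gal σ.symm x)) := rfl

theorem galConj_galConj_symm (σ : ℂ ≃ₐ[ℚ] ℂ) (g : GLC V) :
    galConj σ (galConj σ.symm g) = g := by
  ext x
  change gal σ (gal σ.symm (g (gal σ (gal σ.symm x)))) = g x
  rw [gal_gal_symm, gal_gal_symm]

theorem isGaloisConj_iff {σ : ℂ ≃ₐ[ℚ] ℂ} {g g' : GLC V} :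
    IsGaloisConj σ g g' ↔ g' = galConj σ g := by
  constructor
  · intro h
    ext x
    rw [galConj_apply, ← h, gal_gal_symm]
  · rintro rfl x
    rw [galConj_apply, gal_symm_gal]

end GalConj

/-! ### Polynomial functions of matrices and closedness over ℚ. -/

section PolyFun

variable {V : Type*} [AddCommGroup V] [Module ℚ V] [Module.Finite ℚ V]

/-- Complex polynomial functions in the matrix entries. -/
def IsPolyFun (f : Module.End ℂ (Cx V) → ℂ) : Prop :=
  ∃ P : MvPolynomial (Fin (Module.finrank ℚ V) × Fin (Module.finrank ℚ V)) ℂ,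
    ∀ X, f X = MvPolynomial.eval (entries X) P

namespace IsPolyFun

variable {f g : Module.End ℂ (Cx V) → ℂ}

theorem const (a : ℂ) : IsPolyFun (fun _ : Module.End ℂ (Cx V) => a) :=
  ⟨MvPolynomial.C a, fun X => by simp⟩

theorem add (hf : IsPolyFun f) (hg : IsPolyFun g) : IsPolyFun fun X => f X + g X := by
  obtain ⟨P, hP⟩ := hf
  obtain ⟨Q, hQ⟩ := hg
  exact ⟨P + Q, fun X => by simp only [map_add, hP, hQ]⟩

theorem mul (hf : IsPolyFun f) (hg : IsPolyFun g) : IsPolyFun fun X => f X * g X := by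
  obtain ⟨P, hP⟩ := hf
  obtain ⟨Q, hQ⟩ := hg
  exact ⟨P * Q, fun X => by simp only [map_mul, hP, hQ]⟩

theorem sub (hf : IsPolyFun f) (hg : IsPolyFun g) : IsPolyFun fun X => f X - g X := by
  obtain ⟨P, hP⟩ := hf
  obtain ⟨Q, hQ⟩ := hg
  exact ⟨P - Q, fun X => by simp only [map_sub, hP, hQ]⟩

theorem sum {κ : Type*} (s : Finset κ) {F : κ → Module.End ℂ (Cx V) → ℂ}
    (hF : ∀ k ∈ s, IsPolyFun (F k)) : IsPolyFun fun X => ∑ k ∈ s, F k X := by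
  classical
  induction s using Finset.induction_on with
  | empty => simpa using const 0
  | insert a s ha ih =>
    simp only [Finset.sum_insert ha]
    exact (hF a (Finset.mem_insert_self _ _)).add
      (ih fun k hk => hF k (Finset.mem_insert_of_mem hk))

theorem entry (ij : Fin (Module.finrank ℚ V) × Fin (Module.finrank ℚ V)) :
    IsPolyFun fun X : Module.End ℂ (Cx V) => entries X ij :=
  ⟨MvPolynomial.X ij, fun X => by simp⟩

theorem linear (l : Module.End ℂ (Cx V) →ₗ[ℂ] ℂ) : IsPolyFun l := by
  have : ∀ X, l X = ∑ i, ∑ j, entries X (i, j) *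
      l (Matrix.toLin (cxBasis V) (cxBasis V) (Matrix.single i j 1)) := by
    intro X
    conv_lhs => rw [← Matrix.toLin_toMatrix (cxBasis V) (cxBasis V) X,
      Matrix.matrix_eq_sum_single (LinearMap.toMatrix (cxBasis V) (cxBasis V) X)]
    simp only [map_sum]
    refine Finset.sum_congr rfl fun i _ => Finset.sum_congr rfl fun j _ => ?_
    have : Matrix.single i j (LinearMap.toMatrix (cxBasis V) (cxBasis V) X i j) =
        entries X (i, j) • Matrix.single i j (1 : ℂ) := by
      rw [Matrix.smul_single, smul_eq_mul, mul_one]; rfl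
    rw [this, map_smul, map_smul, smul_eq_mul]
  rw [show (l : Module.End ℂ (Cx V) → ℂ) = _ from funext this]
  exact sum _ fun i _ => sum _ fun j _ => (entry _).mul (const _)

theorem comp_linear (hf : IsPolyFun f) (φ : Module.End ℂ (Cx V) →ₗ[ℂ] Module.End ℂ (Cx V)) :
    IsPolyFun fun X => f (φ X) := by
  obtain ⟨P, hP⟩ := hf
  have h : ∀ ij, ∃ Q : MvPolynomial (Fin (Module.finrank ℚ V) × Fin (Module.finrank ℚ V)) ℂ,
      ∀ X, entries (φ X) ij = MvPolynomial.eval (entries X) Q := fun ij =>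
    linear ((Matrix.entryLinearMap ℂ ℂ ij.1 ij.2) ∘ₗ
      (LinearMap.toMatrix (cxBasis V) (cxBasis V)).toLinearMap ∘ₗ φ)
  choose Q hQ using h
  refine ⟨MvPolynomial.bind₁ Q P, fun X => ?_⟩
  change f (φ X) = _
  rw [hP, ← MvPolynomial.coe_aeval_eq_eval, ← MvPolynomial.coe_aeval_eq_eval, RingHom.coe_coe,
    RingHom.coe_coe, MvPolynomial.aeval_bind₁]
  congr 2
  funext ij
  rw [hQ, ← MvPolynomial.coe_aeval_eq_eval]; rfl

/-- Linear forms on `V_ℂ` evaluated on the image of a vector. -/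
theorem apply (l : Cx V →ₗ[ℂ] ℂ) (x : Cx V) :
    IsPolyFun fun X : Module.End ℂ (Cx V) => l (X x) :=
  linear (l ∘ₗ LinearMap.applyₗ x)

theorem bilin (b : Cx V →ₗ[ℂ] Cx V →ₗ[ℂ] ℂ) (x y : Cx V) :
    IsPolyFun fun X : Module.End ℂ (Cx V) => b (X x) (X y) := by
  have : ∀ X : Module.End ℂ (Cx V), b (X x) (X y) = ∑ i, ∑ j, (cxBasis V).coord i (X x) *
      ((cxBasis V).coord j (X y) * b (cxBasis V i) (cxBasis V j)) := by
    intro X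
    conv_lhs => rw [← (cxBasis V).sum_repr (X x), ← (cxBasis V).sum_repr (X y)]
    simp only [map_sum, map_smul, LinearMap.sum_apply, LinearMap.smul_apply, smul_eq_mul,
      Module.Basis.coord_apply]
    rw [Finset.sum_comm]
    simp only [Finset.mul_sum]
    exact Finset.sum_congr rfl fun i _ => Finset.sum_congr rfl fun j _ => by ring
  rw [show (fun X : Module.End ℂ (Cx V) => b (X x) (X y)) = _ from funext this]
  exact sum _ fun i _ => sum _ fun j _ => (apply _ x).mul ((apply _ y).mul (const _))

end IsPolyFun

theorem gal_cxBasis (σ : ℂ ≃ₐ[ℚ] ℂ) (j : Fin (Module.finrank ℚ V)) :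
    gal σ (cxBasis V j) = cxBasis V j := by
  rw [cxBasis, Algebra.TensorProduct.basis_apply, gal_tmul, map_one]

theorem entries_galConj (σ : ℂ ≃ₐ[ℚ] ℂ) (g : GLC V) (ij) :
    entries (galConj σ g).toLinearMap ij = σ (entries g.toLinearMap ij) := by
  rw [entries, entries, LinearMap.toMatrix_apply, LinearMap.toMatrix_apply]
  change (cxBasis V).repr (gal σ (g (gal σ.symm (cxBasis V ij.2)))) ij.1 =
    σ ((cxBasis V).repr (g (cxBasis V ij.2)) ij.1)
  rw [gal_cxBasis]
  set y := g (cxBasis V ij.2)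
  conv_lhs => rw [← (cxBasis V).sum_repr y, map_sum]
  simp only [gal_smul, gal_cxBasis]
  simp [Finsupp.single_apply]

/-- A set of automorphisms stable under all Galois conjugations. -/
def GalStable (A : Set (GLC V)) : Prop := ∀ σ : ℂ ≃ₐ[ℚ] ℂ, ∀ g ∈ A, galConj σ g ∈ A

theorem aeval_entries_galConj (σ : ℂ ≃ₐ[ℚ] ℂ) (g : GLC V) (P : MatPoly V) :
    MvPolynomial.aeval (entries (galConj σ g).toLinearMap) P =
      σ (MvPolynomial.aeval (entries g.toLinearMap) P) := by
  have : entries (galConj σ g).toLinearMap = fun ij => σ.toAlgHom (entries g.toLinearMap ij) :=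
    funext fun ij => entries_galConj σ g ij
  rw [this, ← MvPolynomial.comp_aeval_apply]
  rfl

theorem IsQClosed.galStable {A : Set (GLC V)} (hA : IsQClosed A) : GalStable A := by
  obtain ⟨S, rfl⟩ := hA
  intro σ g hg P hP
  rw [aeval_entries_galConj, hg P hP, map_zero]

theorem eval_entries_galConj (σ : ℂ ≃ₐ[ℚ] ℂ) (g : GLC V)
    (P : MvPolynomial (Fin (Module.finrank ℚ V) × Fin (Module.finrank ℚ V)) ℂ) :
    MvPolynomial.eval (entries (galConj σ g).toLinearMap)
      (MvPolynomial.map (σ : ℂ →+* ℂ) P) = σ (MvPolynomial.eval (entries g.toLinearMap) P) := by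
  have : entries (galConj σ g).toLinearMap = fun ij => σ (entries g.toLinearMap ij) :=
    funext fun ij => entries_galConj σ g ij
  rw [this, MvPolynomial.eval_map]
  exact (MvPolynomial.eval₂_comp (σ : ℂ →+* ℂ) _ P).symm

/-- The complex polynomials vanishing on a Galois stable set are spanned by rational ones. -/
theorem mem_span_of_vanishing {A : Set (GLC V)} (hA : GalStable A)
    {P : MvPolynomial (Fin (Module.finrank ℚ V) × Fin (Module.finrank ℚ V)) ℂ}
    (hP : ∀ g ∈ A, MvPolynomial.eval (entries g.toLinearMap) P = 0) :
    P ∈ Submodule.span ℂ {P' | ∃ R : MatPoly V, MvPolynomial.map (algebraMap ℚ ℂ) R = P' ∧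
      ∀ g ∈ A, MvPolynomial.aeval (entries g.toLinearMap) R = 0} := by
  let N : Submodule ℂ (MvPolynomial (Fin (Module.finrank ℚ V) × Fin (Module.finrank ℚ V)) ℂ) :=
    { carrier := {P | ∀ g ∈ A, MvPolynomial.eval (entries g.toLinearMap) P = 0}
      add_mem' := fun hP hQ g hg => by rw [map_add, hP g hg, hQ g hg, add_zero]
      zero_mem' := fun g _ => map_zero _
      smul_mem' := fun a P hP g hg => by rw [MvPolynomial.smul_eval, hP g hg, mul_zero] }
  refine Submodule.span_mono ?_ (mem_span_rational N ?_ (P := P) hP)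
  · rintro _ ⟨h1, R, rfl⟩
    refine ⟨R, rfl, fun g hg => ?_⟩
    have := h1 g hg
    rwa [MvPolynomial.eval_map, ← MvPolynomial.aeval_def] at this
  · intro σ P hP g hg
    have := eval_entries_galConj σ (galConj σ.symm g) P
    rw [hP _ (hA _ _ hg), map_zero] at this
    rwa [galConj_galConj_symm] at this

/-- A Galois stable subset cut out by complex polynomials is closed over `ℚ`. -/
theorem isQClosed_of_polyFun {κ : Type*} {A : Set (GLC V)}
    {f : κ → Module.End ℂ (Cx V) → ℂ} (hf : ∀ k, IsPolyFun (f k))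
    (hA : ∀ g : GLC V, g ∈ A ↔ ∀ k, f k g.toLinearMap = 0) (hs : GalStable A) : IsQClosed A := by
  refine ⟨{R | ∀ g ∈ A, MvPolynomial.aeval (entries g.toLinearMap) R = 0}, ?_⟩
  ext g
  refine ⟨fun hg R hR => hR g hg, fun hg => (hA g).2 fun k => ?_⟩
  obtain ⟨P, hP⟩ := hf k
  have h1 := mem_span_of_vanishing hs (P := P) fun g hg => by rw [← hP, (hA g).1 hg k]
  rw [hP]
  clear hP
  induction h1 using Submodule.span_induction with
  | mem P' h =>
    obtain ⟨R, rfl, hR⟩ := h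
    rw [MvPolynomial.eval_map, ← MvPolynomial.aeval_def]
    exact hg R hR
  | zero => simp
  | add P Q _ _ hP hQ => rw [map_add, hP, hQ, add_zero]
  | smul a P _ hP => rw [MvPolynomial.smul_eval, hP, mul_zero]

end PolyFun

/-! ### Polynomials along one-parameter subgroups of a Banach algebra. -/

section AbstractExponential

variable {A : Type*} [NormedRing A] [NormedAlgebra ℂ A]

theorem exp_mul_exp_neg [CompleteSpace A] (X : A) : NormedSpace.exp X * NormedSpace.exp (-X) = 1 := by
  let : NormedAlgebra ℚ A := NormedAlgebra.restrictScalars ℚ ℂ A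
  rw [← NormedSpace.exp_add_of_commute (Commute.neg_right rfl), add_neg_cancel,
    NormedSpace.exp_zero]

theorem exp_neg_mul_exp [CompleteSpace A] (X : A) : NormedSpace.exp (-X) * NormedSpace.exp X = 1 := by
  have := exp_mul_exp_neg (-X)
  rwa [neg_neg] at this

variable {ι : Type*} [Fintype ι] [DecidableEq ι] (e : ι → A →L[ℂ] ℂ)

theorem hasDerivAt_eval {m : ℂ → A} {m' : A} {t : ℂ} (hm : HasDerivAt m m' t)
    (P : MvPolynomial ι ℂ) :
    HasDerivAt (fun s => MvPolynomial.eval (fun i => e i (m s)) P)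
      (∑ i, MvPolynomial.eval (fun i => e i (m t)) (MvPolynomial.pderiv i P) * e i m') t := by
  induction P using MvPolynomial.induction_on with
  | C a => simpa using hasDerivAt_const t a
  | add P Q hP hQ =>
    simp only [map_add, add_mul, Finset.sum_add_distrib]
    exact hP.add hQ
  | mul_X P i hP =>
    have h1 : HasDerivAt (fun s => e i (m s)) (e i m') t :=
      (e i).hasFDerivAt.comp_hasDerivAt t hm
    have := hP.mul h1
    simp only [map_mul, MvPolynomial.eval_X]
    refine this.congr_deriv ?_
    simp only [Derivation.leibniz, MvPolynomial.pderiv_X, smul_eq_mul, map_add, map_mul,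
      MvPolynomial.eval_X, add_mul, Finset.sum_add_distrib, Finset.sum_mul]
    rw [add_comm]
    congr 1
    · rw [Finset.sum_eq_single i]
      · simp
      · intro b _ hb
        simp [hb.symm]
      · simp
    · exact Finset.sum_congr rfl fun _ _ => by ring

/-- If the values of `P` along `s ↦ a (1 + s X)` are those of `P'` along `s ↦ 1 + s X`, the
derivatives at `s = 0` agree. -/
theorem sum_pderiv_translate (a X : A) {P P' : MvPolynomial ι ℂ}
    (h : ∀ Y, MvPolynomial.eval (fun i => e i (a * Y)) P = MvPolynomial.eval (fun i => e i Y) P') :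
    ∑ i, MvPolynomial.eval (fun i => e i a) (MvPolynomial.pderiv i P) * e i (a * X) =
      ∑ i, MvPolynomial.eval (fun i => e i 1) (MvPolynomial.pderiv i P') * e i X := by
  have h1 : HasDerivAt (fun s : ℂ => (1 : A) + s • X) X 0 := by
    simpa using ((hasDerivAt_id (0 : ℂ)).smul_const X).const_add 1
  have h2 := hasDerivAt_eval e h1 P'
  have h4 := hasDerivAt_eval e (h1.const_mul a) P
  simp only [zero_smul, add_zero, mul_one] at h2 h4
  simp only [h] at h4
  exact h4.unique h2

/-- Taylor expansion of a polynomial along `t ↦ exp (t X)`. -/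
theorem eval_exp_eq_zero [CompleteSpace A] (X : A) (D : MvPolynomial ι ℂ → MvPolynomial ι ℂ)
    (hD : ∀ P (Y : A), MvPolynomial.eval (fun i => e i Y) (D P) =
      ∑ i, MvPolynomial.eval (fun i => e i Y) (MvPolynomial.pderiv i P) * e i (Y * X))
    (P : MvPolynomial ι ℂ) (hP : ∀ n : ℕ, MvPolynomial.eval (fun i => e i 1) (D^[n] P) = 0) :
    MvPolynomial.eval (fun i => e i (NormedSpace.exp X)) P = 0 := by
  have hder : ∀ P (t : ℂ), HasDerivAt
      (fun s : ℂ => MvPolynomial.eval (fun i => e i (NormedSpace.exp (s • X))) P)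
      (MvPolynomial.eval (fun i => e i (NormedSpace.exp (t • X))) (D P)) t := by
    intro P t
    rw [hD]
    exact hasDerivAt_eval e (hasDerivAt_exp_smul_const X t) P
  have hiter : ∀ (n : ℕ) P, iteratedDeriv n
      (fun s : ℂ => MvPolynomial.eval (fun i => e i (NormedSpace.exp (s • X))) P) =
      fun s : ℂ => MvPolynomial.eval (fun i => e i (NormedSpace.exp (s • X))) (D^[n] P) := by
    intro n
    induction n with
    | zero => intro P; simp
    | succ n ih =>
      intro P
      rw [iteratedDeriv_succ', Function.iterate_succ_apply, ← ih]
      congr 1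
      exact funext fun t => (hder P t).deriv
  have hent : Differentiable ℂ
      (fun s : ℂ => MvPolynomial.eval (fun i => e i (NormedSpace.exp (s • X))) P) :=
    fun t => (hder P t).differentiableAt
  -- `D` computes the derivative along the curve, so all Taylor coefficients at 0 of this entire
  -- function vanish.
  have := Complex.taylorSeries_eq_of_entire' 0 1 hent
  simp only [hiter, zero_smul, NormedSpace.exp_zero, hP] at this
  simpa using this.symm

theorem sum_pderiv_eq_zero_of_exp [CompleteSpace A] (X : A) (P : MvPolynomial ι ℂ)
    (hP : ∀ t : ℝ, MvPolynomial.eval (fun i => e i (NormedSpace.exp ((t : ℂ) • X))) P = 0) :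
    ∑ i, MvPolynomial.eval (fun i => e i 1) (MvPolynomial.pderiv i P) * e i X = 0 := by
  have h1 := hasDerivAt_eval e (hasDerivAt_exp_smul_const X (0 : ℂ)) P
  have h2 := h1.comp_ofReal (z := 0)
  simp only [hP] at h2
  have := h2.unique (hasDerivAt_const (0 : ℝ) (0 : ℂ))
  simpa only [zero_smul, NormedSpace.exp_zero, one_mul] using this

end AbstractExponential

/-! ### The exponential map and the Lie algebra of a ℚ-group. -/

section Exponential

variable {V : Type*} [AddCommGroup V] [Module ℚ V] [Module.Finite ℚ V]

/-- A norm on the endomorphisms of `V_ℂ`, transported from matrices. -/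
@[reducible]
def endNormedRing (V : Type*) [AddCommGroup V] [Module ℚ V] [Module.Finite ℚ V] :
    NormedRing (Module.End ℂ (Cx V)) :=
  letI := Matrix.linftyOpNormedRing (n := Fin (Module.finrank ℚ V)) (α := ℂ)
  NormedRing.induced _ (Matrix (Fin (Module.finrank ℚ V)) (Fin (Module.finrank ℚ V)) ℂ)
    (LinearMap.toMatrixAlgEquiv (cxBasis V)) (AlgEquiv.injective _)

attribute [local instance] endNormedRing

/-- The normed algebra structure on the endomorphisms of `V_ℂ`, transported from matrices. -/
@[reducible]
def endNormedAlgebra (V : Type*) [AddCommGroup V] [Module ℚ V] [Module.Finite ℚ V] :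
    NormedAlgebra ℂ (Module.End ℂ (Cx V)) :=
  letI := Matrix.linftyOpNormedRing (n := Fin (Module.finrank ℚ V)) (α := ℂ)
  letI := Matrix.linftyOpNormedAlgebra (R := ℂ) (n := Fin (Module.finrank ℚ V)) (α := ℂ)
  NormedAlgebra.induced ℂ _ (Matrix (Fin (Module.finrank ℚ V)) (Fin (Module.finrank ℚ V)) ℂ)
    (LinearMap.toMatrixAlgEquiv (cxBasis V))

attribute [local instance] endNormedAlgebra

instance : Module.Finite ℂ (Cx V) := Module.Finite.of_basis (cxBasis V)

theorem endCompleteSpace (V : Type*) [AddCommGroup V] [Module ℚ V] [Module.Finite ℚ V] :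
    CompleteSpace (Module.End ℂ (Cx V)) := FiniteDimensional.complete ℂ _

attribute [local instance] endCompleteSpace

/-- The exponential of an endomorphism, as an automorphism. -/
def expGL (X : Module.End ℂ (Cx V)) : GLC V :=
  LinearEquiv.ofLinearMap (NormedSpace.exp X) (NormedSpace.exp (-X))
    (exp_mul_exp_neg X) (exp_neg_mul_exp X)

theorem coe_expGL (X : Module.End ℂ (Cx V)) :
    (expGL X).toLinearMap = NormedSpace.exp X := rfl

omit [Module.Finite ℚ V] in
theorem toLinearMap_mul (g g' : GLC V) :
    (g * g').toLinearMap = g.toLinearMap * g'.toLinearMap := rfl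

/-- A matrix entry as a continuous linear form. -/
def entryCLM (ij : Fin (Module.finrank ℚ V) × Fin (Module.finrank ℚ V)) :
    Module.End ℂ (Cx V) →L[ℂ] ℂ :=
  LinearMap.toContinuousLinearMap ((Matrix.entryLinearMap ℂ ℂ ij.1 ij.2) ∘ₗ
    (LinearMap.toMatrix (cxBasis V) (cxBasis V)).toLinearMap)

theorem entries_eq (X : Module.End ℂ (Cx V)) : entries X = fun ij => entryCLM ij X := rfl

attribute [irreducible] entryCLM

theorem sum_pderiv_entries_translate (a X : Module.End ℂ (Cx V))
    (P P' : MvPolynomial (Fin (Module.finrank ℚ V) × Fin (Module.finrank ℚ V)) ℂ)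
    (h : ∀ Y : Module.End ℂ (Cx V), MvPolynomial.eval (entries (a * Y)) P =
      MvPolynomial.eval (entries Y) P') :
    ∑ ij, MvPolynomial.eval (entries a) (MvPolynomial.pderiv ij P) * entries (a * X) ij =
      ∑ ij, MvPolynomial.eval (entries (1 : Module.End ℂ (Cx V))) (MvPolynomial.pderiv ij P') *
        entries X ij := by
  simp only [entries_eq] at h ⊢
  have h1 := sum_pderiv_translate entryCLM a X (P := P) (P' := P')
  exact h1 h

theorem eval_entries_exp_eq_zero (X : Module.End ℂ (Cx V))
    (D : MvPolynomial (Fin (Module.finrank ℚ V) × Fin (Module.finrank ℚ V)) ℂ →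
      MvPolynomial (Fin (Module.finrank ℚ V) × Fin (Module.finrank ℚ V)) ℂ)
    (hD : ∀ P (Y : Module.End ℂ (Cx V)), MvPolynomial.eval (entries Y) (D P) =
      ∑ ij, MvPolynomial.eval (entries Y) (MvPolynomial.pderiv ij P) * entries (Y * X) ij)
    (P : MvPolynomial (Fin (Module.finrank ℚ V) × Fin (Module.finrank ℚ V)) ℂ)
    (hP : ∀ n : ℕ, MvPolynomial.eval (entries (1 : Module.End ℂ (Cx V))) (D^[n] P) = 0) :
    MvPolynomial.eval (entries (NormedSpace.exp X)) P = 0 := by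
  simp only [entries_eq] at hD hP ⊢
  have h1 := eval_exp_eq_zero entryCLM X D
  have h2 := h1 hD P
  exact h2 hP

/-- The definition of `lieAlg` tests rational polynomials only; by Galois descent these span all
complex polynomials vanishing on G. Complex ones appear when an equation is translated by an element
of G. -/
theorem sum_pderiv_eq_zero {G : Subgroup (GLC V)} (hG : GalStable (G : Set (GLC V)))
    {X : Module.End ℂ (Cx V)} (hX : X ∈ lieAlg G)
    {P : MvPolynomial (Fin (Module.finrank ℚ V) × Fin (Module.finrank ℚ V)) ℂ}
    (hP : ∀ g ∈ G, MvPolynomial.eval (entries g.toLinearMap) P = 0) :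
    ∑ ij, MvPolynomial.eval (entries (1 : Module.End ℂ (Cx V))) (MvPolynomial.pderiv ij P)
      * entries X ij = 0 := by
  have h1 := mem_span_of_vanishing hG hP
  clear hP
  induction h1 using Submodule.span_induction with
  | mem P' h =>
    obtain ⟨R, rfl, hR⟩ := h
    simp only [MvPolynomial.pderiv_map, MvPolynomial.eval_map, ← MvPolynomial.aeval_def]
    exact hX R hR
  | zero => simp
  | add P Q _ _ hP hQ => simp only [map_add, add_mul, Finset.sum_add_distrib, hP, hQ, add_zero]
  | smul a P _ hP =>
    have : ∀ ij, MvPolynomial.eval (entries (1 : Module.End ℂ (Cx V)))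
        (MvPolynomial.pderiv ij (a • P)) * entries X ij =
        a * (MvPolynomial.eval (entries (1 : Module.End ℂ (Cx V)))
        (MvPolynomial.pderiv ij P) * entries X ij) := fun ij => by
      rw [Derivation.map_smul, MvPolynomial.smul_eval, mul_assoc]
    rw [Finset.sum_congr rfl fun ij _ => this ij, ← Finset.mul_sum, hP, mul_zero]

/-- The exponential maps the Lie algebra of a closed subgroup to the subgroup. -/
theorem expGL_mem {G : Subgroup (GLC V)} (hG : IsQClosed (G : Set (GLC V)))
    {X : Module.End ℂ (Cx V)} (hX : X ∈ lieAlg G) : expGL X ∈ G := by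
  have hgal := hG.galStable
  have hQ : ∀ ij : Fin (Module.finrank ℚ V) × Fin (Module.finrank ℚ V),
      ∃ Q : MvPolynomial (Fin (Module.finrank ℚ V) × Fin (Module.finrank ℚ V)) ℂ,
      ∀ Y : Module.End ℂ (Cx V), entries (Y * X) ij = MvPolynomial.eval (entries Y) Q := fun ij =>
    (IsPolyFun.entry ij).comp_linear (LinearMap.mulRight ℂ X)
  choose Q hQ using hQ
  set D : MvPolynomial (Fin (Module.finrank ℚ V) × Fin (Module.finrank ℚ V)) ℂ →
      MvPolynomial (Fin (Module.finrank ℚ V) × Fin (Module.finrank ℚ V)) ℂ :=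
    fun P => ∑ ij, MvPolynomial.pderiv ij P * Q ij with hD
  have hDeval : ∀ P (Y : Module.End ℂ (Cx V)), MvPolynomial.eval (entries Y) (D P) =
      ∑ ij, MvPolynomial.eval (entries Y) (MvPolynomial.pderiv ij P) * entries (Y * X) ij := by
    intro P Y
    simp only [hD, map_sum, map_mul, hQ]
  -- `D` is the left invariant vector field Y ↦ YX. Left translation by g moves its value at g to
  -- the identity, where the tangency of X gives zero; hence `D` preserves the ideal of G.
  have hDmem : ∀ P : MvPolynomial (Fin (Module.finrank ℚ V) × Fin (Module.finrank ℚ V)) ℂ,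
      (∀ g ∈ G, MvPolynomial.eval (entries g.toLinearMap) P = 0) →
      ∀ g ∈ G, MvPolynomial.eval (entries g.toLinearMap) (D P) = 0 := by
    intro P hP g hg
    obtain ⟨P', hP'⟩ : ∃ P' : MvPolynomial _ ℂ, ∀ Y : Module.End ℂ (Cx V),
        MvPolynomial.eval (entries (g.toLinearMap * Y)) P = MvPolynomial.eval (entries Y) P' :=
      IsPolyFun.comp_linear (f := fun Y => MvPolynomial.eval (entries Y) P) ⟨P, fun _ => rfl⟩
        (LinearMap.mulLeft ℂ g.toLinearMap)
    rw [hDeval]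
    have h0 := sum_pderiv_eq_zero hgal hX (P := P') fun g' hg' => by
      rw [← hP', ← toLinearMap_mul]
      exact hP _ (G.mul_mem hg hg')
    rw [sum_pderiv_entries_translate g.toLinearMap X P P' hP', h0]
  obtain ⟨S, hS⟩ := id hG
  rw [← SetLike.mem_coe, hS]
  intro R hR
  have h0 : ∀ n : ℕ, MvPolynomial.eval (entries (1 : Module.End ℂ (Cx V)))
      (D^[n] (MvPolynomial.map (algebraMap ℚ ℂ) R)) = 0 := by
    intro n
    have hn : ∀ g ∈ G, MvPolynomial.eval (entries g.toLinearMap)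
        (D^[n] (MvPolynomial.map (algebraMap ℚ ℂ) R)) = 0 := by
      induction n with
      | zero =>
        intro g hg
        rw [Function.iterate_zero, id, MvPolynomial.eval_map, ← MvPolynomial.aeval_def]
        have hg' : g ∈ (G : Set (GLC V)) := hg
        rw [hS] at hg'
        exact hg' R hR
      | succ n ih => rw [Function.iterate_succ_apply']; exact hDmem _ ih
    exact hn 1 G.one_mem
  rw [coe_expGL, MvPolynomial.aeval_def, ← MvPolynomial.eval_map]
  exact eval_entries_exp_eq_zero X D hDeval _ h0

theorem mem_lieAlg_of_expGL {G : Subgroup (GLC V)} {X : Module.End ℂ (Cx V)}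
    (hX : ∀ t : ℝ, expGL ((t : ℂ) • X) ∈ G) : X ∈ lieAlg G := by
  intro R hR
  have h0 : ∀ t : ℝ, MvPolynomial.eval (entries (NormedSpace.exp ((t : ℂ) • X)))
      (MvPolynomial.map (algebraMap ℚ ℂ) R) = 0 := fun t => by
    rw [MvPolynomial.eval_map, ← MvPolynomial.aeval_def, ← coe_expGL]
    exact hR _ (hX t)
  simp only [MvPolynomial.aeval_def, ← MvPolynomial.eval_map, ← MvPolynomial.pderiv_map]
  simp only [entries_eq] at h0 ⊢
  exact sum_pderiv_eq_zero_of_exp entryCLM X _ h0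

theorem mem_lieAlg_iff {G : Subgroup (GLC V)} (hG : IsQClosed (G : Set (GLC V)))
    {X : Module.End ℂ (Cx V)} : X ∈ lieAlg G ↔ ∀ t : ℂ, expGL (t • X) ∈ G :=
  ⟨fun hX t => expGL_mem hG ((lieAlg G).smul_mem t hX),
    fun hX => mem_lieAlg_of_expGL fun t => hX t⟩

end Exponential

/-! ### Local conjugacy of semisimple elements in closed linear groups. -/

section LocalConjugacy

open Filter Topology

variable {A : Type*} [NormedRing A] [NormedAlgebra ℂ A]

theorem exp_nat_smul [CompleteSpace A] (n : ℕ) (X : A) :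
    NormedSpace.exp (n • X) = NormedSpace.exp X ^ n := by
  let : NormedAlgebra ℚ A := NormedAlgebra.restrictScalars ℚ ℂ A
  exact NormedSpace.exp_nsmul n X

theorem continuous_exp [CompleteSpace A] : Continuous (NormedSpace.exp : A → A) := by
  let : NormedAlgebra ℚ A := NormedAlgebra.restrictScalars ℚ ℂ A
  exact NormedSpace.exp_continuous

/-- Elements near a semisimple element `s` which commute with `s` and are annihilated by
the same separable polynomial are equal to `s`. -/
theorem eventually_eq_of_commute [CompleteSpace A] {p : Polynomial ℂ} (hp : p.Separable) {s : A}
    (hs : Polynomial.aeval s p = 0) :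
    ∀ᶠ a in 𝓝 s, Commute a s → Polynomial.aeval a p = 0 → a = s := by
  -- The divided difference of p: if a commutes with s, then (a - s) R(a) = p(a) - p(s). Moreover
  -- R(s) = p'(s) is invertible by separability, hence so is R(a) for a near s.
  set R : A → A := fun a =>
    p.sum fun n c => c • ∑ i ∈ Finset.range n, a ^ i * s ^ (n - 1 - i) with hR
  have hRs : R s = Polynomial.aeval s (Polynomial.derivative p) := by
    rw [Polynomial.derivative_apply]
    simp only [hR, Polynomial.sum_def, map_sum]
    refine Finset.sum_congr rfl fun n _ => ?_
    rw [map_mul, Polynomial.aeval_C, ← Algebra.smul_def, map_pow, Polynomial.aeval_X, mul_smul]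
    congr 1
    rw [Finset.sum_congr rfl (g := fun _ => s ^ (n - 1))]
    · rw [Finset.sum_const, Finset.card_range, Nat.cast_smul_eq_nsmul]
    · intro i hi
      rw [← pow_add]
      congr 1
      have := Finset.mem_range.1 hi
      omega
  have hunit : IsUnit (R s) := by
    obtain ⟨u, v, huv⟩ := hp
    have h1 := congrArg (Polynomial.aeval s) huv
    rw [map_add, map_mul, map_mul, hs, mul_zero, zero_add, map_one] at h1
    have h2 : Polynomial.aeval s (Polynomial.derivative p) * Polynomial.aeval s v = 1 := by
      rw [← map_mul, mul_comm, map_mul, h1]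
    rw [hRs]
    exact ⟨⟨_, _, h2, h1⟩, rfl⟩
  have hcont : Continuous R := by
    simp only [hR, Polynomial.sum_def]
    fun_prop
  have hev : ∀ᶠ a in 𝓝 s, IsUnit (R a) :=
    hcont.continuousAt.eventually (Units.isOpen.mem_nhds hunit)
  filter_upwards [hev] with a ha hcomm hpa
  have hfac : (a - s) * R a = 0 := by
    have : (a - s) * R a = Polynomial.aeval a p - Polynomial.aeval s p := by
      simp only [Polynomial.aeval_def, Polynomial.eval₂_eq_sum, hR, Polynomial.sum_def,
        ← Algebra.smul_def, Finset.mul_sum _ _ (a - s), ← Finset.sum_sub_distrib, mul_smul_comm,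
        ← smul_sub]
      refine Finset.sum_congr rfl fun n _ => ?_
      rw [← Finset.mul_sum, hcomm.mul_geom_sum₂]
    rw [this, hpa, hs, sub_zero]
  exact sub_eq_zero.1 (ha.mul_left_eq_zero.1 hfac)

/-- Since [X, s] commutes with s, the derivation [X, ·] obeys the usual chain rule on polynomials in
s. -/
theorem mul_aeval_comm {X s : A} (h : Commute (X * s - s * X) s) (p : Polynomial ℂ) :
    X * Polynomial.aeval s p = Polynomial.aeval s p * X +
      Polynomial.aeval s (Polynomial.derivative p) * (X * s - s * X) := by
  induction p using Polynomial.induction_on with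
  | C a => simp [Algebra.commutes]
  | add p q hp hq =>
    simp only [map_add, mul_add, add_mul, hp, hq]
    abel
  | monomial n a ih =>
    have e1 : Polynomial.C a * Polynomial.X ^ (n + 1) =
        Polynomial.C a * Polynomial.X ^ n * Polynomial.X := by ring
    rw [e1, Polynomial.derivative_mul, map_mul, ← mul_assoc, ih]
    simp only [Polynomial.derivative_X, mul_one, map_add, map_mul (Polynomial.aeval s) _ Polynomial.X,
      Polynomial.aeval_X]
    set P := Polynomial.aeval s (Polynomial.C a * Polynomial.X ^ n)
    set P' := Polynomial.aeval s (Polynomial.derivative (Polynomial.C a * Polynomial.X ^ n))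
    set δ := X * s - s * X with hδ
    have h1 : X * s = s * X + δ := by rw [hδ]; abel
    rw [add_mul, mul_assoc P, h1, mul_add, mul_assoc P', h.eq, add_mul]
    simp only [mul_assoc]
    abel

/-- Applying [X, ·] to p(s) = 0 gives p'(s)[X, s] = 0, and p'(s) is invertible. This is the
semisimplicity of ad s: the kernel of its square is its kernel. -/
theorem comm_eq_zero_of_separable {p : Polynomial ℂ} (hp : p.Separable) {X s : A}
    (hs : Polynomial.aeval s p = 0) (h : Commute (X * s - s * X) s) : X * s = s * X := by
  have h1 := mul_aeval_comm h p
  rw [hs, mul_zero, zero_mul, zero_add] at h1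
  obtain ⟨u, v, huv⟩ := hp
  have h2 := congrArg (Polynomial.aeval s) huv
  rw [map_add, map_mul, map_mul, hs, mul_zero, zero_add, map_one] at h2
  have h3 : X * s - s * X = 0 := by
    rw [← one_mul (X * s - s * X), ← h2, mul_assoc, ← h1, mul_zero]
  exact sub_eq_zero.1 h3

variable [FiniteDimensional ℂ A]

/-- A linear complement of the Lie algebra of a closed group meets the group near the
identity only in the identity, in exponential coordinates. -/
theorem exists_ball_exp_eq_zero [CompleteSpace A] {Γ Z : Set A} (hZ : IsClosed Z)
    (hΓ : ∀ a, IsUnit a → (a ∈ Γ ↔ a ∈ Z))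
    (hone : 1 ∈ Γ) (hmul : ∀ a ∈ Γ, ∀ b ∈ Γ, a * b ∈ Γ)
    (hinv : ∀ a ∈ Γ, ∀ b, a * b = 1 → b * a = 1 → b ∈ Γ)
    {γ C : Submodule ℝ A} (hγ : ∀ X, (∀ t : ℝ, NormedSpace.exp (t • X) ∈ Γ) → X ∈ γ)
    (hC : Disjoint γ C) :
    ∃ ε > 0, ∀ c ∈ C, ‖c‖ < ε → NormedSpace.exp c ∈ Γ → c = 0 := by
  have hunit : ∀ X : A, IsUnit (NormedSpace.exp X) := fun X =>
    ⟨⟨_, _, exp_mul_exp_neg X, exp_neg_mul_exp X⟩, rfl⟩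
  by_contra! hcon
  choose c hcC hcn hcΓ hc0 using fun n : ℕ => hcon (1 / ((n : ℝ) + 1)) (by positivity)
  have hpow : ∀ n k : ℕ, NormedSpace.exp (k • c n) ∈ Γ := by
    intro n k
    rw [exp_nat_smul]
    induction k with
    | zero => simpa using hone
    | succ k ih => rw [pow_succ]; exact hmul _ ih _ (hcΓ n)
  have hsphere : ∀ n, (‖c n‖⁻¹ • c n) ∈ Metric.sphere (0 : A) 1 := fun n => by
    rw [mem_sphere_zero_iff_norm, norm_smul, norm_inv, norm_norm,
      inv_mul_cancel₀ (norm_ne_zero_iff.2 (hc0 n))]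
  have : ProperSpace A := FiniteDimensional.proper ℂ A
  -- Directions of a sequence of counterexamples c_n → 0 accumulate at a unit vector X of C. For t ≥
  -- 0, exp(tX) is the limit of exp(c_n)^k with k the integral part of t/‖c_n‖, so X also lies in γ,
  -- contradicting disjointness.
  obtain ⟨X, hX, φ, hφ, hlim⟩ := (isCompact_sphere (0 : A) 1).tendsto_subseq hsphere
  have hXC : X ∈ C :=
    (C.closed_of_finiteDimensional).mem_of_tendsto hlim
      (Eventually.of_forall fun n => C.smul_mem _ (hcC _))
  have hcnorm : Tendsto (fun n => ‖c (φ n)‖) atTop (𝓝 0) := by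
    refine squeeze_zero (fun n => norm_nonneg _) (fun n => ?_)
      tendsto_one_div_add_atTop_nhds_zero_nat
    refine (hcn _).le.trans ?_
    gcongr
    exact hφ.id_le n
  have hpos : ∀ t : ℝ, 0 ≤ t → NormedSpace.exp (t • X) ∈ Γ := by
    intro t ht
    rw [hΓ _ (hunit _)]
    have hk : Tendsto (fun n => (⌊t / ‖c (φ n)‖⌋₊ : ℝ) * ‖c (φ n)‖) atTop (𝓝 t) := by
      have h1 : ∀ n, t - ‖c (φ n)‖ ≤ (⌊t / ‖c (φ n)‖⌋₊ : ℝ) * ‖c (φ n)‖ := fun n => by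
        have hp := norm_pos_iff.2 (hc0 (φ n))
        have := (Nat.lt_floor_add_one (t / ‖c (φ n)‖)).le
        rw [div_le_iff₀ hp] at this
        linarith
      have h2 : ∀ n, (⌊t / ‖c (φ n)‖⌋₊ : ℝ) * ‖c (φ n)‖ ≤ t := fun n => by
        have hp := norm_pos_iff.2 (hc0 (φ n))
        have := Nat.floor_le (show 0 ≤ t / ‖c (φ n)‖ by positivity)
        rwa [le_div_iff₀ hp] at this
      refine tendsto_of_tendsto_of_tendsto_of_le_of_le ?_ tendsto_const_nhds h1 h2
      simpa using tendsto_const_nhds.sub hcnorm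
    refine hZ.mem_of_tendsto ((continuous_exp.tendsto _).comp (hk.smul hlim))
      (Eventually.of_forall fun n => ?_)
    have : ((⌊t / ‖c (φ n)‖⌋₊ : ℝ) * ‖c (φ n)‖) • (((fun n => ‖c n‖⁻¹ • c n) ∘ φ) n) =
        ⌊t / ‖c (φ n)‖⌋₊ • c (φ n) := by
      have hp := norm_ne_zero_iff.2 (hc0 (φ n))
      rw [Function.comp_apply, smul_smul, mul_assoc, mul_inv_cancel₀ hp, mul_one,
        Nat.cast_smul_eq_nsmul]
    rw [Function.comp_apply, this, ← hΓ _ (hunit _)]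
    exact hpow _ _
  have hXγ : X ∈ γ := hγ X fun t => by
    rcases le_total 0 t with ht | ht
    · exact hpos t ht
    · have := hpos (-t) (by linarith)
      refine hinv _ this _ ?_ ?_
      · rw [neg_smul]; exact exp_neg_mul_exp _
      · rw [neg_smul]; exact exp_mul_exp_neg _
  have := Submodule.disjoint_def.1 hC X hXγ hXC
  rw [this] at hX
  simp at hX

/-- The Lie algebra of a group is the sum of the commutator image and the centralizer of a
semisimple element of the group. -/
theorem exists_comm_add_centralizer {p : Polynomial ℂ} (hp : p.Separable) {s s' : A}
    (hs : Polynomial.aeval s p = 0) (hss : s * s' = 1) (hss' : s' * s = 1)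
    {γ : Submodule ℝ A} (hγ : ∀ X ∈ γ, s' * X * s ∈ γ) {X : A} (hX : X ∈ γ) :
    ∃ m ∈ γ, ∃ ζ ∈ γ, Commute s ζ ∧ X = (s' * m * s - m) + ζ := by
  let T : γ →ₗ[ℝ] γ :=
    { toFun := fun Y => ⟨s' * Y * s - Y, γ.sub_mem (hγ _ Y.2) Y.2⟩
      map_add' := fun Y Z => by
        ext
        simp only [Submodule.coe_add, mul_add, add_mul]
        abel
      map_smul' := fun r Y => by
        ext
        simp only [Submodule.coe_smul, mul_smul_comm, smul_mul_assoc, smul_sub, RingHom.id_apply] }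
  have hker : ∀ Y : γ, T Y = 0 ↔ (Y : A) * s = s * Y := fun Y => by
    rw [Subtype.ext_iff]
    change s' * Y * s - Y = 0 ↔ _
    rw [sub_eq_zero]
    constructor
    · intro h
      have := congrArg (s * ·) h
      simpa only [← mul_assoc, hss, one_mul] using this
    · intro h
      rw [mul_assoc, h, ← mul_assoc, hss', one_mul]
  -- T is Ad(s⁻¹) - 1 on γ. Its range and kernel meet in 0 by the semisimplicity of ad s, so
  -- counting dimensions makes γ their direct sum.
  have hdisj : Disjoint (LinearMap.range T) (LinearMap.ker T) := by
    rw [Submodule.disjoint_def]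
    rintro _ ⟨Y, rfl⟩ hY
    rw [LinearMap.mem_ker, hker] at hY
    rw [hker]
    refine comm_eq_zero_of_separable hp hs ?_
    have h1 : (Y : A) * s - s * Y = s * (T Y : A) := by
      change _ = s * (s' * Y * s - Y)
      rw [mul_sub, ← mul_assoc, ← mul_assoc, hss, one_mul]
    rw [h1]
    exact (Commute.refl s).mul_left hY
  have htop := Submodule.eq_top_of_disjoint _ _ (LinearMap.finrank_range_add_finrank_ker T).ge hdisj
  have hmem : (⟨X, hX⟩ : γ) ∈ LinearMap.range T ⊔ LinearMap.ker T := by rw [htop]; trivial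
  obtain ⟨_, ⟨m, rfl⟩, ζ, hζ, h⟩ := Submodule.mem_sup.1 hmem
  refine ⟨m, m.2, ζ, ζ.2, ((hker ζ).1 hζ).symm, ?_⟩
  exact (congrArg Subtype.val h).symm

/-- **Local conjugacy.** Near a semisimple element `s` of a closed matrix group, the elements of
the group annihilated by the same separable polynomial are conjugate to `s`. -/
theorem eventually_conj_of_aeval_eq_zero [CompleteSpace A] {Γ Z : Set A} (hZ : IsClosed Z)
    (hΓ : ∀ a, IsUnit a → (a ∈ Γ ↔ a ∈ Z))
    (hone : 1 ∈ Γ) (hmul : ∀ a ∈ Γ, ∀ b ∈ Γ, a * b ∈ Γ)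
    (hinv : ∀ a ∈ Γ, ∀ b, a * b = 1 → b * a = 1 → b ∈ Γ)
    {γ : Submodule ℝ A} (hγ : ∀ X, X ∈ γ ↔ ∀ t : ℝ, NormedSpace.exp (t • X) ∈ Γ)
    {p : Polynomial ℂ} (hp : p.Separable) {s s' : A} (hs : Polynomial.aeval s p = 0)
    (hss : s * s' = 1) (hss' : s' * s = 1) (hsΓ : s ∈ Γ) (hAd : ∀ X ∈ γ, s' * X * s ∈ γ) :
    ∀ᶠ a in 𝓝 s, a ∈ Γ → Polynomial.aeval a p = 0 →
      ∃ m ∈ γ, a = NormedSpace.exp m * s * NormedSpace.exp (-m) := by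
  obtain ⟨C, hC⟩ := γ.exists_isCompl
  obtain ⟨ε, hε, hball⟩ := exists_ball_exp_eq_zero hZ hΓ hone hmul hinv
    (fun X hX => (hγ X).2 hX) hC.disjoint
  let z : Submodule ℝ A := γ ⊓
    { carrier := {X | Commute s X}
      add_mem' := fun h h' => Commute.add_right h h'
      zero_mem' := Commute.zero_right s
      smul_mem' := fun r X h => Commute.smul_right h r }
  -- The derivative at 0, (m, ζ, c) ↦ ms - sm + sζ + sc, is surjective by
  -- `exists_comm_add_centralizer` and the complement C, so Ψ covers a neighbourhood of s with small
  -- parameters. Membership in Γ then forces c = 0, and annihilation by p forces s exp(ζ) = s.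
  let Ψ : γ × z × C → A := fun x =>
    NormedSpace.exp (x.1 : A) * s * NormedSpace.exp (x.2.1 : A) * NormedSpace.exp (-(x.1 : A)) *
      NormedSpace.exp (x.2.2 : A)
  let l1 : γ × z × C →L[ℝ] A := γ.subtypeL.comp (ContinuousLinearMap.fst ℝ _ _)
  let l2 : γ × z × C →L[ℝ] A := z.subtypeL.comp
    ((ContinuousLinearMap.fst ℝ _ _).comp (ContinuousLinearMap.snd ℝ _ _))
  let l3 : γ × z × C →L[ℝ] A := C.subtypeL.comp
    ((ContinuousLinearMap.snd ℝ _ _).comp (ContinuousLinearMap.snd ℝ _ _))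
  have hexp : ∀ l : γ × z × C →L[ℝ] A,
      HasStrictFDerivAt (fun x => NormedSpace.exp (l x)) l 0 := fun l => by
    have h0 : HasStrictFDerivAt (NormedSpace.exp : A → A) (1 : A →L[ℝ] A) (l 0) := by
      rw [map_zero]; exact hasStrictFDerivAt_exp_zero
    exact h0.comp 0 l.hasStrictFDerivAt
  have hΨ := (((((hexp l1).mul_const' s).mul' (hexp l2)).mul' (hexp (-l1))).mul' (hexp l3))
  have hsurj : ∀ a : A, ∃ x : γ × z × C, (x.1 : A) * s - s * x.1 + s * x.2.1 + s * x.2.2 = a := by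
    intro a
    have : s' * a ∈ γ ⊔ C := by rw [hC.sup_eq_top]; trivial
    obtain ⟨g, hg, c, hc, h⟩ := Submodule.mem_sup.1 this
    obtain ⟨m, hm, ζ, hζ, hcomm, hgm⟩ := exists_comm_add_centralizer hp hs hss hss' hAd hg
    refine ⟨(⟨m, hm⟩, ⟨ζ, hζ, hcomm⟩, ⟨c, hc⟩), ?_⟩
    have h2 : a = s * (g + c) := by rw [h, ← mul_assoc, hss, one_mul]
    rw [h2, hgm]
    simp only [mul_add, mul_sub, ← mul_assoc, hss, one_mul]
  have hmap := hΨ.map_nhds_eq_of_surj (by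
    rw [LinearMap.range_eq_top]
    intro a
    obtain ⟨x, hx⟩ := hsurj a
    refine ⟨x, ?_⟩
    rw [← hx]
    simp [l1, l2, l3, NormedSpace.exp_zero]
    abel)
  have hΨ0 : (((((fun x => NormedSpace.exp (l1 x) * s) * fun x => NormedSpace.exp (l2 x)) *
      fun x => NormedSpace.exp ((-l1) x)) * fun x => NormedSpace.exp (l3 x)) 0) = s := by
    simp [NormedSpace.exp_zero]
  rw [hΨ0] at hmap
  have hΨcont : ∀ᶠ x : γ × z × C in 𝓝 0, ‖(x.2.2 : A)‖ < ε ∧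
      (Commute (s * NormedSpace.exp (x.2.1 : A)) s →
        Polynomial.aeval (s * NormedSpace.exp (x.2.1 : A)) p = 0 →
        s * NormedSpace.exp (x.2.1 : A) = s) := by
    refine Filter.Eventually.and ?_ ?_
    · have : Continuous fun x : γ × z × C => ‖(x.2.2 : A)‖ := by fun_prop
      have h2 := this.tendsto 0
      simp only [Prod.snd_zero, ZeroMemClass.coe_zero, norm_zero] at h2
      exact h2.eventually_lt_const hε
    · have : Continuous fun x : γ × z × C => s * NormedSpace.exp (x.2.1 : A) :=
        continuous_const.mul (continuous_exp.comp (by fun_prop))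
      have h2 := this.tendsto 0
      simp only [Prod.snd_zero, Prod.fst_zero, ZeroMemClass.coe_zero, NormedSpace.exp_zero,
        mul_one] at h2
      exact h2.eventually (eventually_eq_of_commute hp hs)
  rw [← hmap, Filter.eventually_map]
  filter_upwards [hΨcont] with x hx hΓx hpx
  obtain ⟨⟨m, hm⟩, ⟨ζ, hζ, hcomm⟩, ⟨c, hc⟩⟩ := x
  replace hcomm : Commute s ζ := hcomm
  obtain ⟨hcε, hx⟩ := hx
  have hΨx : (((((fun x => NormedSpace.exp (l1 x) * s) * fun x => NormedSpace.exp (l2 x)) *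
      fun x => NormedSpace.exp ((-l1) x)) * fun x => NormedSpace.exp (l3 x))
        (⟨m, hm⟩, ⟨ζ, hζ, hcomm⟩, ⟨c, hc⟩)) =
      NormedSpace.exp m * s * NormedSpace.exp ζ * NormedSpace.exp (-m) * NormedSpace.exp c := rfl
  rw [hΨx] at hΓx hpx ⊢
  have hexpΓ : ∀ X ∈ γ, NormedSpace.exp X ∈ Γ := fun X hX => by
    simpa using (hγ X).1 hX 1
  have hb : NormedSpace.exp m * s * NormedSpace.exp ζ * NormedSpace.exp (-m) ∈ Γ :=
    hmul _ (hmul _ (hmul _ (hexpΓ m hm) _ hsΓ) _ (hexpΓ ζ hζ)) _ (hexpΓ _ (γ.neg_mem hm))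
  have hb' : NormedSpace.exp m * NormedSpace.exp (-ζ) * s' * NormedSpace.exp (-m) ∈ Γ :=
    hmul _ (hmul _ (hmul _ (hexpΓ m hm) _ (hexpΓ _ (γ.neg_mem hζ))) _ (hinv s hsΓ s' hss hss')) _
      (hexpΓ _ (γ.neg_mem hm))
  have hbb : NormedSpace.exp m * NormedSpace.exp (-ζ) * s' * NormedSpace.exp (-m) *
      (NormedSpace.exp m * s * NormedSpace.exp ζ * NormedSpace.exp (-m)) = 1 := by
    calc _ = NormedSpace.exp m * NormedSpace.exp (-ζ) * s' *
          (NormedSpace.exp (-m) * NormedSpace.exp m) * s * NormedSpace.exp ζ *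
          NormedSpace.exp (-m) := by simp only [mul_assoc]
      _ = NormedSpace.exp m * NormedSpace.exp (-ζ) * (s' * s) * NormedSpace.exp ζ *
          NormedSpace.exp (-m) := by rw [exp_neg_mul_exp]; simp only [mul_assoc, one_mul]
      _ = NormedSpace.exp m * (NormedSpace.exp (-ζ) * NormedSpace.exp ζ) *
          NormedSpace.exp (-m) := by rw [hss']; simp only [mul_assoc, one_mul]
      _ = 1 := by rw [exp_neg_mul_exp, mul_one, exp_mul_exp_neg]
  have hcΓ : NormedSpace.exp c ∈ Γ := by
    have := hmul _ hb' _ hΓx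
    rwa [← mul_assoc, hbb, one_mul] at this
  have hc0 := hball c hc hcε hcΓ
  rw [hc0, NormedSpace.exp_zero, mul_one] at hpx ⊢
  have hconj : ∀ q : Polynomial ℂ, Polynomial.aeval (NormedSpace.exp m * s * NormedSpace.exp ζ *
      NormedSpace.exp (-m)) q = NormedSpace.exp m * Polynomial.aeval (s * NormedSpace.exp ζ) q *
      NormedSpace.exp (-m) := by
    intro q
    let u : Aˣ := ⟨_, _, exp_mul_exp_neg m, exp_neg_mul_exp m⟩
    have := Polynomial.aeval_algHom_apply (MulSemiringAction.toAlgHom ℂ A (ConjAct.toConjAct u))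
      (s * NormedSpace.exp ζ) q
    simp only [MulSemiringAction.toAlgHom_apply, ConjAct.units_smul_def] at this
    rw [← mul_assoc] at this
    exact this
  rw [hconj] at hpx
  have hp1 : Polynomial.aeval (s * NormedSpace.exp ζ) p = 0 := by
    have h1 := congrArg (fun y => NormedSpace.exp (-m) * y * NormedSpace.exp m) hpx
    simp only [mul_zero, zero_mul] at h1
    rw [← h1]
    simp only [← mul_assoc, exp_neg_mul_exp, one_mul]
    rw [mul_assoc, exp_neg_mul_exp, mul_one]
  have hcs : Commute (s * NormedSpace.exp ζ) s := by
    refine Commute.mul_left (Commute.refl s) (Commute.symm ?_)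
    exact hcomm.exp_right
  have h1 := hx hcs hp1
  refine ⟨m, hm, ?_⟩
  rw [mul_assoc (NormedSpace.exp m), h1]

end LocalConjugacy

/-! ### Engel's and Kolchin's theorems. -/

section Kolchin

variable {E : Type*} [AddCommGroup E] [Module ℂ E]

theorem aeval_X_mul_mem {S : Submodule ℂ (Module.End ℂ E)} (hmul : ∀ x ∈ S, ∀ y ∈ S, x * y ∈ S)
    {x : Module.End ℂ E} (hx : x ∈ S) (q : Polynomial ℂ) :
    Polynomial.aeval x (Polynomial.X * q) ∈ S := by
  induction q using Polynomial.induction_on with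
  | C a =>
    rw [mul_comm, ← Polynomial.smul_eq_C_mul, map_smul, Polynomial.aeval_X]
    exact S.smul_mem a hx
  | add p q hp hq =>
    rw [mul_add, map_add]
    exact S.add_mem hp hq
  | monomial n a ih =>
    have : (Polynomial.X : Polynomial ℂ) * (Polynomial.C a * Polynomial.X ^ (n + 1)) =
        Polynomial.X * (Polynomial.C a * Polynomial.X ^ n) * Polynomial.X := by ring
    rw [this, map_mul, Polynomial.aeval_X]
    exact hmul _ ih _ hx

variable [FiniteDimensional ℂ E]

/-- The elements of an algebra of endomorphisms of trace zero are nilpotent. -/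
theorem isNilpotent_of_trace_eq_zero {S : Submodule ℂ (Module.End ℂ E)}
    (hmul : ∀ x ∈ S, ∀ y ∈ S, x * y ∈ S) (htr : ∀ x ∈ S, LinearMap.trace ℂ E x = 0)
    {x : Module.End ℂ E} (hx : x ∈ S) : IsNilpotent x := by
  have hint : IsIntegral ℂ x := Algebra.IsIntegral.isIntegral x
  have hne : Polynomial.X * minpoly ℂ x ≠ 0 :=
    mul_ne_zero Polynomial.X_ne_zero (minpoly.ne_zero hint)
  obtain ⟨r, hr, hndvd⟩ :=
    Polynomial.exists_eq_pow_rootMultiplicity_mul_and_not_dvd _ hne (0 : ℂ)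
  have ha : 0 < Polynomial.rootMultiplicity 0 (Polynomial.X * minpoly ℂ x) := by
    rw [Polynomial.rootMultiplicity_pos hne]
    simp
  obtain ⟨a, ha⟩ := Nat.exists_eq_succ_of_ne_zero ha.ne'
  rw [ha] at hr
  simp only [map_zero, sub_zero] at hr hndvd
  have hzero : Polynomial.aeval x ((Polynomial.X : Polynomial ℂ) ^ (a + 1) * r) = 0 := by
    rw [← Nat.succ_eq_add_one, ← hr, map_mul, minpoly.aeval, mul_zero]
  have hcop : IsCoprime ((Polynomial.X : Polynomial ℂ) ^ (a + 1)) r :=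
    IsCoprime.pow_left ((Polynomial.irreducible_X.coprime_iff_not_dvd).2 hndvd)
  obtain ⟨u, v, huv⟩ := hcop
  -- e is the projection to the part on which x is invertible, along the nilpotent part. As a
  -- polynomial in x without constant term it lies in S, so it has trace zero; an idempotent of
  -- trace zero vanishes in characteristic zero.
  set e := Polynomial.aeval x (u * (Polynomial.X : Polynomial ℂ) ^ (a + 1)) with he
  have hemem : e ∈ S := by
    have : u * (Polynomial.X : Polynomial ℂ) ^ (a + 1) =
      Polynomial.X * (u * Polynomial.X ^ a) := by ring
    rw [he, this]
    exact aeval_X_mul_mem hmul hx _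
  have hidem : IsIdempotentElem e := by
    have h1 : e * Polynomial.aeval x (v * r) = 0 := by
      rw [he, ← map_mul]
      have : u * (Polynomial.X : Polynomial ℂ) ^ (a + 1) * (v * r) =
        u * v * (Polynomial.X ^ (a + 1) * r) := by ring
      rw [this, map_mul, hzero, mul_zero]
    have h2 : e + Polynomial.aeval x (v * r) = 1 := by
      rw [he, ← map_add, huv, map_one]
    have h3 := congrArg (e * ·) h2
    simp only [mul_add, h1, add_zero, mul_one] at h3
    exact h3
  have he0 : e = 0 := LinearMap.IsIdempotentElem.eq_zero_of_trace_eq_zero hidem (htr e hemem)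
  refine ⟨a + 1, ?_⟩
  have h2 : Polynomial.aeval x (v * r) = 1 := by
    have := congrArg (Polynomial.aeval x) huv
    rwa [map_add, ← he, he0, zero_add, map_one] at this
  rw [← mul_one (x ^ (a + 1)), ← h2, ← Polynomial.aeval_X_pow (R := ℂ), ← map_mul]
  have : (Polynomial.X : Polynomial ℂ) ^ (a + 1) * (v * r) =
    v * (Polynomial.X ^ (a + 1) * r) := by ring
  rw [this, map_mul, hzero, mul_zero]

attribute [local instance] LieRing.ofAssociativeRing

/-- **Engel's theorem** for a multiplicatively closed space of nilpotent endomorphisms. -/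
theorem exists_ne_zero_of_forall_isNilpotent [Nontrivial E] {S : Submodule ℂ (Module.End ℂ E)}
    (hmul : ∀ x ∈ S, ∀ y ∈ S, x * y ∈ S) (hnil : ∀ x ∈ S, IsNilpotent x) :
    ∃ v : E, v ≠ 0 ∧ ∀ x ∈ S, x v = 0 := by
  let L : LieSubalgebra ℂ (Module.End ℂ E) :=
    { S with
      lie_mem' := fun {x y} hx hy => by
        rw [Ring.lie_def]
        exact S.sub_mem (hmul x hx y hy) (hmul y hy x hx) }
  have hL : LieModule.IsNilpotent L E :=
    LieAlgebra.isEngelian_of_isNoetherian (R := ℂ) (L := L) E fun x => hnil x.1 x.2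
  have := LieModule.nontrivial_max_triv_of_isNilpotent ℂ L E
  obtain ⟨v, hv⟩ := exists_ne (0 : LieModule.maxTrivSubmodule ℂ L E)
  refine ⟨v, fun h => hv (Subtype.ext h), fun x hx => ?_⟩
  exact (LieModule.mem_maxTrivSubmodule _ _ _ _).1 v.2 ⟨x, hx⟩

/-- **Kolchin's theorem.** -/
theorem exists_fixed_of_unipotent [Nontrivial E] {N : Set (Module.End ℂ E)}
    (hmul : ∀ x ∈ N, ∀ y ∈ N, x * y ∈ N) (hnil : ∀ x ∈ N, IsNilpotent (x - 1)) :
    ∃ v : E, v ≠ 0 ∧ ∀ x ∈ N, x v = v := by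
  -- By (n-1)(m-1) = (nm-1) - (n-1) - (m-1) this span is multiplicatively closed. The trace vanishes
  -- on its generators, hence on all of it, so all its elements are nilpotent and Engel's theorem
  -- gives a common null vector.
  set S := Submodule.span ℂ ((fun x => x - 1) '' N) with hS
  have hmem : ∀ x ∈ N, x - 1 ∈ S := fun x hx => Submodule.subset_span ⟨x, hx, rfl⟩
  have hSmul : ∀ x ∈ S, ∀ y ∈ S, x * y ∈ S := by
    intro x hx y hy
    induction hx using Submodule.span_induction with
    | mem x hx =>
      obtain ⟨n, hn, rfl⟩ := hx
      induction hy using Submodule.span_induction with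
      | mem y hy =>
        obtain ⟨m, hm, rfl⟩ := hy
        have : (n - 1) * (m - 1) = (n * m - 1) - (n - 1) - (m - 1) := by noncomm_ring
        rw [this]
        exact S.sub_mem (S.sub_mem (hmem _ (hmul n hn m hm)) (hmem n hn)) (hmem m hm)
      | zero => rw [mul_zero]; exact S.zero_mem
      | add y z _ _ hy hz => rw [mul_add]; exact S.add_mem hy hz
      | smul a y _ hy => rw [mul_smul_comm]; exact S.smul_mem a hy
    | zero => rw [zero_mul]; exact S.zero_mem
    | add x z _ _ hx hz => rw [add_mul]; exact S.add_mem hx hz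
    | smul a x _ hx => rw [smul_mul_assoc]; exact S.smul_mem a hx
  have htr : ∀ x ∈ S, LinearMap.trace ℂ E x = 0 := by
    intro x hx
    induction hx using Submodule.span_induction with
    | mem x hx =>
      obtain ⟨n, hn, rfl⟩ := hx
      exact (LinearMap.isNilpotent_trace_of_isNilpotent (hnil n hn)).eq_zero
    | zero => exact map_zero _
    | add x z _ _ hx hz => rw [map_add, hx, hz, add_zero]
    | smul a x _ hx => rw [map_smul, hx, smul_zero]
  obtain ⟨v, hv, h⟩ := exists_ne_zero_of_forall_isNilpotent hSmul
    fun x hx => isNilpotent_of_trace_eq_zero hSmul htr hx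
  refine ⟨v, hv, fun x hx => ?_⟩
  have := h _ (hmem x hx)
  rwa [LinearMap.sub_apply, Module.End.one_apply, sub_eq_zero] at this

/-- Kolchin's theorem for a subquotient. -/
theorem exists_fixed_of_unipotent_of_lt {N : Set (Module.End ℂ E)}
    (hmul : ∀ x ∈ N, ∀ y ∈ N, x * y ∈ N) (hnil : ∀ x ∈ N, IsNilpotent (x - 1))
    {A B : Submodule ℂ E} (hA : ∀ x ∈ N, ∀ v ∈ A, x v ∈ A) (hB : ∀ x ∈ N, ∀ v ∈ B, x v ∈ B)
    (hBA : ¬ B ≤ A) : ∃ v ∈ B, v ∉ A ∧ ∀ x ∈ N, x v - v ∈ A := by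
  let A' : Submodule ℂ B := A.comap B.subtype
  have hnt : Nontrivial (B ⧸ A') := by
    rw [Submodule.Quotient.nontrivial_iff]
    intro h
    exact hBA fun v hv => by
      have : (⟨v, hv⟩ : B) ∈ A' := by rw [h]; trivial
      exact this
  let N' : Set (Module.End ℂ (B ⧸ A')) :=
    {y | ∃ x ∈ N, ∀ v w : B, (w : E) = x v → y (A'.mkQ v) = A'.mkQ w}
  obtain ⟨ξ, hξ, hfix⟩ := exists_fixed_of_unipotent (N := N') (by
    rintro y ⟨x, hx, hxy⟩ y' ⟨x', hx', hxy'⟩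
    refine ⟨x * x', hmul x hx x' hx', fun v w hw => ?_⟩
    rw [Module.End.mul_apply, hxy' v ⟨x' v, hB x' hx' v v.2⟩ rfl]
    exact hxy _ _ hw) (by
    rintro y ⟨x, hx, hxy⟩
    obtain ⟨n, hn⟩ := hnil x hx
    refine ⟨n, LinearMap.ext fun ξ => ?_⟩
    obtain ⟨v, rfl⟩ := A'.mkQ_surjective ξ
    have key : ∀ (k : ℕ) (v w : B), (w : E) = ((x - 1) ^ k) v → ((y - 1) ^ k) (A'.mkQ v) = A'.mkQ w := by
      intro k
      induction k with
      | zero =>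
        intro v w hw
        have : w = v := Subtype.ext hw
        rw [this]; rfl
      | succ k ih =>
        intro v w hw
        rw [pow_succ, Module.End.mul_apply]
        rw [pow_succ, Module.End.mul_apply] at hw
        have h1 : (y - 1) (A'.mkQ v) = A'.mkQ (⟨x v, hB x hx v v.2⟩ - v) := by
          rw [LinearMap.sub_apply, hxy v ⟨x v, hB x hx v v.2⟩ rfl, map_sub]; rfl
        rw [h1]
        exact ih _ _ hw
    have := key n v 0 (by rw [hn]; rfl)
    rw [this, map_zero]; rfl)
  obtain ⟨v, rfl⟩ := A'.mkQ_surjective ξ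
  refine ⟨v, v.2, fun h => hξ ?_, fun x hx => ?_⟩
  · rw [Submodule.mkQ_apply, Submodule.Quotient.mk_eq_zero]; exact h
  · let y : Module.End ℂ (B ⧸ A') := A'.mapQ A' (x.restrict (hB x hx)) fun w hw => hA x hx w hw
    have h1 := hfix y ⟨x, hx, fun v w hw => by
      change A'.mkQ (x.restrict (hB x hx) v) = _
      congr 1
      exact Subtype.ext hw.symm⟩
    have h2 : y (A'.mkQ v) = A'.mkQ (x.restrict (hB x hx) v) := rfl
    rw [h2, ← sub_eq_zero, ← map_sub, Submodule.mkQ_apply, Submodule.Quotient.mk_eq_zero] at h1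
    exact h1

end Kolchin

/-! ### Complex powers of unipotent elements. -/

section PowerCurve

variable {V : Type*} [AddCommGroup V] [Module ℚ V] [Module.Finite ℚ V]

/-- A polynomial curve in the space of endomorphisms. -/
def IsPolyCurve (f : ℂ → Module.End ℂ (Cx V)) : Prop :=
  ∀ ij, ∃ p : Polynomial ℂ, ∀ t, entries (f t) ij = p.eval t

theorem entries_injective : Function.Injective (entries (V := V)) := by
  intro X Y h
  apply (LinearMap.toMatrix (cxBasis V) (cxBasis V)).injective
  ext i j
  exact congrFun h (i, j)

theorem entries_smul (a : ℂ) (X : Module.End ℂ (Cx V)) (ij) :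
    entries (a • X) ij = a * entries X ij := by
  simp only [entries, map_smul, Matrix.smul_apply, smul_eq_mul]

theorem entries_sum {κ : Type*} (s : Finset κ) (X : κ → Module.End ℂ (Cx V)) (ij) :
    entries (∑ k ∈ s, X k) ij = ∑ k ∈ s, entries (X k) ij := by
  simp only [entries, map_sum, Matrix.sum_apply]

theorem entries_mul (X Y : Module.End ℂ (Cx V)) (ij) :
    entries (X * Y) ij = ∑ k, entries X (ij.1, k) * entries Y (k, ij.2) := by
  simp only [entries, LinearMap.toMatrix_mul, Matrix.mul_apply]

namespace IsPolyCurve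

theorem mul {f g : ℂ → Module.End ℂ (Cx V)} (hf : IsPolyCurve f) (hg : IsPolyCurve g) :
    IsPolyCurve fun t => f t * g t := by
  choose p hp using hf
  choose q hq using hg
  intro ij
  refine ⟨∑ k, p (ij.1, k) * q (k, ij.2), fun t => ?_⟩
  simp only [entries_mul, hp, hq, Polynomial.eval_finsetSum, Polynomial.eval_mul]

theorem const (X : Module.End ℂ (Cx V)) : IsPolyCurve fun _ => X := fun ij =>
  ⟨Polynomial.C (entries X ij), fun t => by simp⟩

theorem comp_mul {f : ℂ → Module.End ℂ (Cx V)} (hf : IsPolyCurve f) (a : ℂ) :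
    IsPolyCurve fun t => f (a * t) := fun ij => by
  obtain ⟨p, hp⟩ := hf ij
  exact ⟨p.comp (Polynomial.C a * Polynomial.X), fun t => by simp [hp]⟩

theorem exists_aeval {f : ℂ → Module.End ℂ (Cx V)} (hf : IsPolyCurve f) (P : MatPoly V) :
    ∃ q : Polynomial ℂ, ∀ t, MvPolynomial.aeval (entries (f t)) P = q.eval t := by
  choose p hp using hf
  refine ⟨MvPolynomial.aeval p P, fun t => ?_⟩
  have h1 : entries (f t) = fun ij => (Polynomial.aeval t).restrictScalars ℚ (p ij) := by
    funext ij
    rw [hp]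
    simp
  rw [h1, ← MvPolynomial.comp_aeval]
  simp

end IsPolyCurve

theorem polynomial_eq_zero_of_nat {p : Polynomial ℂ} (h : ∀ n : ℕ, p.eval (n : ℂ) = 0) :
    p = 0 := by
  refine Polynomial.eq_zero_of_infinite_isRoot p ?_
  exact (Set.infinite_range_of_injective (Nat.cast_injective (R := ℂ))).mono
    (by rintro _ ⟨n, rfl⟩; exact h n)

/-- A polynomial vanishing on ℕ is zero. Identities between integral powers of unipotents thereby
extend to complex exponents. -/
theorem IsPolyCurve.eq_of_nat {f g : ℂ → Module.End ℂ (Cx V)} (hf : IsPolyCurve f)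
    (hg : IsPolyCurve g) (h : ∀ n : ℕ, f n = g n) (t : ℂ) : f t = g t := by
  refine entries_injective (funext fun ij => ?_)
  obtain ⟨p, hp⟩ := hf ij
  obtain ⟨q, hq⟩ := hg ij
  have : p - q = 0 := polynomial_eq_zero_of_nat fun n => by
    rw [Polynomial.eval_sub, ← hp, ← hq, h, sub_self]
  rw [hp, hq, sub_eq_zero.1 this]

/-- The binomial coefficient `t (t - 1) ⋯ (t - k + 1) / k!`. -/
def binom (t : ℂ) (k : ℕ) : ℂ := (descPochhammer ℂ k).eval t / k.factorial

theorem binom_nat (n k : ℕ) : binom n k = n.choose k := by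
  rw [binom, descPochhammer_eval_eq_descFactorial, Nat.descFactorial_eq_factorial_mul_choose]
  push_cast
  exact mul_div_cancel_left₀ _ (Nat.cast_ne_zero.2 k.factorial_ne_zero)

theorem map_binom (σ : ℂ ≃ₐ[ℚ] ℂ) (t : ℂ) (k : ℕ) : σ (binom t k) = binom (σ t) k := by
  have h : ∀ t : ℂ, (descPochhammer ℂ k).eval t = ∏ j ∈ Finset.range k, (t - j) := by
    intro t
    induction k with
    | zero => simp
    | succ k ih => rw [descPochhammer_succ_right, Finset.prod_range_succ, ← ih]; simp
  rw [binom, binom, h, h, map_div₀, map_prod, map_natCast]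
  simp

/-- The power `u ^ t` of a unipotent endomorphism. -/
def upow (u : Module.End ℂ (Cx V)) (t : ℂ) : Module.End ℂ (Cx V) :=
  ∑ k ∈ Finset.range (Module.finrank ℂ (Cx V)), binom t k • (u - 1) ^ k

theorem pow_finrank_eq_zero {x : Module.End ℂ (Cx V)} (hx : IsNilpotent x) :
    x ^ Module.finrank ℂ (Cx V) = 0 := by
  have h1 := LinearMap.aeval_self_charpoly x
  rwa [hx.charpoly_eq_X_pow_finrank, map_pow, Polynomial.aeval_X] at h1

theorem upow_nat {u : Module.End ℂ (Cx V)} (hu : IsNilpotent (u - 1)) (n : ℕ) :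
    upow u n = u ^ n := by
  have h1 : u ^ n = ∑ k ∈ Finset.range (n + 1), (n.choose k : ℂ) • (u - 1) ^ k := by
    conv_lhs => rw [← sub_add_cancel u 1, (Commute.one_right (u - 1)).add_pow]
    refine Finset.sum_congr rfl fun k _ => ?_
    rw [one_pow, mul_one, ← Nat.cast_comm, Nat.cast_smul_eq_nsmul, nsmul_eq_mul]
  rw [h1, upow]
  simp only [binom_nat]
  set N := Module.finrank ℂ (Cx V)
  have h2 : ∀ m, N ≤ m → ∑ k ∈ Finset.range N, (n.choose k : ℂ) • (u - 1) ^ k =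
      ∑ k ∈ Finset.range m, (n.choose k : ℂ) • (u - 1) ^ k := fun m hm =>
    Finset.sum_subset (Finset.range_subset_range.2 hm) fun k _ hk => by
      rw [Finset.mem_range, not_lt] at hk
      rw [pow_eq_zero_of_le hk (pow_finrank_eq_zero hu), smul_zero]
  have h3 : ∀ m, n + 1 ≤ m → ∑ k ∈ Finset.range (n + 1), (n.choose k : ℂ) • (u - 1) ^ k =
      ∑ k ∈ Finset.range m, (n.choose k : ℂ) • (u - 1) ^ k := fun m hm =>
    Finset.sum_subset (Finset.range_subset_range.2 hm) fun k _ hk => by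
      rw [Finset.mem_range, not_lt] at hk
      rw [Nat.choose_eq_zero_of_lt (by omega), Nat.cast_zero, zero_smul]
  rw [h2 (max N (n + 1)) (le_max_left _ _), h3 (max N (n + 1)) (le_max_right _ _)]

theorem isPolyCurve_upow (u : Module.End ℂ (Cx V)) : IsPolyCurve (upow u) := fun ij =>
  ⟨∑ k ∈ Finset.range (Module.finrank ℂ (Cx V)),
      Polynomial.C ((k.factorial : ℂ)⁻¹ * entries ((u - 1) ^ k) ij) * descPochhammer ℂ k, fun t => by
    simp only [upow, entries_sum, entries_smul, Polynomial.eval_finsetSum, Polynomial.eval_mul,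
      Polynomial.eval_C, binom]
    exact Finset.sum_congr rfl fun k _ => by ring⟩

theorem isNilpotent_sub_one_of_inv {R : Type*} [Ring R] {a b : R} (hab : a * b = 1)
    (hba : b * a = 1) (ha : IsNilpotent (a - 1)) : IsNilpotent (b - 1) := by
  have h3 : b - 1 = -b * (a - 1) := by rw [mul_sub, neg_mul, hba]; simp; abel
  rw [h3]
  refine Commute.isNilpotent_mul_left (Commute.neg_left ?_) ha
  change _ * _ = _ * _
  rw [mul_sub, sub_mul, hab, hba, mul_one, one_mul]

omit [Module.Finite ℚ V] in
theorem isNilpotent_inv_sub_one {u : GLC V} (hu : IsNilpotent (u.toLinearMap - 1)) :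
    IsNilpotent ((u⁻¹).toLinearMap - 1) := by
  refine isNilpotent_sub_one_of_inv (a := u.toLinearMap) ?_ ?_ hu
  · rw [← toLinearMap_mul, mul_inv_cancel]; rfl
  · rw [← toLinearMap_mul, inv_mul_cancel]; rfl

theorem upow_mul_upow_inv {u : GLC V} (hu : IsNilpotent (u.toLinearMap - 1)) (t : ℂ) :
    upow u.toLinearMap t * upow u⁻¹.toLinearMap t = 1 := by
  refine IsPolyCurve.eq_of_nat ((isPolyCurve_upow _).mul (isPolyCurve_upow _)) (.const 1)
    (fun n => ?_) t
  have h2 : u.toLinearMap * u⁻¹.toLinearMap = 1 := by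
    rw [← toLinearMap_mul, mul_inv_cancel]; rfl
  have h1 : u⁻¹.toLinearMap * u.toLinearMap = 1 := by
    rw [← toLinearMap_mul, inv_mul_cancel]; rfl
  have hc : Commute u.toLinearMap u⁻¹.toLinearMap := h2.trans h1.symm
  rw [upow_nat hu, upow_nat (isNilpotent_inv_sub_one hu), ← hc.mul_pow, h2, one_pow]

/-- The power `u ^ t` of a unipotent automorphism. -/
def upowGL (u : GLC V) (hu : IsNilpotent (u.toLinearMap - 1)) (t : ℂ) : GLC V :=
  LinearEquiv.ofLinearMap (upow u.toLinearMap t) (upow u⁻¹.toLinearMap t)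
    (upow_mul_upow_inv hu t)
    (by
      have := upow_mul_upow_inv (isNilpotent_inv_sub_one hu) t
      rw [inv_inv] at this
      exact this)

theorem upowGL_toLinearMap (u : GLC V) (hu : IsNilpotent (u.toLinearMap - 1)) (t : ℂ) :
    (upowGL u hu t).toLinearMap = upow u.toLinearMap t := rfl

omit [Module.Finite ℚ V] in
theorem toLinearMap_pow (g : GLC V) (n : ℕ) : (g ^ n).toLinearMap = g.toLinearMap ^ n := by
  induction n with
  | zero => rfl
  | succ n ih => rw [pow_succ, pow_succ, toLinearMap_mul, ih]

/-- Each equation of G becomes a polynomial in t along u^t, and it vanishes at all natural t because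
u^n lies in G. -/
theorem upowGL_mem {G : Subgroup (GLC V)} (hG : IsQClosed (G : Set (GLC V))) {u : GLC V}
    (hu : IsNilpotent (u.toLinearMap - 1)) (huG : u ∈ G) (t : ℂ) : upowGL u hu t ∈ G := by
  obtain ⟨S, hS⟩ := hG
  rw [← SetLike.mem_coe, hS]
  intro P hP
  obtain ⟨q, hq⟩ := (isPolyCurve_upow u.toLinearMap).exists_aeval P
  have : q = 0 := polynomial_eq_zero_of_nat fun n => by
    have h1 : u ^ n ∈ (G : Set (GLC V)) := G.pow_mem huG n
    rw [hS] at h1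
    rw [← hq, upow_nat hu, ← toLinearMap_pow]
    exact h1 P hP
  rw [upowGL_toLinearMap, hq, this, Polynomial.eval_zero]

theorem upowGL_half_sq (u : GLC V) (hu : IsNilpotent (u.toLinearMap - 1)) :
    upowGL u hu (1 / 2) * upowGL u hu (1 / 2) = u := by
  have h := IsPolyCurve.eq_of_nat ((isPolyCurve_upow u.toLinearMap).mul (isPolyCurve_upow _))
    ((isPolyCurve_upow u.toLinearMap).comp_mul 2) (fun n => by
      have := upow_nat hu (2 * n)
      push_cast at this
      rw [this, upow_nat hu, ← pow_add, two_mul]) (1 / 2)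
  apply LinearEquiv.toLinearMap_injective
  rw [toLinearMap_mul, upowGL_toLinearMap, h]
  have := upow_nat hu 1
  rw [Nat.cast_one, pow_one] at this
  rw [show (2 : ℂ) * (1 / 2) = 1 by norm_num, this]

theorem galConj_upowGL (σ : ℂ ≃ₐ[ℚ] ℂ) (u : GLC V) (hu : IsNilpotent (u.toLinearMap - 1))
    (hu' : IsNilpotent ((galConj σ u).toLinearMap - 1)) (t : ℂ) :
    galConj σ (upowGL u hu t) = upowGL (galConj σ u) hu' (σ t) := by
  ext x
  have key : ∀ (k : ℕ) (x : Cx V), gal σ (((u.toLinearMap - 1) ^ k) (gal σ.symm x)) =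
      (((galConj σ u).toLinearMap - 1) ^ k) x := by
    intro k
    induction k with
    | zero => intro x; rw [pow_zero, pow_zero]; exact gal_gal_symm σ x
    | succ k ih =>
      intro x
      rw [pow_succ, pow_succ, Module.End.mul_apply, Module.End.mul_apply, ← ih]
      congr 2
      simp only [LinearMap.sub_apply, map_sub, LinearEquiv.coe_coe, galConj_apply, gal_symm_gal,
        Module.End.one_apply]
  change gal σ (upow u.toLinearMap t (gal σ.symm x)) = upow (galConj σ u).toLinearMap (σ t) x
  simp only [upow, LinearMap.sum_apply, LinearMap.smul_apply, map_sum, gal_smul, map_binom, key]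

/-- A unipotent closed group is connected. -/
theorem isQConnected_of_unipotent {G : Subgroup (GLC V)}
    (hG : ∀ u ∈ G, IsNilpotent (u.toLinearMap - 1)) : IsQConnected (G : Set (GLC V)) := by
  refine ⟨⟨1, G.one_mem⟩, ?_⟩
  suffices H : ∀ Z₁ Z₂ : Set (GLC V), IsQClosed Z₁ → IsQClosed Z₂ → (G : Set (GLC V)) ⊆ Z₁ ∪ Z₂ →
      (G : Set (GLC V)) ∩ (Z₁ ∩ Z₂) = ∅ → 1 ∈ Z₁ → (G : Set (GLC V)) ⊆ Z₁ by
    intro Z₁ Z₂ h₁ h₂ hun hdis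
    rcases hun G.one_mem with h | h
    · exact Or.inl (H Z₁ Z₂ h₁ h₂ hun hdis h)
    · exact Or.inr (H Z₂ Z₁ h₂ h₁ (by rwa [Set.union_comm]) (by rwa [Set.inter_comm Z₂]) h)
  rintro Z₁ Z₂ ⟨S₁, rfl⟩ ⟨S₂, rfl⟩ hun hdis h1 u hu
  have hnil := hG u hu
  by_contra hcon
  simp only [Set.mem_ofPred_eq, not_forall] at hcon
  obtain ⟨P₁, hP₁, hne⟩ := hcon
  obtain ⟨q₁, hq₁⟩ := (isPolyCurve_upow u.toLinearMap).exists_aeval P₁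
  have hn : ∀ n : ℕ, upow u.toLinearMap n = (u ^ n).toLinearMap := fun n => by
    rw [upow_nat hnil, toLinearMap_pow]
  -- Along u^t the product of an equation of Z₁ and one of Z₂ is a polynomial vanishing on ℕ. The
  -- first factor is nonzero at t = 1, so the second vanishes identically, in particular at t = 0;
  -- then the identity lies in both closed sets.
  have h12 : (1 : GLC V) ∈ {g : GLC V | ∀ P ∈ S₂, MvPolynomial.aeval (entries g.toLinearMap) P = 0} := by
    intro P₂ hP₂
    obtain ⟨q₂, hq₂⟩ := (isPolyCurve_upow u.toLinearMap).exists_aeval P₂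
    have h0 : q₁ * q₂ = 0 := polynomial_eq_zero_of_nat fun n => by
      rw [Polynomial.eval_mul, ← hq₁, ← hq₂, hn]
      rcases hun (G.pow_mem hu n) with h | h
      · rw [h P₁ hP₁, zero_mul]
      · rw [h P₂ hP₂, mul_zero]
    have h1' : q₁ ≠ 0 := fun h => hne (by
      have := hn 1
      rw [pow_one] at this
      rw [← this, hq₁, h, Polynomial.eval_zero])
    have h2 := (mul_eq_zero.1 h0).resolve_left h1'
    have := hn 0
    rw [pow_zero] at this
    rw [← this, hq₂, h2, Polynomial.eval_zero]
  have : (1 : GLC V) ∈ (∅ : Set (GLC V)) := by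
    rw [← hdis]
    exact ⟨G.one_mem, h1, h12⟩
  exact this

end PowerCurve

/-! ### Exponential series and closed subspaces. -/

section AbstractCurves

variable {A : Type*} [NormedRing A] [NormedAlgebra ℂ A] [CompleteSpace A]

theorem exp_eq_sum_smul {ι : Type*} (S : Finset ι) (e : ι → A) (f : ι → ℂ) {X : A}
    (hX : ∀ n : ℕ, X ^ n = ∑ i ∈ S, f i ^ n • e i) :
    NormedSpace.exp X = ∑ i ∈ S, Complex.exp (f i) • e i := by
  have h1 := NormedSpace.exp_series_hasSum_exp' (𝕂 := ℂ) X
  have h2 : HasSum (fun n : ℕ => (n.factorial : ℂ)⁻¹ • X ^ n)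
      (∑ i ∈ S, Complex.exp (f i) • e i) := by
    simp only [hX, Finset.smul_sum, smul_smul]
    refine hasSum_sum fun i _ => ?_
    have h3 := NormedSpace.exp_series_hasSum_exp' (𝕂 := ℂ) (f i)
    rw [← Complex.exp_eq_exp_ℂ] at h3
    exact h3.smul_const (e i)
  exact h1.unique h2

/-- The exponential of an element all of whose powers lie in a closed subspace. -/
theorem exp_sub_one_mem {L : Submodule ℂ A} (hL : IsClosed (L : Set A)) {X : A}
    (hX : ∀ n : ℕ, X ^ (n + 1) ∈ L) : NormedSpace.exp X - 1 ∈ L := by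
  have h1 := NormedSpace.exp_series_hasSum_exp' (𝕂 := ℂ) X
  have h2 := (hasSum_nat_add_iff' 1).2 h1
  simp only [Finset.range_one, Finset.sum_singleton, Nat.factorial_zero, Nat.cast_one, inv_one,
    pow_zero, one_smul] at h2
  exact hL.mem_of_tendsto h2 (Filter.Eventually.of_forall fun s =>
    L.sum_mem fun n _ => L.smul_mem _ (hX n))

theorem mem_of_exp_sub_one_mem {L : Submodule ℝ A} (hL : IsClosed (L : Set A)) {X : A}
    (hX : ∀ t : ℝ, NormedSpace.exp ((t : ℂ) • X) - 1 ∈ L) : X ∈ L := by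
  have h1 := hasDerivAt_exp_smul_const X (0 : ℝ)
  simp only [zero_smul, NormedSpace.exp_zero, one_mul] at h1
  have h2 := hasDerivAt_iff_tendsto_slope.1 h1
  refine hL.mem_of_tendsto h2 (Filter.Eventually.of_forall fun t => ?_)
  rw [slope_def_module]
  refine L.smul_mem _ ?_
  have := hX t
  rw [Complex.coe_smul] at this
  simpa only [zero_smul, NormedSpace.exp_zero] using this

theorem differentiable_eval_exp {ι : Type*} [Fintype ι] [DecidableEq ι] (e : ι → A →L[ℂ] ℂ)
    (X : A) (P : MvPolynomial ι ℂ) :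
    Differentiable ℂ fun t : ℂ => MvPolynomial.eval (fun i => e i (NormedSpace.exp (t • X))) P :=
  fun t => (hasDerivAt_eval e (hasDerivAt_exp_smul_const X t) P).differentiableAt

end AbstractCurves

/-! ### One-parameter subgroups of automorphisms and of tori. -/

section Curves

variable {V : Type*} [AddCommGroup V] [Module ℚ V] [Module.Finite ℚ V]

attribute [local instance] endNormedRing endNormedAlgebra endCompleteSpace

theorem analytic_aeval_exp (X : Module.End ℂ (Cx V)) (g : GLC V) (P : MatPoly V) :
    AnalyticOnNhd ℂ
      (fun t : ℂ => MvPolynomial.aeval (entries (expGL (t • X) * g).toLinearMap) P) Set.univ := by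
  have h1 : IsPolyFun fun Y : Module.End ℂ (Cx V) => MvPolynomial.eval
      (entries (LinearMap.mulRight ℂ g.toLinearMap Y)) (MvPolynomial.map (algebraMap ℚ ℂ) P) :=
    IsPolyFun.comp_linear (f := fun Y => MvPolynomial.eval (entries Y) _) ⟨_, fun _ => rfl⟩ _
  obtain ⟨P', hP'⟩ := h1
  have h2 : (fun t : ℂ => MvPolynomial.aeval (entries (expGL (t • X) * g).toLinearMap) P) =
      fun t : ℂ => MvPolynomial.eval (entries (NormedSpace.exp (t • X))) P' := by
    funext t
    rw [← hP']
    simp only []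
    rw [MvPolynomial.eval_map, ← MvPolynomial.aeval_def, toLinearMap_mul, coe_expGL]
    rfl
  rw [h2]
  have h3 := differentiable_eval_exp entryCLM X P'
  simp only [entries_eq]
  exact h3.differentiableOn.analyticOnNhd isOpen_univ

/-- A one-parameter curve is irreducible. -/
theorem forall_mem_or_forall_mem_of_exp {Z₁ Z₂ : Set (GLC V)} (h₁ : IsQClosed Z₁)
    (h₂ : IsQClosed Z₂) {X : Module.End ℂ (Cx V)} {g : GLC V}
    (h : ∀ t : ℂ, expGL (t • X) * g ∈ Z₁ ∪ Z₂) :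
    (∀ t : ℂ, expGL (t • X) * g ∈ Z₁) ∨ ∀ t : ℂ, expGL (t • X) * g ∈ Z₂ := by
  obtain ⟨S₁, rfl⟩ := h₁
  obtain ⟨S₂, rfl⟩ := h₂
  by_contra! hcon
  obtain ⟨⟨t₁, ht₁⟩, ⟨t₂, ht₂⟩⟩ := hcon
  simp only [Set.mem_ofPred_eq, not_forall] at ht₁ ht₂
  obtain ⟨P₁, hP₁, hne₁⟩ := ht₁
  obtain ⟨P₂, hP₂, hne₂⟩ := ht₂
  rcases (analytic_aeval_exp X g P₁).eq_zero_or_eq_zero_of_mul_eq_zero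
    (analytic_aeval_exp X g P₂) (fun t _ => by
      rcases h t with h | h
      · rw [h P₁ hP₁, zero_mul]
      · rw [h P₂ hP₂, mul_zero]) isPreconnected_univ with h | h
  · exact hne₁ (h t₁ trivial)
  · exact hne₂ (h t₂ trivial)

theorem expGL_zero : expGL (0 : Module.End ℂ (Cx V)) = 1 := by
  apply LinearEquiv.toLinearMap_injective
  rw [coe_expGL]
  exact NormedSpace.exp_zero

theorem exp_scalar (B : Bigrading (Cx V)) (f : ℤ × ℤ → ℂ) :
    NormedSpace.exp (B.scalar f) = B.scalar fun i => Complex.exp (f i) :=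
  exp_eq_sum_smul B.supp B.proj f fun n => by rw [B.scalar_pow]; rfl

/-- The Lie algebra element generating the action of `(e^{ta}, e^{tb})`. -/
def linChr (a b : ℂ) (i : ℤ × ℤ) : ℂ := i.1 * a + i.2 * b

theorem expGL_scalar_linChr (B : Bigrading (Cx V)) (z : ℂˣ × ℂˣ) {a b : ℂ}
    (ha : Complex.exp a = z.1) (hb : Complex.exp b = z.2) :
    expGL (B.scalar (linChr a b)) = B.torus z := by
  apply LinearEquiv.toLinearMap_injective
  rw [coe_expGL, exp_scalar]
  change _ = B.scalar (Bigrading.chr z)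
  congr 1
  funext i
  rw [linChr, Complex.exp_add, Complex.exp_int_mul, Complex.exp_int_mul, ha, hb, Bigrading.chr,
    Units.val_mul, Units.val_zpow_eq_zpow_val, Units.val_zpow_eq_zpow_val]

theorem exists_exp_eq (z : ℂˣ) : ∃ a : ℂ, Complex.exp a = z :=
  ⟨Complex.log z, Complex.exp_log z.ne_zero⟩

theorem smul_linChr (t a b : ℂ) : t • linChr a b = linChr (t * a) (t * b) := by
  funext i
  simp only [linChr, Pi.smul_apply, smul_eq_mul]
  ring

theorem expGL_smul_scalar_linChr (B : Bigrading (Cx V)) (t a b : ℂ) :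
    ∃ z : ℂˣ × ℂˣ, expGL (t • B.scalar (linChr a b)) = B.torus z := by
  refine ⟨(Units.mk0 _ (Complex.exp_ne_zero (t * a)), Units.mk0 _ (Complex.exp_ne_zero (t * b))), ?_⟩
  rw [← B.scalar_smul, smul_linChr]
  exact expGL_scalar_linChr B _ rfl rfl

end Curves

/-! ### The groups preserving the weight filtration or acting trivially on its graded pieces. -/

section WeightGroups

variable {V : Type*} [AddCommGroup V] [Module ℚ V]

theorem galConj_mul (σ : ℂ ≃ₐ[ℚ] ℂ) (g g' : GLC V) :
    galConj σ (g * g') = galConj σ g * galConj σ g' := by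
  ext x
  simp only [galConj_apply, LinearEquiv.mul_apply, gal_symm_gal]

theorem galConj_one (σ : ℂ ≃ₐ[ℚ] ℂ) : galConj σ (1 : GLC V) = 1 := by
  ext x
  simp only [galConj_apply, LinearEquiv.coe_one, id, gal_gal_symm]

theorem galConj_inv (σ : ℂ ≃ₐ[ℚ] ℂ) (g : GLC V) : galConj σ g⁻¹ = (galConj σ g)⁻¹ := by
  rw [eq_inv_iff_mul_eq_one, ← galConj_mul, inv_mul_cancel, galConj_one]

theorem GL_inv_apply_self (g : GLC V) (x : Cx V) : g⁻¹ (g x) = x := g.symm_apply_apply x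

theorem GL_apply_inv_self (g : GLC V) (x : Cx V) : g (g⁻¹ x) = x := g.apply_symm_apply x

variable [Module.Finite ℚ V] (W : WeightFiltration V)

theorem inv_mem_of_forall_mem {g : GLC V} {S : Submodule ℂ (Cx V)} (hg : ∀ x ∈ S, g x ∈ S)
    {x : Cx V} (hx : x ∈ S) : g⁻¹ x ∈ S := by
  have h1 : S.map g.toLinearMap = S := by
    apply Submodule.eq_of_le_of_finrank_eq
    · rintro _ ⟨y, hy, rfl⟩; exact hg y hy
    · exact LinearEquiv.finrank_map_eq g S
  rw [← h1] at hx
  obtain ⟨y, hy, rfl⟩ := hx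
  rw [LinearEquiv.coe_coe, GL_inv_apply_self]
  exact hy

/-- The group of automorphisms preserving the weight filtration. -/
def stabW : Subgroup (GLC V) where
  carrier := {g | ∀ k, ∀ x ∈ W.cx k, g x ∈ W.cx k}
  mul_mem' := fun ha hb k x hx => ha k _ (hb k x hx)
  one_mem' := fun _ _ hx => hx
  inv_mem' := fun ha k _ hx => inv_mem_of_forall_mem (ha k) hx

variable {W}

variable (W)

/-- The group of automorphisms acting trivially on the graded pieces. -/
def grTriv : Subgroup (GLC V) where
  carrier := {g | ∀ k, ∀ x ∈ W.cx k, g x - x ∈ W.cx (k - 1)}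
  mul_mem' := fun {a b} ha hb k x hx => by
    have h1 : b x ∈ W.cx k := by
      have := Submodule.add_mem _ (WeightFiltration.cx_mono (by omega) (hb k x hx)) hx
      rwa [sub_add_cancel] at this
    have := Submodule.add_mem _ (ha k _ h1) (hb k x hx)
    rwa [sub_add_sub_cancel] at this
  one_mem' := fun k x _ => by
    rw [LinearEquiv.coe_one, id, sub_self]; exact Submodule.zero_mem _
  inv_mem' := fun {a} ha k x hx => by
    have hs : ∀ k, ∀ x ∈ W.cx k, a x ∈ W.cx k := fun k x hx => by
      have := Submodule.add_mem _ (WeightFiltration.cx_mono (by omega) (ha k x hx)) hx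
      rwa [sub_add_cancel] at this
    have h1 := ha k _ (inv_mem_of_forall_mem (hs k) hx)
    rw [GL_apply_inv_self] at h1
    rw [← neg_sub x]
    exact Submodule.neg_mem _ h1

variable {W}

theorem grTriv_le_stabW : grTriv W ≤ stabW W := fun a ha k x hx => by
  have := Submodule.add_mem _ (WeightFiltration.cx_mono (by omega) (ha k x hx)) hx
  rwa [sub_add_cancel] at this

theorem conj_mem_grTriv {g u : GLC V} (hg : g ∈ stabW W) (hu : u ∈ grTriv W) :
    g * u * g⁻¹ ∈ grTriv W := fun k x hx => by
  have h1 := hg _ _ (hu k _ ((stabW W).inv_mem hg k x hx))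
  rwa [map_sub, GL_apply_inv_self] at h1

theorem isNilpotent_of_mem_grTriv {u : GLC V} (hu : u ∈ grTriv W) :
    IsNilpotent (u.toLinearMap - 1) := by
  obtain ⟨m, hm⟩ := WeightFiltration.exists_cx_bot (W := W)
  obtain ⟨M, hM⟩ := WeightFiltration.exists_cx_top (W := W)
  have key : ∀ (n : ℕ) (x : Cx V), ((u.toLinearMap - 1) ^ n) x ∈ W.cx (M - n) := by
    intro n
    induction n with
    | zero => intro x; simp [hM]
    | succ n ih =>
      intro x
      rw [pow_succ', Module.End.mul_apply]
      exact mem_of_index_eq (hu _ _ (ih x)) (by push_cast; ring)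
  refine ⟨(M - m).toNat, LinearMap.ext fun x => ?_⟩
  have h1 := WeightFiltration.cx_mono (b := m) (by omega) (key (M - m).toNat x)
  rw [hm] at h1
  exact (Submodule.mem_bot ℂ).1 h1

theorem galConj_mem_stabW (σ : ℂ ≃ₐ[ℚ] ℂ) {g : GLC V} (hg : g ∈ stabW W) :
    galConj σ g ∈ stabW W := fun k _ hx =>
  WeightFiltration.gal_mem_cx σ (hg k _ (WeightFiltration.gal_mem_cx σ.symm hx))

theorem galConj_mem_grTriv (σ : ℂ ≃ₐ[ℚ] ℂ) {g : GLC V} (hg : g ∈ grTriv W) :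
    galConj σ g ∈ grTriv W := fun k x hx => by
  have := WeightFiltration.gal_mem_cx σ (hg k _ (WeightFiltration.gal_mem_cx σ.symm hx))
  rwa [map_sub, gal_gal_symm] at this

omit [Module.Finite ℚ V] in
theorem mem_of_forall_dual {S : Submodule ℂ (Cx V)} {x : Cx V}
    (h : ∀ l : Cx V →ₗ[ℂ] ℂ, (∀ y ∈ S, l y = 0) → l x = 0) : x ∈ S := by
  by_contra hx
  obtain ⟨l, hl, hS⟩ := Submodule.exists_le_ker_of_notMem hx
  exact hl (h l fun y hy => hS hy)

/-- The evident equations involve complex vectors and linear forms; the weight filtration being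
rational, the group is Galois stable and descent applies. -/
theorem isQClosed_stabW : IsQClosed (stabW W : Set (GLC V)) := by
  refine isQClosed_of_polyFun
    (κ := {t : ℤ × Cx V × (Cx V →ₗ[ℂ] ℂ) // t.2.1 ∈ W.cx t.1 ∧ ∀ y ∈ W.cx t.1, t.2.2 y = 0})
    (f := fun t X => t.1.2.2 (X t.1.2.1)) (fun t => IsPolyFun.apply _ _) (fun g => ?_)
    fun σ g hg => galConj_mem_stabW σ hg
  constructor
  · rintro hg ⟨⟨k, x, l⟩, hx, hl⟩
    exact hl _ (hg k x hx)
  · intro h k x hx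
    exact mem_of_forall_dual fun l hl => h ⟨⟨k, x, l⟩, hx, hl⟩

theorem isQClosed_grTriv : IsQClosed (grTriv W : Set (GLC V)) := by
  refine isQClosed_of_polyFun
    (κ := {t : ℤ × Cx V × (Cx V →ₗ[ℂ] ℂ) // t.2.1 ∈ W.cx t.1 ∧ ∀ y ∈ W.cx (t.1 - 1), t.2.2 y = 0})
    (f := fun t X => t.1.2.2 (X t.1.2.1) - t.1.2.2 t.1.2.1)
    (fun t => (IsPolyFun.apply _ _).sub (IsPolyFun.const _)) (fun g => ?_)
    fun σ g hg => galConj_mem_grTriv σ hg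
  constructor
  · rintro hg ⟨⟨k, x, l⟩, hx, hl⟩
    have := hl _ (hg k x hx)
    rwa [map_sub] at this
  · intro h k x hx
    refine mem_of_forall_dual fun l hl => ?_
    rw [map_sub]
    exact h ⟨⟨k, x, l⟩, hx, hl⟩

theorem IsQClosed.inter {Z₁ Z₂ : Set (GLC V)} (h₁ : IsQClosed Z₁) (h₂ : IsQClosed Z₂) :
    IsQClosed (Z₁ ∩ Z₂) := by
  obtain ⟨S₁, rfl⟩ := h₁
  obtain ⟨S₂, rfl⟩ := h₂
  refine ⟨S₁ ∪ S₂, ?_⟩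
  ext g
  constructor
  · rintro ⟨h1, h2⟩ P (hP | hP)
    · exact h1 P hP
    · exact h2 P hP
  · exact fun h => ⟨fun P hP => h P (Or.inl hP), fun P hP => h P (Or.inr hP)⟩

end WeightGroups

/-! ### Similitudes of the graded forms. -/

section Similitudes

variable {V : Type*} [AddCommGroup V] [Module ℚ V] {W : WeightFiltration V} (Q : GradedForms W)

/-- The bilinear form on `V_ℂ` which on `(W_k)_ℂ` is the pullback of the form on `Gr_k`. -/
def grForm (k : ℤ) : Cx V →ₗ[ℂ] Cx V →ₗ[ℂ] ℂ :=
  LinearMap.compl₁₂ (LinearMap.BilinForm.baseChange ℂ (Q.form k)) (W.grC k) (W.grC k)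

theorem grForm_apply (k : ℤ) (x y : Cx V) : grForm Q k x y =
    LinearMap.BilinForm.baseChange ℂ (Q.form k) (W.grC k x) (W.grC k y) := rfl

theorem gal_baseChange_form {H : Type*} [AddCommGroup H] [Module ℚ H] (σ : ℂ ≃ₐ[ℚ] ℂ)
    (b : LinearMap.BilinForm ℚ H) (x y : Cx H) :
    LinearMap.BilinForm.baseChange ℂ b (gal σ x) (gal σ y) =
      σ (LinearMap.BilinForm.baseChange ℂ b x y) := by
  induction x using TensorProduct.induction_on with
  | zero => simp
  | add x x' hx hx' => simp only [map_add, LinearMap.add_apply, hx, hx']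
  | tmul a v =>
    induction y using TensorProduct.induction_on with
    | zero => simp
    | add y y' hy hy' => simp only [map_add, hy, hy']
    | tmul a' v' =>
      rw [gal_tmul, gal_tmul, LinearMap.BilinForm.baseChange_tmul,
        LinearMap.BilinForm.baseChange_tmul, Rat.smul_def, Rat.smul_def, map_mul, map_mul,
        map_ratCast]

theorem grForm_gal (σ : ℂ ≃ₐ[ℚ] ℂ) (k : ℤ) (x y : Cx V) :
    grForm Q k (gal σ x) (gal σ y) = σ (grForm Q k x y) := by
  rw [grForm_apply, ← WeightFiltration.gal_grC, ← WeightFiltration.gal_grC, gal_baseChange_form]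
  rfl

variable {Q}

theorem grForm_eq_zero_left {k : ℤ} {x : Cx V} (hx : x ∈ W.cx (k - 1)) (y : Cx V) :
    grForm Q k x y = 0 := by
  rw [grForm_apply, (WeightFiltration.grC_eq_zero_iff (WeightFiltration.cx_mono (by omega) hx)).2 hx,
    map_zero, LinearMap.zero_apply]

theorem grForm_eq_zero_right {k : ℤ} {y : Cx V} (hy : y ∈ W.cx (k - 1)) (x : Cx V) :
    grForm Q k x y = 0 := by
  rw [grForm_apply, (WeightFiltration.grC_eq_zero_iff (WeightFiltration.cx_mono (by omega) hy)).2 hy,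
    map_zero]

variable [Module.Finite ℚ V] (Q)

/-- The group of automorphisms which preserve the weight filtration and are similitudes of the
graded forms. -/
def simGroup : Subgroup (GLC V) where
  carrier := {g | g ∈ stabW W ∧ ∀ k, ∃ c : ℂ, c ≠ 0 ∧ ∀ x ∈ W.cx k, ∀ y ∈ W.cx k,
    grForm Q k (g x) (g y) = c * grForm Q k x y}
  mul_mem' := by
    rintro a b ⟨ha, ha'⟩ ⟨hb, hb'⟩
    refine ⟨(stabW W).mul_mem ha hb, fun k => ?_⟩
    obtain ⟨c, hc, h⟩ := ha' k
    obtain ⟨d, hd, h'⟩ := hb' k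
    refine ⟨c * d, mul_ne_zero hc hd, fun x hx y hy => ?_⟩
    rw [LinearEquiv.mul_apply, LinearEquiv.mul_apply, h _ (hb k x hx) _ (hb k y hy), h' x hx y hy,
      mul_assoc]
  one_mem' := ⟨(stabW W).one_mem, fun k => ⟨1, one_ne_zero, fun x _ y _ => (one_mul _).symm⟩⟩
  inv_mem' := by
    rintro a ⟨ha, ha'⟩
    refine ⟨(stabW W).inv_mem ha, fun k => ?_⟩
    obtain ⟨c, hc, h⟩ := ha' k
    refine ⟨c⁻¹, inv_ne_zero hc, fun x hx y hy => ?_⟩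
    have h1 := h _ ((stabW W).inv_mem ha k x hx) _ ((stabW W).inv_mem ha k y hy)
    rw [GL_apply_inv_self, GL_apply_inv_self] at h1
    rw [h1, inv_mul_cancel_left₀ hc]

theorem isQClosed_simGroup : IsQClosed (simGroup Q : Set (GLC V)) := by
  -- Cross-multiplication eliminates the unknown similitude factor and leaves polynomial equations.
  let T : Set (GLC V) := {g | ∀ k, ∀ x ∈ W.cx k, ∀ y ∈ W.cx k, ∀ x' ∈ W.cx k, ∀ y' ∈ W.cx k,
    grForm Q k (g x) (g y) * grForm Q k x' y' = grForm Q k (g x') (g y') * grForm Q k x y}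
  have hT : IsQClosed T := by
    refine isQClosed_of_polyFun
      (κ := {t : ℤ × (Cx V × Cx V) × (Cx V × Cx V) // (t.2.1.1 ∈ W.cx t.1 ∧ t.2.1.2 ∈ W.cx t.1) ∧
        (t.2.2.1 ∈ W.cx t.1 ∧ t.2.2.2 ∈ W.cx t.1)})
      (f := fun t X =>
        grForm Q t.1.1 (X t.1.2.1.1) (X t.1.2.1.2) * grForm Q t.1.1 t.1.2.2.1 t.1.2.2.2 -
        grForm Q t.1.1 (X t.1.2.2.1) (X t.1.2.2.2) * grForm Q t.1.1 t.1.2.1.1 t.1.2.1.2)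
      (fun t => ((IsPolyFun.bilin _ _ _).mul (IsPolyFun.const _)).sub
        ((IsPolyFun.bilin _ _ _).mul (IsPolyFun.const _))) (fun g => ?_) fun σ g hg => ?_
    · constructor
      · rintro hg ⟨⟨k, ⟨x, y⟩, ⟨x', y'⟩⟩, ⟨hx, hy⟩, ⟨hx', hy'⟩⟩
        exact sub_eq_zero.2 (hg k x hx y hy x' hx' y' hy')
      · intro h k x hx y hy x' hx' y' hy'
        exact sub_eq_zero.1 (h ⟨⟨k, ⟨x, y⟩, ⟨x', y'⟩⟩, ⟨hx, hy⟩, ⟨hx', hy'⟩⟩)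
    · intro k x hx y hy x' hx' y' hy'
      have hm : ∀ {v}, v ∈ W.cx k → gal σ.symm v ∈ W.cx k := fun hv =>
        WeightFiltration.gal_mem_cx σ.symm hv
      have := congrArg σ (hg k _ (hm hx) _ (hm hy) _ (hm hx') _ (hm hy'))
      simpa only [map_mul, ← grForm_gal, gal_gal_symm, galConj_apply] using this
  have hST : (simGroup Q : Set (GLC V)) = (stabW W : Set (GLC V)) ∩ T := by
    ext g
    constructor
    · rintro ⟨hg, h⟩
      refine ⟨hg, fun k x hx y hy x' hx' y' hy' => ?_⟩
      obtain ⟨c, -, h⟩ := h k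
      rw [h x hx y hy, h x' hx' y' hy']
      ring
    · rintro ⟨hg, h⟩
      refine ⟨hg, fun k => ?_⟩
      by_cases hex : ∃ x ∈ W.cx k, ∃ y ∈ W.cx k, grForm Q k x y ≠ 0
      · obtain ⟨x', hx', y', hy', hne⟩ := hex
        -- The factor is nonzero: comparing the pairs (g⁻¹x', g⁻¹y') and (x', y') would otherwise
        -- give q(x', y')² = 0.
        refine ⟨grForm Q k (g x') (g y') / grForm Q k x' y', div_ne_zero (fun h0 => hne ?_) hne,
          fun x hx y hy => ?_⟩
        · have hi := (stabW W).inv_mem hg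
          have := h k _ (hi k x' hx') _ (hi k y' hy') x' hx' y' hy'
          rw [GL_apply_inv_self, GL_apply_inv_self, h0, zero_mul] at this
          exact mul_self_eq_zero.1 this
        · rw [div_mul_eq_mul_div, eq_div_iff hne, h k x hx y hy x' hx' y' hy']
      · push Not at hex
        exact ⟨1, one_ne_zero, fun x hx y hy => by
          rw [hex x hx y hy, hex _ (hg k x hx) _ (hg k y hy), mul_zero]⟩
  rw [hST]
  exact isQClosed_stabW.inter hT

end Similitudes

/-! ### A real point of the torus separating all characters. -/

section GenericTorusElement

/-- A unit of `ℂ` which is multiplicatively independent of its conjugate. -/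
def genericUnit : ℂˣ := Units.mk0 (2 * Complex.exp Complex.I) (by simp)

/-- A generic real point of the torus. -/
def genericPoint : ℂˣ × ℂˣ := (genericUnit, Units.map (conjQ : ℂ →* ℂ) genericUnit)

theorem chr_genericPoint (i : ℤ × ℤ) : Bigrading.chr genericPoint i =
    2 ^ (i.1 + i.2) * Complex.exp ((i.1 - i.2 : ℤ) * Complex.I) := by
  have h1 : (conjQ (2 * Complex.exp Complex.I) : ℂ) = 2 * Complex.exp (-Complex.I) := by
    rw [conjQ_apply, map_mul, ← Complex.exp_conj, Complex.conj_I, map_ofNat]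
  rw [Bigrading.chr, Units.val_mul, Units.val_zpow_eq_zpow_val, Units.val_zpow_eq_zpow_val]
  change (2 * Complex.exp Complex.I) ^ i.1 * (conjQ (2 * Complex.exp Complex.I)) ^ i.2 = _
  rw [h1, mul_zpow, mul_zpow, zpow_add₀ two_ne_zero, ← Complex.exp_int_mul, ← Complex.exp_int_mul,
    mul_mul_mul_comm, ← Complex.exp_add]
  congr 2
  push_cast
  ring

/-- The absolute value 2^(p+q) determines p+q. The argument determines p-q modulo 2π, hence p-q
itself because π is irrational. -/
theorem chr_genericPoint_injective : Function.Injective (Bigrading.chr genericPoint) := by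
  intro i j h
  rw [chr_genericPoint, chr_genericPoint] at h
  have hnorm := congrArg norm h
  have hn : ∀ m : ℤ, ‖Complex.exp ((m : ℤ) * Complex.I)‖ = 1 := fun m => by
    exact_mod_cast Complex.norm_exp_ofReal_mul_I (m : ℝ)
  rw [norm_mul, norm_mul, hn, hn, mul_one, mul_one, norm_zpow, norm_zpow, Complex.norm_ofNat] at hnorm
  have hsum : i.1 + i.2 = j.1 + j.2 := zpow_right_injective₀ (by norm_num) (by norm_num) hnorm
  rw [hsum] at h
  have hexp := mul_left_cancel₀ (zpow_ne_zero _ two_ne_zero) h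
  rw [Complex.exp_eq_exp_iff_exists_int] at hexp
  obtain ⟨n, hn⟩ := hexp
  have h2 : ((i.1 - i.2 : ℤ) : ℂ) - ((j.1 - j.2 : ℤ) : ℂ) = n * (2 * Real.pi) := by
    have : (((i.1 - i.2 : ℤ) : ℂ) - ((j.1 - j.2 : ℤ) : ℂ)) * Complex.I =
        (n * (2 * Real.pi)) * Complex.I := by
      rw [sub_mul, hn]; ring
    exact mul_right_cancel₀ Complex.I_ne_zero this
  have h3 : (((i.1 - i.2) - (j.1 - j.2) : ℤ) : ℝ) = n * (2 * Real.pi) := by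
    rw [← Complex.ofReal_inj]
    push_cast at h2 ⊢
    exact h2
  have hn0 : n = 0 := by
    by_contra hne
    refine (irrational_pi.intCast_mul (m := n * 2) (by simpa using hne)).ne_int
      ((i.1 - i.2) - (j.1 - j.2)) ?_
    rw [h3]
    push_cast
    ring
  rw [hn0, Int.cast_zero, zero_mul] at h3
  have h4 : (i.1 - i.2) - (j.1 - j.2) = 0 := by exact_mod_cast h3
  ext
  · omega
  · omega

end GenericTorusElement

/-! ### The Mumford-Tate group is closed and connected. -/

section MumfordTate

variable {V : Type*} [AddCommGroup V] [Module ℚ V] [Module.Finite ℚ V]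
  {W : WeightFiltration V} {F : CxFiltration V}

theorem isQClosed_sInf {𝒮 : Set (Subgroup (GLC V))}
    (h : ∀ G ∈ 𝒮, IsQClosed (G : Set (GLC V))) : IsQClosed ((sInf 𝒮 : Subgroup _) : Set (GLC V)) := by
  choose! S hS using h
  refine ⟨⋃ G ∈ 𝒮, S G, ?_⟩
  ext g
  rw [SetLike.mem_coe, Subgroup.mem_sInf]
  constructor
  · intro h P hP
    simp only [Set.mem_iUnion] at hP
    obtain ⟨G, hG, hP⟩ := hP
    have := h G hG
    rw [← SetLike.mem_coe, hS G hG] at this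
    exact this P hP
  · intro h G hG
    rw [← SetLike.mem_coe, hS G hG]
    exact fun P hP => h P (Set.mem_biUnion hG hP)

theorem isQClosed_mumfordTate : IsQClosed (mumfordTate W F : Set (GLC V)) :=
  isQClosed_sInf fun _ hG => hG.1

theorem deligneTorus_mem_mumfordTate (z : ℂˣ × ℂˣ) : deligneTorus W F z ∈ mumfordTate W F :=
  Subgroup.mem_sInf.2 fun _ hG => hG.2 z

theorem mumfordTate_le {G : Subgroup (GLC V)} (hG : IsQClosed (G : Set (GLC V)))
    (h : ∀ z, deligneTorus W F z ∈ G) : mumfordTate W F ≤ G := sInf_le ⟨hG, h⟩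

/-- For a single complex a the condition ga ∈ Z need not be rational; over a Galois stable family of
a it is. -/
theorem isQClosed_translate {A Z : Set (GLC V)} (hA : GalStable A) (hZ : IsQClosed Z) :
    IsQClosed {g : GLC V | ∀ a ∈ A, g * a ∈ Z} := by
  have hgal := hZ.galStable
  obtain ⟨S, hS⟩ := hZ
  refine isQClosed_of_polyFun (κ := A × S)
    (f := fun t X => MvPolynomial.eval (entries (LinearMap.mulRight ℂ t.1.1.toLinearMap X))
      (MvPolynomial.map (algebraMap ℚ ℂ) t.2.1))
    (fun t => IsPolyFun.comp_linear (f := fun Y => MvPolynomial.eval (entries Y) _)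
      ⟨_, fun _ => rfl⟩ _) (fun g => ?_) fun σ g hg a ha => ?_
  · have h1 : ∀ (a : GLC V) (P : MatPoly V), MvPolynomial.eval
        (entries (LinearMap.mulRight ℂ a.toLinearMap g.toLinearMap))
        (MvPolynomial.map (algebraMap ℚ ℂ) P) =
        MvPolynomial.aeval (entries (g * a).toLinearMap) P := fun a P => by
      rw [LinearMap.mulRight_apply, ← toLinearMap_mul, MvPolynomial.eval_map,
        ← MvPolynomial.aeval_def]
    simp only [h1, hS]
    constructor
    · rintro h ⟨⟨a, ha⟩, P, hP⟩
      exact h a ha P hP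
    · intro h a ha P hP
      exact h ⟨⟨a, ha⟩, P, hP⟩
  · have h1 := hgal σ _ (hg _ (hA σ.symm a ha))
    rwa [galConj_mul, galConj_galConj_symm] at h1

omit [Module.Finite ℚ V] in
theorem GalStable.inter {A A' : Set (GLC V)} (h : GalStable A) (h' : GalStable A') :
    GalStable (A ∩ A') := fun σ g hg => ⟨h σ g hg.1, h' σ g hg.2⟩

/-- Suppose two closed sets cover G and are disjoint on it. The elements of G whose left translation
preserves both parts form a ℚ-closed subgroup K. It contains the torus, since the curve t ↦ exp(tY)g
is irreducible and passes through g. Minimality gives K = G, and translating the identity puts all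
of G in one part. -/
theorem isQConnected_mumfordTate (h : IsMixedHodge W F) :
    IsQConnected (mumfordTate W F : Set (GLC V)) := by
  set G := mumfordTate W F with hG
  have hcl : IsQClosed (G : Set (GLC V)) := isQClosed_mumfordTate
  refine ⟨⟨1, G.one_mem⟩, ?_⟩
  suffices H : ∀ Z₁ Z₂ : Set (GLC V), IsQClosed Z₁ → IsQClosed Z₂ → (G : Set (GLC V)) ⊆ Z₁ ∪ Z₂ →
      (G : Set (GLC V)) ∩ (Z₁ ∩ Z₂) = ∅ → 1 ∈ Z₁ → (G : Set (GLC V)) ⊆ Z₁ by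
    intro Z₁ Z₂ h₁ h₂ hun hdis
    rcases hun G.one_mem with h | h
    · exact Or.inl (H Z₁ Z₂ h₁ h₂ hun hdis h)
    · exact Or.inr (H Z₂ Z₁ h₂ h₁ (by rwa [Set.union_comm]) (by rwa [Set.inter_comm Z₂]) h)
  intro Z₁ Z₂ h₁ h₂ hun hdis h1
  have hnot : ∀ g ∈ G, g ∈ Z₁ → g ∈ Z₂ → False := fun g hg hg1 hg2 => by
    have : g ∈ (∅ : Set (GLC V)) := by
      rw [← hdis]
      exact ⟨hg, hg1, hg2⟩
    exact this
  let K : Subgroup (GLC V) :=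
    { carrier := (G : Set (GLC V)) ∩ ({g | ∀ a ∈ (G : Set (GLC V)) ∩ Z₁, g * a ∈ Z₁} ∩
        {g | ∀ a ∈ (G : Set (GLC V)) ∩ Z₂, g * a ∈ Z₂})
      mul_mem' := by
        rintro a b ⟨ha, ha1, ha2⟩ ⟨hb, hb1, hb2⟩
        refine ⟨G.mul_mem ha hb, fun x hx => ?_, fun x hx => ?_⟩
        · rw [mul_assoc]
          exact ha1 _ ⟨G.mul_mem hb hx.1, hb1 x hx⟩
        · rw [mul_assoc]
          exact ha2 _ ⟨G.mul_mem hb hx.1, hb2 x hx⟩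
      one_mem' := ⟨G.one_mem, fun x hx => by rw [one_mul]; exact hx.2,
        fun x hx => by rw [one_mul]; exact hx.2⟩
      inv_mem' := by
        rintro a ⟨ha, ha1, ha2⟩
        refine ⟨G.inv_mem ha, fun x hx => ?_, fun x hx => ?_⟩
        · have hmem : a⁻¹ * x ∈ G := G.mul_mem (G.inv_mem ha) hx.1
          refine (hun hmem).resolve_right fun h2 => hnot x hx.1 hx.2 ?_
          have := ha2 _ ⟨hmem, h2⟩
          rwa [mul_inv_cancel_left] at this
        · have hmem : a⁻¹ * x ∈ G := G.mul_mem (G.inv_mem ha) hx.1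
          refine (hun hmem).resolve_left fun h2 => hnot x hx.1 ?_ hx.2
          have := ha1 _ ⟨hmem, h2⟩
          rwa [mul_inv_cancel_left] at this }
  have hKcl : IsQClosed (K : Set (GLC V)) :=
    hcl.inter ((isQClosed_translate (hcl.galStable.inter h₁.galStable) h₁).inter
      (isQClosed_translate (hcl.galStable.inter h₂.galStable) h₂))
  have htor : ∀ z, h.bigrading.torus z ∈ G := fun z => by
    rw [← h.deligneTorus_eq]; exact deligneTorus_mem_mumfordTate z
  have hle : G ≤ K := mumfordTate_le hKcl fun z => by
    rw [h.deligneTorus_eq]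
    obtain ⟨a, ha⟩ := exists_exp_eq z.1
    obtain ⟨b, hb⟩ := exists_exp_eq z.2
    have hz := expGL_scalar_linChr h.bigrading z ha hb
    have hcurve : ∀ g ∈ G, ∀ t : ℂ,
        expGL (t • h.bigrading.scalar (linChr a b)) * g ∈ Z₁ ∪ Z₂ := fun g hg t => by
      obtain ⟨w, hw⟩ := expGL_smul_scalar_linChr h.bigrading t a b
      rw [hw]
      exact hun (G.mul_mem (htor w) hg)
    refine ⟨htor z, fun g hg => ?_, fun g hg => ?_⟩
    · rcases forall_mem_or_forall_mem_of_exp h₁ h₂ (hcurve g hg.1) with h' | h'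
      · have := h' 1
        rwa [one_smul, hz] at this
      · have := h' 0
        rw [zero_smul, expGL_zero, one_mul] at this
        exact (hnot g hg.1 hg.2 this).elim
    · rcases forall_mem_or_forall_mem_of_exp h₁ h₂ (hcurve g hg.1) with h' | h'
      · have := h' 0
        rw [zero_smul, expGL_zero, one_mul] at this
        exact (hnot g hg.1 this hg.2).elim
      · have := h' 1
        rwa [one_smul, hz] at this
  intro g hg
  have := (hle hg).2.1 1 ⟨G.one_mem, h1⟩
  rwa [mul_one] at this

end MumfordTate

/-! ### Polarizations and the unipotent radical. -/

section Polarization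

variable {V : Type*} [AddCommGroup V] [Module ℚ V]
  {W : WeightFiltration V} {F : CxFiltration V} {Q : GradedForms W} {B : Bigrading (Cx V)}

theorem IsSplitting.grForm_proj_proj (hB : IsSplitting (gal conjQ) W.cx F B) {k : ℤ}
    (hpol : IsPolarizedBy k (inducedFiltration W F k) (Q.form k)) {i j : ℤ × ℤ}
    (hi : i.1 + i.2 = k) (hj : j.1 + j.2 = k) (hij : j ≠ i.swap) (x y : Cx V) :
    grForm Q k (B.proj i x) (B.proj j y) = 0 := by
  have hu : W.grC k (B.proj i x) ∈ hodgePiece (inducedFiltration W F k) i.1 i.2 :=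
    hB.grC_proj_mem_hodgePiece hi x
  have hv : W.grC k (B.proj j y) ∈ hodgePiece (inducedFiltration W F k) j.1 j.2 :=
    hB.grC_proj_mem_hodgePiece hj y
  have hv' : gal conjQ (W.grC k (B.proj j y)) ∈
      hodgePiece (inducedFiltration W F k) j.2 j.1 := by
    refine ⟨hv.2, ?_⟩
    change gal conjQ (gal conjQ (W.grC k (B.proj j y))) ∈ inducedFiltration W F k j.1
    rw [gal_conjQ_gal_conjQ]
    exact hv.1
  have h1 : i.2 = k - i.1 := by omega
  have h2 : j.1 = k - j.2 := by omega
  rw [h1] at hu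
  rw [h2] at hv'
  have := hpol.orthogonal i.1 j.2 (fun h => hij (Prod.ext (by simp; omega) (by simp; omega)))
    _ hu _ hv'
  rwa [gal_conjQ_gal_conjQ] at this

theorem IsSplitting.proj_mem_of_grForm_conj_eq_zero (hB : IsSplitting (gal conjQ) W.cx F B) {k : ℤ}
    (hpol : IsPolarizedBy k (inducedFiltration W F k) (Q.form k)) {i : ℤ × ℤ}
    (hi : i.1 + i.2 = k) {x : Cx V}
    (h0 : grForm Q k (B.proj i x) (gal conjQ (B.proj i x)) = 0) :
    B.proj i x ∈ W.cx (k - 1) := by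
  have hu : W.grC k (B.proj i x) ∈ hodgePiece (inducedFiltration W F k) i.1 i.2 :=
    hB.grC_proj_mem_hodgePiece hi x
  have h1 : i.2 = k - i.1 := by omega
  rw [h1] at hu
  rw [← WeightFiltration.grC_eq_zero_iff (hB.proj_mem_W hi.le x)]
  by_contra hne
  obtain ⟨r, hr, hr'⟩ := hpol.positive i.1 _ hu hne
  rw [grForm_apply, ← WeightFiltration.gal_grC] at h0
  rw [h0, mul_zero] at hr'
  exact hr.ne (by exact_mod_cast hr')

/-- The form on `Gr_k` pairs only conjugate types. -/
theorem IsSplitting.grForm_eq_sum (hB : IsSplitting (gal conjQ) W.cx F B) {k : ℤ}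
    (hpol : IsPolarizedBy k (inducedFiltration W F k) (Q.form k)) {x y : Cx V} (hx : x ∈ W.cx k)
    (hy : y ∈ W.cx k) : grForm Q k x y =
      ∑ i ∈ B.supp, ∑ j ∈ B.supp, if i.1 + i.2 = k ∧ j = i.swap then
        grForm Q k (B.proj i x) (B.proj j y) else 0 := by
  conv_lhs => rw [← B.sum_proj x, ← B.sum_proj y]
  rw [map_sum (grForm Q k) (fun i => B.proj i x) B.supp, LinearMap.sum_apply]
  refine Finset.sum_congr rfl fun i _ => ?_
  rw [map_sum]
  refine Finset.sum_congr rfl fun j _ => ?_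
  split_ifs with h
  · rfl
  · have hzero : ∀ (l : ℤ × ℤ) {w : Cx V}, w ∈ W.cx k → l.1 + l.2 ≠ k →
        B.proj l w ∈ W.cx (k - 1) := fun l w hw hl => by
      rcases lt_or_gt_of_ne hl with hl | hl
      · exact hB.proj_mem_W (by omega) w
      · rw [(hB.mem_W k w).1 hw l hl]; exact Submodule.zero_mem _
    by_cases hi : i.1 + i.2 = k
    · by_cases hj : j.1 + j.2 = k
      · exact hB.grForm_proj_proj hpol hi hj (fun hij => h ⟨hi, hij⟩) x y
      · exact grForm_eq_zero_right (hzero j hy hj) _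
    · exact grForm_eq_zero_left (hzero i hx hi) _

theorem IsSplitting.torus_mem_stabW [Module.Finite ℚ V] (hB : IsSplitting (gal conjQ) W.cx F B)
    (z : ℂˣ × ℂˣ) : B.torus z ∈ stabW W := fun k x hx => by
  refine (hB.mem_W _ _).2 fun i hi => ?_
  rw [Bigrading.torus_apply, Bigrading.proj_scalar, (hB.mem_W _ _).1 hx i hi, smul_zero]

theorem IsSplitting.torus_mem_simGroup [Module.Finite ℚ V]
    (hB : IsSplitting (gal conjQ) W.cx F B)
    (hpol : ∀ k, IsPolarizedBy k (inducedFiltration W F k) (Q.form k)) (z : ℂˣ × ℂˣ) :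
    B.torus z ∈ simGroup Q := by
  have hst := hB.torus_mem_stabW z
  refine ⟨hst, fun k => ⟨((z.1 * z.2) ^ k : ℂˣ), Units.ne_zero _, fun x hx y hy => ?_⟩⟩
  rw [hB.grForm_eq_sum (hpol k) hx hy, hB.grForm_eq_sum (hpol k) (hst k x hx) (hst k y hy),
    Finset.mul_sum]
  refine Finset.sum_congr rfl fun i _ => ?_
  rw [Finset.mul_sum]
  refine Finset.sum_congr rfl fun j _ => ?_
  split_ifs with h
  · obtain ⟨rfl, rfl⟩ := h
    rw [Bigrading.torus_apply, Bigrading.torus_apply, Bigrading.proj_scalar, Bigrading.proj_scalar,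
      map_smul, map_smul, LinearMap.smul_apply, smul_eq_mul, smul_eq_mul, ← mul_assoc]
    congr 1
    simp only [Bigrading.chr, Prod.fst_swap, Prod.snd_swap, ← Units.val_mul]
    congr 1
    rw [mul_zpow, zpow_add, zpow_add, mul_mul_mul_comm, mul_comm (z.1 ^ i.2)]
  · rw [mul_zero]

/-- The form on `Gr_k` is nondegenerate. -/
theorem IsSplitting.mem_of_forall_grForm_eq_zero (hB : IsSplitting (gal conjQ) W.cx F B) {k : ℤ}
    (hpol : IsPolarizedBy k (inducedFiltration W F k) (Q.form k)) {x : Cx V} (hx : x ∈ W.cx k)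
    (h0 : ∀ y ∈ W.cx k, grForm Q k x y = 0) : x ∈ W.cx (k - 1) := by
  refine hB.mem_W_pred hx fun i hi => hB.proj_mem_of_grForm_conj_eq_zero hpol hi ?_
  set u := B.proj i x
  have h1 : gal conjQ u - B.proj i.swap (gal conjQ u) ∈ W.cx (k - 1) :=
    hB.conj_proj_sub (by omega) x
  have hswap : B.proj i.swap (gal conjQ u) ∈ W.cx k :=
    hB.proj_mem_W (by simp; omega) _
  have h2 : ∀ w, grForm Q k w (gal conjQ u) = grForm Q k w (B.proj i.swap (gal conjQ u)) := by
    intro w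
    rw [← sub_eq_zero, ← map_sub]
    exact grForm_eq_zero_right h1 w
  -- In weight k only the component u of x pairs with type i.swap, so the hermitian norm of u equals
  -- a value of the form on x, which is zero by hypothesis.
  rw [h2, ← h0 _ hswap, hB.grForm_eq_sum hpol hx hswap,
    hB.grForm_eq_sum hpol (hB.proj_mem_W hi.le x) hswap]
  refine Finset.sum_congr rfl fun i' _ => Finset.sum_congr rfl fun j' _ => ?_
  split_ifs with h
  · obtain ⟨-, rfl⟩ := h
    by_cases hii : i' = i
    · rw [hii, B.proj_self]
    · rw [B.proj_ne (fun h' => hii (Prod.swap_injective h')) _, map_zero, map_zero]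
  · rfl

variable [Module.Finite ℚ V]

/-- Linear forms on `W_k` that vanish on `W_{k-1}` are represented by the graded form. -/
theorem IsSplitting.exists_grForm_eq (hB : IsSplitting (gal conjQ) W.cx F B) {k : ℤ}
    (hpol : IsPolarizedBy k (inducedFiltration W F k) (Q.form k)) {l : Cx V →ₗ[ℂ] ℂ}
    (hl : ∀ w ∈ W.cx (k - 1), l w = 0) :
    ∃ y ∈ W.cx k, ∀ x ∈ W.cx k, grForm Q k y x = l x := by
  have hsurj : Function.Surjective (W.grC k ∘ₗ (W.cx k).subtype) := fun ξ => by
    obtain ⟨x, hx, rfl⟩ := WeightFiltration.grC_surjective k ξ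
    exact ⟨⟨x, hx⟩, rfl⟩
  obtain ⟨s, hs⟩ := LinearMap.exists_rightInverse_of_surjective _ (LinearMap.range_eq_top.2 hsurj)
  have hs' : ∀ ξ, W.grC k (s ξ : Cx V) = ξ := fun ξ => LinearMap.congr_fun hs ξ
  let b : Cx (W.Gr k) →ₗ[ℂ] Module.Dual ℂ (Cx (W.Gr k)) :=
    LinearMap.BilinForm.baseChange ℂ (Q.form k)
  have hinj : Function.Injective b := by
    rw [← LinearMap.ker_eq_bot, LinearMap.ker_eq_bot']
    intro η hη
    rw [← hs' η, WeightFiltration.grC_eq_zero_iff (s η).2]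
    refine hB.mem_of_forall_grForm_eq_zero hpol (s η).2 fun y _ => ?_
    rw [grForm_apply, hs']
    exact LinearMap.congr_fun hη _
  have hb : Function.Surjective b :=
    (LinearMap.injective_iff_surjective_of_finrank_eq_finrank (Subspace.dual_finrank_eq).symm).1 hinj
  obtain ⟨η, hη⟩ := hb (l ∘ₗ (W.cx k).subtype ∘ₗ s)
  refine ⟨s η, (s η).2, fun x hx => ?_⟩
  have h1 : grForm Q k (s η) x = l (s (W.grC k x)) := by
    rw [grForm_apply, hs']
    exact LinearMap.congr_fun hη _
  rw [h1, ← sub_eq_zero, ← map_sub]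
  refine hl _ ?_
  rw [← WeightFiltration.grC_eq_zero_iff (Submodule.sub_mem _ (s _).2 hx), map_sub, hs', sub_self]

/-- The unipotent radical consists of the elements that act trivially on the graded pieces. -/
theorem IsSplitting.unipotentRadical_eq (hB : IsSplitting (gal conjQ) W.cx F B)
    (hpol : ∀ k, IsPolarizedBy k (inducedFiltration W F k) (Q.form k)) {G : Subgroup (GLC V)}
    (hG : IsQClosed (G : Set (GLC V))) (hsim : G ≤ simGroup Q) (htor : ∀ z, B.torus z ∈ G) :
    unipotentRadical G = G ⊓ grTriv W := by
  have hst : ∀ g ∈ G, ∀ k, ∀ x ∈ W.cx k, g x ∈ W.cx k := fun g hg => (hsim hg).1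
  apply le_antisymm
  · refine sSup_le ?_
    rintro N ⟨hNG, hNc, hnorm, hunip⟩
    refine le_inf hNG fun n hn k x hx => ?_
    have hNgal := hNc.closed.galStable
    -- M is the preimage in W_k of the N-fixed vectors of Gr_k, and P below is its orthogonal.
    -- Normality of N makes M stable under G, similitudes preserve P, and Galois stability of N
    -- makes M real. It has to be shown that M is all of W_k.
    let M : Submodule ℂ (Cx V) :=
      { carrier := {x | x ∈ W.cx k ∧ ∀ n ∈ N, n x - x ∈ W.cx (k - 1)}
        add_mem' := fun {x y} hx hy => ⟨Submodule.add_mem _ hx.1 hy.1, fun n hn => by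
          rw [map_add, add_sub_add_comm]
          exact Submodule.add_mem _ (hx.2 n hn) (hy.2 n hn)⟩
        zero_mem' := ⟨Submodule.zero_mem _, fun n _ => by
          rw [map_zero, sub_zero]; exact Submodule.zero_mem _⟩
        smul_mem' := fun a x hx => ⟨Submodule.smul_mem _ a hx.1, fun n hn => by
          rw [map_smul, ← smul_sub]
          exact Submodule.smul_mem _ a (hx.2 n hn)⟩ }
    let P : Submodule ℂ (Cx V) :=
      { carrier := {y | y ∈ W.cx k ∧ ∀ x ∈ M, grForm Q k y x = 0}
        add_mem' := fun {x y} hx hy => ⟨Submodule.add_mem _ hx.1 hy.1, fun w hw => by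
          rw [map_add, LinearMap.add_apply, hx.2 w hw, hy.2 w hw, add_zero]⟩
        zero_mem' := ⟨Submodule.zero_mem _, fun w _ => by rw [map_zero, LinearMap.zero_apply]⟩
        smul_mem' := fun a x hx => ⟨Submodule.smul_mem _ a hx.1, fun w hw => by
          rw [map_smul, LinearMap.smul_apply, hx.2 w hw, smul_zero]⟩ }
    have hWM : W.cx (k - 1) ≤ M := fun x hx =>
      ⟨WeightFiltration.cx_mono (by omega) hx, fun n hn =>
        Submodule.sub_mem _ (hst n (hNG hn) _ x hx) hx⟩
    have hMG : ∀ g ∈ G, ∀ x ∈ M, g x ∈ M := fun g hg x hx => ⟨hst g hg k x hx.1, fun n hn => by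
      have h1 := hst g hg _ _ (hx.2 _ (hnorm g⁻¹ (G.inv_mem hg) n hn))
      rw [inv_inv, map_sub, LinearEquiv.mul_apply, LinearEquiv.mul_apply, GL_apply_inv_self] at h1
      exact h1⟩
    have hPG : ∀ g ∈ G, ∀ y ∈ P, g y ∈ P := fun g hg y hy => ⟨hst g hg k y hy.1, fun x hx => by
      obtain ⟨c, -, hc⟩ := (hsim hg).2 k
      have hx' := hMG _ (G.inv_mem hg) x hx
      have h1 := hc y hy.1 _ hx'.1
      rw [GL_apply_inv_self, hy.2 _ hx', mul_zero] at h1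
      exact h1⟩
    have hproj : ∀ L : Submodule ℂ (Cx V), (∀ g ∈ G, ∀ x ∈ L, g x ∈ L) →
        ∀ i, ∀ x ∈ L, B.proj i x ∈ L := fun L hL i x hx =>
      B.proj_mem_of_scalar_mem chr_genericPoint_injective
        (fun x hx => hL _ (htor genericPoint) x hx) i hx
    have hMc : ∀ x ∈ M, gal conjQ x ∈ M := fun x hx =>
      ⟨WeightFiltration.gal_mem_cx _ hx.1, fun n hn => by
        have h1 := WeightFiltration.gal_mem_cx conjQ (hx.2 _ (hNgal conjQ.symm n hn))
        rw [map_sub, galConj_apply, gal_gal_symm] at h1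
        exact h1⟩
    -- M and P are graded because they are stable under the torus. A component of a vector in M ∩ P
    -- is orthogonal to its own conjugate, which lies in M; positivity of the polarization puts it
    -- in W_{k-1}.
    have hMP : ∀ x ∈ M, x ∈ P → x ∈ W.cx (k - 1) := fun x hxM hxP => by
      refine hB.mem_W_pred hxM.1 fun i hi => hB.proj_mem_of_grForm_conj_eq_zero (hpol k) hi ?_
      exact (hproj P hPG i x hxP).2 _ (hMc _ (hproj M hMG i x hxM))
    have hPW : P ≤ W.cx (k - 1) := by
      by_contra hcon
      -- Kolchin's theorem on P modulo W_{k-1} would give a nonzero fixed class, that is, an element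
      -- of M ∩ P outside W_{k-1}.
      obtain ⟨v, hvP, hvW, hfix⟩ := exists_fixed_of_unipotent_of_lt
        (N := (fun n : GLC V => n.toLinearMap) '' N)
        (by
          rintro _ ⟨n, hn, rfl⟩ _ ⟨m, hm, rfl⟩
          exact ⟨n * m, N.mul_mem hn hm, toLinearMap_mul n m⟩)
        (by
          rintro _ ⟨n, hn, rfl⟩
          exact hunip n hn)
        (A := W.cx (k - 1)) (B := P)
        (by
          rintro _ ⟨n, hn, rfl⟩ v hv
          exact hst n (hNG hn) _ v hv)
        (by
          rintro _ ⟨n, hn, rfl⟩ v hv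
          exact hPG n (hNG hn) v hv) hcon
      exact hvW (hMP v ⟨hvP.1, fun n hn => hfix _ ⟨n, hn, rfl⟩⟩ hvP)
    suffices hM : x ∈ M from hM.2 n hn
    refine mem_of_forall_dual fun l hl => ?_
    -- A linear form that vanishes on M is represented on W_k by an element of P, and P has zero
    -- class in Gr_k, so the form vanishes on W_k.
    obtain ⟨y, hy, hyl⟩ := hB.exists_grForm_eq (hpol k) (l := l) fun w hw => hl w (hWM hw)
    have hyP : y ∈ P := ⟨hy, fun w hw => by rw [hyl w hw.1, hl w hw]⟩
    rw [← hyl x hx]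
    exact grForm_eq_zero_left (hPW hyP) x
  · refine le_sSup ⟨inf_le_left, ⟨hG.inter isQClosed_grTriv, ?_⟩, ?_, fun n hn =>
      isNilpotent_of_mem_grTriv hn.2⟩
    · exact isQConnected_of_unipotent fun u hu => isNilpotent_of_mem_grTriv hu.2
    · exact fun g hg n hn => ⟨G.mul_mem (G.mul_mem hg hn.1) (G.inv_mem hg),
        conj_mem_grTriv (hst g hg) hn.2⟩

end Polarization

/-! ### Weight spaces of a torus and of its adjoint action. -/

section TorusWeights

variable {E : Type*} [AddCommGroup E] [Module ℂ E] (B : Bigrading E)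

namespace Bigrading

theorem ext_proj {x y : E} (h : ∀ i, B.proj i x = B.proj i y) : x = y := by
  rw [← B.sum_proj x, ← B.sum_proj y, Finset.sum_congr rfl fun i _ => h i]

/-- The eigenvalue at the generic point alone already singles out the summand. -/
theorem mem_torusWeightSpace_iff {i : ℤ × ℤ} {x : E} :
    x ∈ torusWeightSpace (fun z => B.scalar (chr z)) i.1 i.2 ↔ B.proj i x = x := by
  rw [torusWeightSpace, Submodule.mem_iInf]
  simp only [Module.End.mem_eigenspace_iff]
  constructor
  · intro h
    refine B.ext_proj fun j => ?_
    rw [B.proj_proj]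
    split_ifs with hij
    · rw [hij]
    · have h1 := congrArg (B.proj j) (h genericPoint)
      change _ = B.proj j (chr genericPoint i • x) at h1
      rw [proj_scalar, map_smul, ← sub_eq_zero, ← sub_smul] at h1
      exact ((smul_eq_zero.1 h1).resolve_left
        (sub_ne_zero.2 fun h => hij (chr_genericPoint_injective h))).symm
  · intro h z
    rw [← h]
    exact B.scalar_proj _ _ _

theorem endo_scalar_apply (z : ℂˣ × ℂˣ) (X : Module.End ℂ E) :
    B.endo.scalar (chr z) X = (B.torus z).conj X := by
  refine B.endo.ext_proj fun i => ?_
  rw [proj_scalar]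
  refine B.linearMap_ext fun a x => ?_
  have h1 : (B.torus z).symm (B.proj a x) = chr z⁻¹ a • B.proj a x := B.scalar_proj _ _ _
  rw [endo_proj_apply_proj, LinearMap.smul_apply, endo_proj_apply_proj,
    LinearEquiv.conj_apply_apply, h1, map_smul, map_smul, map_smul, torus_apply, proj_scalar,
    smul_smul]
  congr 1
  have h2 : chr z (a + i) = chr z a * chr z i := by
    simp only [chr, ← Units.val_mul, Prod.fst_add, Prod.snd_add, zpow_add]
    rw [mul_mul_mul_comm]
  have h3 : chr z⁻¹ a * chr z a = 1 := by
    have := congrFun (chr_mul z⁻¹ z) a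
    rw [inv_mul_cancel, chr_one] at this
    exact this.symm
  rw [h2, ← mul_assoc, h3, one_mul]

theorem conjBy_torus (g : E ≃ₗ[ℂ] E) (z : ℂˣ × ℂˣ) :
    (B.conjBy g).torus z = g * B.torus z * g⁻¹ := by
  ext x
  exact B.conjBy_scalar_apply g _ x

end Bigrading

end TorusWeights

/-! ### Recovering both filtrations from a splitting torus. -/

section InducedFiltrations

variable {V : Type*} [AddCommGroup V] [Module ℚ V] {W : WeightFiltration V} {F : CxFiltration V}
  (B : Bigrading (Cx V))

theorem Bigrading.mem_torusPiece_iff {i : ℤ × ℤ} {x : Cx V} :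
    x ∈ torusPiece B.torus i.1 i.2 ↔ B.proj i x = x := B.mem_torusWeightSpace_iff

theorem Bigrading.proj_mem_torusPiece (i : ℤ × ℤ) (x : Cx V) :
    B.proj i x ∈ torusPiece B.torus i.1 i.2 := B.mem_torusPiece_iff.2 (B.proj_self i x)

theorem Bigrading.isAlgebraicTorusHom_torus : IsAlgebraicTorusHom B.torus := by
  refine eq_top_iff.2 fun x _ => ?_
  rw [← B.sum_proj x]
  exact Submodule.sum_mem _ fun i _ => Submodule.mem_iSup_of_mem i.1
    (Submodule.mem_iSup_of_mem i.2 (B.proj_mem_torusPiece i x))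

variable {B}

theorem IsSplitting.hodgeFiltrationOf_torus (hB : IsSplitting (gal conjQ) W.cx F B) :
    hodgeFiltrationOf B.torus = F := by
  funext p
  apply le_antisymm
  · refine iSup_le fun r => iSup_le fun s => iSup_le fun hr x hx => ?_
    rw [← (B.mem_torusPiece_iff (i := (r, s))).1 hx]
    exact hB.proj_mem_F hr x
  · intro x hx
    rw [← B.sum_proj x]
    refine Submodule.sum_mem _ fun i _ => ?_
    by_cases hi : p ≤ i.1
    · exact Submodule.mem_iSup_of_mem i.1 (Submodule.mem_iSup_of_mem i.2
        (Submodule.mem_iSup_of_mem hi (B.proj_mem_torusPiece i x)))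
    · rw [(hB.mem_F p x).1 hx i (not_le.1 hi)]
      exact Submodule.zero_mem _

theorem IsSplitting.weightFiltrationOf_torus (hB : IsSplitting (gal conjQ) W.cx F B) (k : ℤ) :
    weightFiltrationOf B.torus k = W.cx k := by
  apply le_antisymm
  · refine iSup_le fun r => iSup_le fun s => iSup_le fun hr x hx => ?_
    rw [← (B.mem_torusPiece_iff (i := (r, s))).1 hx]
    exact hB.proj_mem_W hr x
  · intro x hx
    rw [← B.sum_proj x]
    refine Submodule.sum_mem _ fun i _ => ?_
    by_cases hi : i.1 + i.2 ≤ k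
    · exact Submodule.mem_iSup_of_mem i.1 (Submodule.mem_iSup_of_mem i.2
        (Submodule.mem_iSup_of_mem hi (B.proj_mem_torusPiece i x)))
    · rw [(hB.mem_W k x).1 hx i (not_le.1 hi)]
      exact Submodule.zero_mem _

end InducedFiltrations

/-! ### Automorphisms real on the graded pieces; the group G(ℝ)U(ℂ). -/

section RealOnGraded

variable {V : Type*} [AddCommGroup V] [Module ℚ V] [Module.Finite ℚ V] (W : WeightFiltration V)

/-- The automorphisms which preserve the weight filtration and are real on the graded pieces. -/
def realGr : Subgroup (GLC V) where
  carrier := {g | g ∈ stabW W ∧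
    ∀ k, ∀ x ∈ W.cx k, gal conjQ (g x) - g (gal conjQ x) ∈ W.cx (k - 1)}
  mul_mem' := by
    rintro a b ⟨ha, ha'⟩ ⟨hb, hb'⟩
    refine ⟨(stabW W).mul_mem ha hb, fun k x hx => ?_⟩
    have h1 := ha (k - 1) _ (hb' k x hx)
    have h2 := add_mem (ha' k _ (hb k x hx)) h1
    rwa [map_sub, sub_add_sub_cancel] at h2
  one_mem' := ⟨(stabW W).one_mem, fun k x _ => by
    rw [LinearEquiv.coe_one, id, id, sub_self]; exact Submodule.zero_mem _⟩
  inv_mem' := by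
    rintro a ⟨ha, ha'⟩
    refine ⟨(stabW W).inv_mem ha, fun k x hx => ?_⟩
    have h1 := (stabW W).inv_mem ha (k - 1) _ (ha' k _ ((stabW W).inv_mem ha k x hx))
    rw [GL_apply_inv_self, map_sub, GL_inv_apply_self] at h1
    rw [← neg_sub (a⁻¹ (gal conjQ x))]
    exact neg_mem h1

variable {W}

theorem grTriv_le_realGr : grTriv W ≤ realGr W := fun u hu =>
  ⟨grTriv_le_stabW hu, fun k x hx => by
    have h1 := sub_mem (WeightFiltration.gal_mem_cx conjQ (hu k x hx))
      (hu k _ (WeightFiltration.gal_mem_cx conjQ hx))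
    rwa [map_sub, sub_sub_sub_cancel_right] at h1⟩

theorem realPoints_le_realGr {G : Subgroup (GLC V)} (hG : G ≤ stabW W) :
    realPoints G ≤ realGr W := fun g hg =>
  ⟨hG hg.1, fun k x _ => by rw [← hg.2 x, sub_self]; exact Submodule.zero_mem _⟩

/-- An element of `𝐆` which is real on the graded pieces is the product of a real point
and an element acting trivially on the graded pieces. -/
theorem exists_realPoints_mul {G : Subgroup (GLC V)} (hG : IsQClosed (G : Set (GLC V)))
    {g : GLC V} (hg : g ∈ G) (hgr : g ∈ realGr W) :
    ∃ r ∈ realPoints G, ∃ u ∈ G ⊓ grTriv W, g = r * u := by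
  have hst := (stabW W).inv_mem hgr.1
  have hGU : IsQClosed ((G ⊓ grTriv W : Subgroup (GLC V)) : Set (GLC V)) :=
    hG.inter isQClosed_grTriv
  -- v lies in G ∩ `grTriv` and satisfies conj(v) = v⁻¹. Its unipotent square root w inherits
  -- conj(w) = w⁻¹, so conj(gw) = (gv)w⁻¹ = gw is real. This is the vanishing of the first
  -- cohomology of a unipotent group.
  set v := g⁻¹ * galConj conjQ g with hv
  have hvU : v ∈ G ⊓ grTriv W := by
    refine ⟨G.mul_mem (G.inv_mem hg) (hG.galStable _ _ hg), fun k x hx => ?_⟩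
    have h1 := hst (k - 1) _ (hgr.2 k _ (WeightFiltration.gal_mem_cx conjQ hx))
    rw [map_sub, gal_conjQ_gal_conjQ, GL_inv_apply_self] at h1
    exact h1
  have hinv : ∀ a : GLC V, galConj conjQ (galConj conjQ a) = a := fun a =>
    galConj_galConj_symm conjQ a
  have hvbar : galConj conjQ v = v⁻¹ := by
    rw [hv, galConj_mul, galConj_inv, hinv, mul_inv_rev, inv_inv]
  have hnil := isNilpotent_of_mem_grTriv hvU.2
  have hnil' := isNilpotent_inv_sub_one hnil
  set w := upowGL v hnil (1 / 2) with hw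
  have hw2 : w * w = v := upowGL_half_sq v hnil
  have hwU : w ∈ G ⊓ grTriv W := upowGL_mem hGU hnil hvU _
  have hwbar : galConj conjQ w = w⁻¹ := by
    have h1 : w * galConj conjQ w = 1 := by
      apply LinearEquiv.toLinearMap_injective
      rw [hw, galConj_upowGL conjQ v hnil (by rw [hvbar]; exact hnil'), toLinearMap_mul,
        upowGL_toLinearMap, upowGL_toLinearMap, hvbar]
      have : conjQ (1 / 2) = 1 / 2 := by rw [map_div₀, map_one, map_ofNat]
      rw [this]
      exact upow_mul_upow_inv hnil _
    exact eq_inv_of_mul_eq_one_right h1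
  refine ⟨g * w, ⟨G.mul_mem hg hwU.1, ?_⟩, w⁻¹, (G ⊓ grTriv W).inv_mem hwU,
    (mul_inv_cancel_right g w).symm⟩
  rw [isGaloisConj_iff, galConj_mul, hwbar, eq_mul_inv_iff_mul_eq, mul_assoc, hw2, hv,
    mul_inv_cancel_left]

/-- The products of real points with elements of U are exactly the elements of G real on the graded
pieces, by `exists_realPoints_mul`. The conjugacy class is therefore the orbit of a single subgroup.
-/
theorem mem_conjClass_iff {G : Subgroup (GLC V)} (hG : IsQClosed (G : Set (GLC V)))
    (hst : G ≤ stabW W) (hU : unipotentRadical G = G ⊓ grTriv W) {χ χ' : TorusHom V} :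
    χ' ∈ conjClass G χ ↔ ∃ g ∈ G ⊓ realGr W, ∀ z, χ' z = g * χ z * g⁻¹ := by
  constructor
  · rintro ⟨r, hr, u, hu, h⟩
    rw [hU] at hu
    exact ⟨r * u, (G ⊓ realGr W).mul_mem ⟨hr.1, realPoints_le_realGr hst hr⟩
      ⟨hu.1, grTriv_le_realGr hu.2⟩, h⟩
  · rintro ⟨g, hg, h⟩
    obtain ⟨r, hr, u, hu, rfl⟩ := exists_realPoints_mul hG hg.1 hg.2
    exact ⟨r, hr, u, hU ▸ hu, h⟩

theorem IsSplitting.conjBy {F : CxFiltration V} {B : Bigrading (Cx V)}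
    (hB : IsSplitting (gal conjQ) W.cx F B) {g : GLC V} (hg : g ∈ realGr W) :
    IsSplitting (gal conjQ) W.cx (fun p => (F p).map g.toLinearMap) (B.conjBy g) where
  invol := hB.invol
  mem_W k x := by
    have h1 : x ∈ W.cx k ↔ g⁻¹ x ∈ W.cx k :=
      ⟨(stabW W).inv_mem hg.1 k x, fun h => by
        have := hg.1 k _ h; rwa [GL_apply_inv_self] at this⟩
    rw [h1, hB.mem_W]
    refine forall₂_congr fun i _ => ?_
    rw [Bigrading.conjBy_proj_apply, LinearEquiv.map_eq_zero_iff]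
    rfl
  mem_F p x := by
    have h1 : x ∈ (F p).map g.toLinearMap ↔ g⁻¹ x ∈ F p := by
      constructor
      · rintro ⟨y, hy, rfl⟩
        change g⁻¹ (g y) ∈ _
        rwa [GL_inv_apply_self]
      · exact fun h => ⟨_, h, GL_apply_inv_self g x⟩
    rw [h1, hB.mem_F]
    refine forall₂_congr fun i _ => ?_
    rw [Bigrading.conjBy_proj_apply, LinearEquiv.map_eq_zero_iff]
    rfl
  real i j x hij hne := by
    rw [Bigrading.conjBy_proj_apply, Bigrading.conjBy_proj_apply, LinearEquiv.map_eq_zero_iff]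
    set y := B.proj i (g.symm x) with hy
    have hyW : y ∈ W.cx (i.1 + i.2) := hB.proj_mem_W le_rfl _
    have h1 := (stabW W).inv_mem hg.1 _ _ (hg.2 _ y hyW)
    rw [map_sub, GL_inv_apply_self] at h1
    have h2 := (hB.mem_W _ _).1 h1 j (by omega)
    rw [map_sub, hB.real i j _ hij hne, sub_zero] at h2
    exact h2

end RealOnGraded

/-! ### The axioms of a mixed Hodge datum. -/

section Datum

variable {V : Type*} [AddCommGroup V] [Module ℚ V] [Module.Finite ℚ V] {W : WeightFiltration V}
  {F : CxFiltration V} {B : Bigrading (Cx V)}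

attribute [local instance] endNormedRing endNormedAlgebra endCompleteSpace

theorem exp_units_mul_mul_inv {A : Type*} [NormedRing A] [NormedAlgebra ℂ A] [CompleteSpace A]
    (y : Aˣ) (X : A) : NormedSpace.exp ((y : A) * X * (y⁻¹ : Aˣ)) =
      y * NormedSpace.exp X * (y⁻¹ : Aˣ) :=
  letI : NormedAlgebra ℚ A := NormedAlgebra.restrictScalars ℚ ℂ A
  NormedSpace.exp_units_conj y X

theorem conj_mem_lieAlg {G : Subgroup (GLC V)} (hG : IsQClosed (G : Set (GLC V))) {g : GLC V}
    (hg : g ∈ G) {X : Module.End ℂ (Cx V)} (hX : X ∈ lieAlg G) : g.conj X ∈ lieAlg G := by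
  rw [mem_lieAlg_iff hG] at hX ⊢
  intro t
  have h1 : expGL (t • g.conj X) = g * expGL (t • X) * g⁻¹ := by
    apply LinearEquiv.toLinearMap_injective
    rw [toLinearMap_mul, toLinearMap_mul, coe_expGL, coe_expGL]
    let y : (Module.End ℂ (Cx V))ˣ := ⟨g.toLinearMap, g⁻¹.toLinearMap,
      by rw [← toLinearMap_mul, mul_inv_cancel]; rfl, by rw [← toLinearMap_mul, inv_mul_cancel]; rfl⟩
    have h2 : t • g.conj X = (y : Module.End ℂ (Cx V)) * (t • X) * (y⁻¹ : (Module.End ℂ (Cx V))ˣ) := by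
      rw [← map_smul]; rfl
    rw [h2, exp_units_mul_mul_inv]
    rfl
  rw [h1]
  exact G.mul_mem (G.mul_mem hg (hX t)) (G.inv_mem hg)

omit [Module.Finite ℚ V] in
theorem mul_pow_mem_endFil {k : ℤ} (hk : k ≤ 0) {X : Module.End ℂ (Cx V)} (hX : X ∈ endFil W.cx k)
    (n : ℕ) : X ^ (n + 1) ∈ endFil W.cx k := by
  induction n with
  | zero => simpa using hX
  | succ n ih =>
    rw [pow_succ]
    intro j x hx
    exact WeightFiltration.cx_mono (by omega) (ih _ _ (hX j x hx))

/-- X is a limit of quotients (exp(tX) - 1)/t, and conversely exp(tX) - 1 is a series in positive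
powers of X. So all exp(tX) - 1 lower weights if and only if X does. -/
theorem lieAlg_inf_grTriv {G : Subgroup (GLC V)} (hG : IsQClosed (G : Set (GLC V))) :
    lieAlg (G ⊓ grTriv W) = lieAlg G ⊓ endFil W.cx (-1) := by
  have hGU : IsQClosed ((G ⊓ grTriv W : Subgroup (GLC V)) : Set (GLC V)) :=
    hG.inter isQClosed_grTriv
  have hcl : IsClosed (endFil W.cx (-1) : Set (Module.End ℂ (Cx V))) :=
    Submodule.closed_of_finiteDimensional _
  ext X
  rw [mem_lieAlg_iff hGU, Submodule.mem_inf, mem_lieAlg_iff hG]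
  constructor
  · intro h
    refine ⟨fun t => (h t).1, ?_⟩
    have h1 := mem_of_exp_sub_one_mem (L := (endFil W.cx (-1)).restrictScalars ℝ) hcl (X := X)
    exact h1 fun t j x hx => (h t).2 j x hx
  · rintro ⟨h, h'⟩ t
    refine ⟨h t, fun k x hx => ?_⟩
    exact exp_sub_one_mem hcl (X := t • X)
      (mul_pow_mem_endFil (by omega) (Submodule.smul_mem _ _ h')) k x hx

theorem endo_proj_mem_lieAlg {G : Subgroup (GLC V)} (hG : IsQClosed (G : Set (GLC V)))
    (htor : ∀ z, B.torus z ∈ G) (i : ℤ × ℤ) {X : Module.End ℂ (Cx V)} (hX : X ∈ lieAlg G) :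
    B.endo.proj i X ∈ lieAlg G :=
  B.endo.proj_mem_of_scalar_mem chr_genericPoint_injective
    (fun Y hY => by rw [B.endo_scalar_apply]; exact conj_mem_lieAlg hG (htor _) hY) i hX

/-- The Lie algebra of G is stable under the adjoint action of the torus, hence graded, and the
grading of endomorphisms splits the filtration `endFil`. -/
theorem IsSplitting.lieWeight_torus (hB : IsSplitting (gal conjQ) W.cx F B)
    {G : Subgroup (GLC V)} (hG : IsQClosed (G : Set (GLC V))) (htor : ∀ z, B.torus z ∈ G) (k : ℤ) :
    lieWeight G B.torus k = lieAlg G ⊓ endFil W.cx k := by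
  have hfun : (fun z => (B.torus z).conj.toLinearMap) = fun z => B.endo.scalar (Bigrading.chr z) := by
    funext z
    ext1 X
    exact (B.endo_scalar_apply z X).symm
  rw [lieWeight, hfun]
  apply le_antisymm
  · refine iSup_le fun r => iSup_le fun s => iSup_le fun hr X hX => ⟨hX.1, ?_⟩
    rw [← (B.endo.mem_torusWeightSpace_iff (i := (r, s))).1 hX.2]
    exact hB.endo.proj_mem_W hr X
  · rintro X ⟨hX, hXW⟩
    rw [← B.endo.sum_proj X]
    refine Submodule.sum_mem _ fun i _ => ?_
    by_cases hi : i.1 + i.2 ≤ k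
    · exact Submodule.mem_iSup_of_mem i.1 (Submodule.mem_iSup_of_mem i.2
        (Submodule.mem_iSup_of_mem hi ⟨endo_proj_mem_lieAlg hG htor i hX,
          B.endo.mem_torusWeightSpace_iff.2 (B.endo.proj_self i X)⟩))
    · rw [(hB.endo.mem_W k X).1 hXW i (not_le.1 hi)]
      exact Submodule.zero_mem _

/-- Conjugation exchanges types (p,q) and (q,p) modulo lower weight, matching the real structure
(z₁, z₂) ↦ (conj z₂, conj z₁) of the torus. -/
theorem IsSplitting.galConj_torus_sub_mem (hB : IsSplitting (gal conjQ) W.cx F B)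
    (z : ℂˣ × ℂˣ) {k : ℤ} {x : Cx V} (hx : x ∈ W.cx k) :
    galConj conjQ (B.torus z) x - B.torus (Units.map (conjQ : ℂ →* ℂ) z.2,
      Units.map (conjQ : ℂ →* ℂ) z.1) x ∈ W.cx (k - 1) := by
  set z' : ℂˣ × ℂˣ := (Units.map (conjQ : ℂ →* ℂ) z.2, Units.map (conjQ : ℂ →* ℂ) z.1) with hz'
  have hst := hB.torus_mem_stabW z'
  obtain ⟨y, rfl⟩ : ∃ y, gal conjQ y = x := ⟨_, gal_conjQ_gal_conjQ x⟩
  have hy : y ∈ W.cx k := by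
    have := WeightFiltration.gal_mem_cx conjQ hx
    rwa [gal_conjQ_gal_conjQ] at this
  change gal conjQ (B.torus z (gal conjQ (gal conjQ y))) - _ ∈ _
  rw [gal_conjQ_gal_conjQ]
  have hsum : gal conjQ (B.torus z y) - B.torus z' (gal conjQ y) = ∑ i ∈ B.supp,
      (gal conjQ (B.torus z (B.proj i y)) - B.torus z' (gal conjQ (B.proj i y))) := by
    rw [Finset.sum_sub_distrib, ← map_sum, ← map_sum, ← map_sum, ← map_sum, B.sum_proj]
  rw [hsum]
  refine Submodule.sum_mem _ fun i _ => ?_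
  by_cases hi : k < i.1 + i.2
  · rw [(hB.mem_W k y).1 hy i hi]
    simp
  set u := B.proj i y with hu
  have hd : gal conjQ u - B.proj i.swap (gal conjQ u) ∈ W.cx (k - 1) :=
    hB.conj_proj_sub (by omega) y
  set d := gal conjQ u - B.proj i.swap (gal conjQ u) with hd'
  have h1 : gal conjQ (B.torus z u) = Bigrading.chr z' i.swap • gal conjQ u := by
    rw [Bigrading.torus_apply, hu, B.scalar_proj, gal_smul]
    congr 1
    simp only [Bigrading.chr, hz', Prod.fst_swap, Prod.snd_swap, Units.val_mul,
      Units.val_zpow_eq_zpow_val, Units.coe_map, map_mul, map_zpow₀]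
    rw [mul_comm]
    rfl
  have h2 : gal conjQ u = B.proj i.swap (gal conjQ u) + d := by rw [hd']; abel
  have h3 : gal conjQ (B.torus z u) - B.torus z' (gal conjQ u) =
      Bigrading.chr z' i.swap • d - B.torus z' d := by
    rw [h1]
    conv_lhs => rw [h2]
    rw [map_add, smul_add, Bigrading.torus_apply, B.scalar_proj, add_sub_add_left_eq_sub]
  rw [h3]
  exact sub_mem (Submodule.smul_mem _ _ hd) (hst _ _ hd)

theorem IsSplitting.torus_diag_sub_mem (hB : IsSplitting (gal conjQ) W.cx F B)
    (t : ℂˣ) {k : ℤ} {x : Cx V} (hx : x ∈ W.cx k) :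
    B.torus (t, t) x - ((t ^ k : ℂˣ) : ℂ) • x ∈ W.cx (k - 1) := by
  refine hB.mem_W_pred (sub_mem (hB.torus_mem_stabW _ k x hx) (Submodule.smul_mem _ _ hx))
    fun i hi => ?_
  rw [map_sub, Bigrading.torus_apply, Bigrading.proj_scalar, map_smul, Bigrading.chr, ← zpow_add,
    hi, sub_self]
  exact Submodule.zero_mem _

theorem exists_mem_isGaloisConj {G U : Subgroup (GLC V)} (hG : IsQClosed (G : Set (GLC V)))
    (hU : U = G ⊓ grTriv W) (hst : G ≤ stabW W) (σ : ℂ ≃ₐ[ℚ] ℂ) {a b : GLC V} (ha : a ∈ G)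
    (hb : b ∈ G) (h : ∀ k, ∀ x ∈ W.cx k, galConj σ a x - b x ∈ W.cx (k - 1)) :
    ∃ u ∈ U, IsGaloisConj σ a (b * u) := by
  refine ⟨b⁻¹ * galConj σ a, ?_, by rw [isGaloisConj_iff, mul_inv_cancel_left]⟩
  rw [hU]
  refine ⟨G.mul_mem (G.inv_mem hb) (hG.galStable _ _ ha), fun k x hx => ?_⟩
  have := hst (G.inv_mem hb) _ _ (h k x hx)
  rw [map_sub, GL_inv_apply_self] at this
  exact this

/-- As U consists of the elements of G trivial on the graded pieces, the rationality axioms may be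
checked there: the torus is real, and the diagonal acts on Gr_k by the scalar t^k. The Lie algebra
axiom compares two descriptions of the endomorphisms in Lie G that lower weights. -/
theorem isMixedHodgeDatum_of_isSplitting {G : Subgroup (GLC V)} {X : Set (TorusHom V)}
    (hG : IsConnectedQGroup G) (hU : unipotentRadical G = G ⊓ grTriv W) (hst : G ≤ stabW W)
    (hX : ∃ χ, X = conjClass G χ)
    (hsplit : ∀ χ ∈ X, (∀ z, χ z ∈ G) ∧ ∃ (F : CxFiltration V) (B : Bigrading (Cx V)),
      IsSplitting (gal conjQ) W.cx F B ∧ χ = B.torus) : IsMixedHodgeDatum G X where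
  group := hG
  isConjClass := hX
  algebraic χ hχ := by
    obtain ⟨-, F, B, -, rfl⟩ := hsplit χ hχ
    exact B.isAlgebraicTorusHom_torus
  mem_group χ hχ := (hsplit χ hχ).1
  real χ hχ z := by
    obtain ⟨hmem, F, B, hB, rfl⟩ := hsplit χ hχ
    exact exists_mem_isGaloisConj hG.closed hU hst conjQ (hmem _) (hmem _)
      fun k x hx => hB.galConj_torus_sub_mem z hx
  weight_rational χ hχ σ t := by
    obtain ⟨hmem, F, B, hB, rfl⟩ := hsplit χ hχ
    refine exists_mem_isGaloisConj hG.closed hU hst σ (hmem _) (hmem _) fun k x hx => ?_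
    have hx' := WeightFiltration.gal_mem_cx σ.symm hx
    have h1 := WeightFiltration.gal_mem_cx σ (hB.torus_diag_sub_mem t hx')
    have h2 := hB.torus_diag_sub_mem (Units.map (σ : ℂ →* ℂ) t) hx
    have h3 := sub_mem h1 h2
    rw [map_sub, gal_smul, gal_gal_symm, ← map_zpow] at h3
    change _ - σ ((t ^ k : ℂˣ) : ℂ) • x - (_ - σ ((t ^ k : ℂˣ) : ℂ) • x) ∈ _ at h3
    rw [sub_sub_sub_cancel_right] at h3
    exact h3
  lie_weight χ hχ := by
    obtain ⟨hmem, F, B, hB, rfl⟩ := hsplit χ hχ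
    rw [hB.lieWeight_torus hG.closed hmem, hU, lieAlg_inf_grTriv hG.closed]

end Datum

/-! ### Stability of the Lie algebra under complex conjugation. -/

section ConjugateLieAlgebra

variable {V : Type*} [AddCommGroup V] [Module ℚ V] [Module.Finite ℚ V]

theorem entries_conjEnd (X : Module.End ℂ (Cx V)) (ij) :
    entries (conjEnd (gal conjQ) X) ij = conjQ (entries X ij) := by
  rw [entries, entries, LinearMap.toMatrix_apply, LinearMap.toMatrix_apply]
  change (cxBasis V).repr (gal conjQ (X (gal conjQ (cxBasis V ij.2)))) ij.1 =
    conjQ ((cxBasis V).repr (X (cxBasis V ij.2)) ij.1)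
  rw [gal_cxBasis]
  set y := X (cxBasis V ij.2)
  conv_lhs => rw [← (cxBasis V).sum_repr y, map_sum]
  simp only [gal_smul, gal_cxBasis]
  simp [Finsupp.single_apply]

/-- The tangent equations have rational coefficients at the identity, so conjugating a solution
gives a solution. -/
theorem conjEnd_mem_lieAlg {G : Subgroup (GLC V)} {X : Module.End ℂ (Cx V)} (hX : X ∈ lieAlg G) :
    conjEnd (gal conjQ) X ∈ lieAlg G := by
  intro P hP
  have hone : conjEnd (gal conjQ) (1 : Module.End ℂ (Cx V)) = 1 :=
    LinearMap.ext fun x => gal_conjQ_gal_conjQ x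
  have h1 : ∀ R : MatPoly V, MvPolynomial.aeval (entries (1 : Module.End ℂ (Cx V))) R =
      conjQ (MvPolynomial.aeval (entries (1 : Module.End ℂ (Cx V))) R) := fun R => by
    have : entries (1 : Module.End ℂ (Cx V)) =
        fun ij => conjQ.toAlgHom (entries (1 : Module.End ℂ (Cx V)) ij) := by
      funext ij
      conv_lhs => rw [← hone]
      exact entries_conjEnd 1 ij
    conv_lhs => rw [this]
    rw [← MvPolynomial.comp_aeval_apply]
    rfl
  have h2 := congrArg conjQ (hX P hP)
  rw [map_sum, map_zero] at h2
  rw [← h2]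
  refine Finset.sum_congr rfl fun ij _ => ?_
  rw [map_mul, ← h1, entries_conjEnd]

end ConjugateLieAlgebra

/-! ### Comparison of an arbitrary splitting with the Deligne splitting. -/

section DeligneTorusOfSplitting

variable {V : Type*} [AddCommGroup V] [Module ℚ V] [Module.Finite ℚ V] {W : WeightFiltration V}
  {F : CxFiltration V} {B : Bigrading (Cx V)}

-- Two splittings induce the same Hodge decomposition on each graded piece, so the scalar operators
-- of `B` and `B'` differ there only by terms of lower weight.
omit [Module.Finite ℚ V] in
theorem IsSplitting.proj_scalar_proj (hB : IsSplitting (gal conjQ) W.cx F B)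
    {B' : Bigrading (Cx V)} (hB' : IsSplitting (gal conjQ) W.cx F B') (f : ℤ × ℤ → ℂ)
    (a : ℤ × ℤ) (x : Cx V) : B.proj a (B'.scalar f (B.proj a x)) = f a • B.proj a x := by
  have hx : B.proj a x ∈ W.cx (a.1 + a.2) := hB.proj_mem_W le_rfl x
  have hdiff : B'.scalar f (B.proj a x) - f a • B.proj a x ∈ W.cx (a.1 + a.2 - 1) := by
    refine hB'.mem_W_pred (sub_mem ?_ (Submodule.smul_mem _ _ hx)) fun i hi => ?_
    · refine (hB'.mem_W _ _).2 fun i hi => ?_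
      rw [Bigrading.proj_scalar, (hB'.mem_W _ _).1 hx i hi, smul_zero]
    · rw [map_sub, map_smul, Bigrading.proj_scalar, ← sub_smul]
      by_cases hia : i = a
      · rw [hia, sub_self, zero_smul]
        exact Submodule.zero_mem _
      · refine Submodule.smul_mem _ _ ?_
        have := hB.proj_sub_proj_mem hB' hi.ge hx
        rw [B.proj_ne hia, zero_sub] at this
        exact (Submodule.neg_mem_iff _).1 this
  have h0 := (hB.mem_W _ _).1 hdiff a (by omega)
  rwa [map_sub, map_smul, B.proj_self, sub_eq_zero] at h0

theorem delI_le_of_inf {E : Type*} [AddCommGroup E] [Module ℂ E] {σ : ℂ →+* ℂ} {c : E →ₛₗ[σ] E}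
    {W F : ℤ → Submodule ℂ E} {L : Submodule ℂ E} (p q : ℤ) :
    delI c (fun k => W k ⊓ L) F p q ≤ delI c W F p q ⊓ L := by
  refine le_inf (inf_le_inf (inf_le_inf_left _ inf_le_left) (sup_le_sup
    (inf_le_inf_left _ inf_le_left) (iSup_mono fun j => inf_le_inf_left _ inf_le_left))) ?_
  exact inf_le_left.trans (inf_le_right.trans inf_le_right)

theorem IsMixedHodge.endo_proj_of_mem_delI (h : IsMixedHodge W F) {i : ℤ × ℤ}
    {Z : Module.End ℂ (Cx V)}
    (hZ : Z ∈ delI (conjEnd (gal conjQ)) (endFil W.cx) (endFil F) i.1 i.2) :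
    h.bigrading.endo.proj i Z = Z :=
  (h.bigrading.endo_proj_eq_self_iff).2 fun a x => h.proj_of_mem_deligneI (i := a + i)
    (apply_mem_delI gal_conjQ_gal_conjQ WeightFiltration.cx_mono hZ (h.proj_mem_deligneI a x))

/-- If some splitting of a mixed Hodge structure takes values in a closed `ℚ`-group, then so does
the Deligne torus. -/
theorem IsSplitting.bigrading_torus_mem (hB : IsSplitting (gal conjQ) W.cx F B)
    {G : Subgroup (GLC V)} (hG : IsQClosed (G : Set (GLC V))) (htor : ∀ z, B.torus z ∈ G)
    (h : IsMixedHodge W F) (z : ℂˣ × ℂˣ) : h.bigrading.torus z ∈ G := by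
  obtain ⟨a, ha⟩ := exists_exp_eq z.1
  obtain ⟨b, hb⟩ := exists_exp_eq z.2
  rw [← expGL_scalar_linChr h.bigrading z ha hb]
  apply expGL_mem hG
  set D := h.bigrading with hD
  set Y := B.scalar (linChr a b) with hY
  have hYL : Y ∈ lieAlg G := (mem_lieAlg_iff hG).2 fun t => by
    obtain ⟨w, hw⟩ := expGL_smul_scalar_linChr B t a b
    rw [hw]
    exact htor w
  -- Lie G is stable under the projections of `B.endo` and under conjugation, so it carries opposed
  -- filtrations. Its own Deligne splitting decomposes Y inside Lie G, compatibly with the Deligne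
  -- splitting of all endomorphisms.
  have hopp := hB.endo.opposed_inf (L := lieAlg G)
    (fun i X hX => endo_proj_mem_lieAlg hG htor i hX) fun X hX => conjEnd_mem_lieAlg hX
  have hYF : Y ∈ endFil F 0 ⊓ (endFil W.cx 0 ⊓ lieAlg G) := by
    refine ⟨fun j x hx => ?_, fun j x hx => ?_, hYL⟩
    · rw [add_zero]
      refine (hB.mem_F _ _).2 fun i hi => ?_
      rw [Bigrading.proj_scalar, (hB.mem_F _ _).1 hx i hi, smul_zero]
    · rw [add_zero]
      refine (hB.mem_W _ _).2 fun i hi => ?_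
      rw [Bigrading.proj_scalar, (hB.mem_W _ _).1 hx i hi, smul_zero]
  have hmem := hopp.inf_le_iSup_delI 0 0 hYF
  have hle : (⨆ r : ℤ, ⨆ s : ℤ, ⨆ _ : 0 ≤ r ∧ r + s ≤ 0,
      delI (conjEnd (gal conjQ)) (fun k => endFil W.cx k ⊓ lieAlg G) (endFil F) r s) ≤
      (lieAlg G).comap (D.endo.proj (0, 0)) := by
    refine iSup_le fun r => iSup_le fun s => iSup_le fun _ Z hZ => ?_
    obtain ⟨hZI, hZL⟩ := delI_le_of_inf r s hZ
    have hZp : D.endo.proj (r, s) Z = Z := h.endo_proj_of_mem_delI hZI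
    change D.endo.proj (0, 0) Z ∈ lieAlg G
    rw [← hZp, D.endo.proj_proj]
    split_ifs
    · rw [hZp]; exact hZL
    · exact Submodule.zero_mem _
  -- On a graded piece Y acts by the same scalars as the generator of the Deligne torus; the
  -- component of type (0,0) with respect to the Deligne splitting is therefore exactly that
  -- generator.
  have hYD : D.endo.proj (0, 0) Y = D.scalar (linChr a b) := by
    refine D.linearMap_ext fun i x => ?_
    rw [Bigrading.endo_proj_apply_proj, Bigrading.scalar_proj, Prod.mk_zero_zero, add_zero]
    exact h.isSplitting.proj_scalar_proj hB _ i x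
  rw [← hYD]
  exact hle hmem

theorem IsSplitting.mumfordTate_le (hB : IsSplitting (gal conjQ) W.cx F B)
    {G : Subgroup (GLC V)} (hG : IsQClosed (G : Set (GLC V))) (htor : ∀ z, B.torus z ∈ G) :
    mumfordTate W F ≤ G :=
  MixedHodge.mumfordTate_le hG fun z => by
    rw [hB.isMixedHodge.deligneTorus_eq]
    exact hB.bigrading_torus_mem hG htor _ z

end DeligneTorusOfSplitting

/-! ### Orbits of structures under automorphisms real on the graded pieces. -/

section Orbits

variable {V : Type*} [AddCommGroup V] [Module ℚ V] [Module.Finite ℚ V] {W : WeightFiltration V}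
  {Q : GradedForms W} {F : CxFiltration V} {B : Bigrading (Cx V)}

/-- The translate of a filtration. -/
def translate (g : GLC V) (F : CxFiltration V) : CxFiltration V :=
  fun p => (F p).map g.toLinearMap

omit [Module.Finite ℚ V] in
theorem translate_mul (g g' : GLC V) (F : CxFiltration V) :
    translate (g * g') F = translate g (translate g' F) := by
  funext p
  exact Submodule.map_comp g'.toLinearMap g.toLinearMap (F p)

omit [Module.Finite ℚ V] in
theorem translate_one (F : CxFiltration V) : translate 1 F = F := by
  funext p
  exact Submodule.map_id (F p)

omit [Module.Finite ℚ V] in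
theorem Bigrading.finrank_range_conjBy_proj (B : Bigrading (Cx V)) (g : GLC V) (i : ℤ × ℤ) :
    Module.finrank ℂ (LinearMap.range ((B.conjBy g).proj i)) =
      Module.finrank ℂ (LinearMap.range (B.proj i)) := by
  have : LinearMap.range ((B.conjBy g).proj i) =
      (LinearMap.range (B.proj i)).map g.toLinearMap := by
    ext x
    constructor
    · rintro ⟨y, rfl⟩
      exact ⟨_, ⟨g.symm y, rfl⟩, rfl⟩
    · rintro ⟨_, ⟨y, rfl⟩, rfl⟩
      exact ⟨g y, by rw [conjBy_proj_apply, LinearEquiv.symm_apply_apply]; rfl⟩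
  rw [this]
  exact LinearEquiv.finrank_map_eq g _

variable (Q) in
/-- The automorphisms which preserve the weight filtration, are real on the graded
pieces, and multiply the graded forms by positive factors. -/
def posSim : Subgroup (GLC V) where
  carrier := {g | g ∈ realGr W ∧ ∀ k, ∃ μ : ℝ, 0 < μ ∧ ∀ x ∈ W.cx k, ∀ y ∈ W.cx k,
    grForm Q k (g x) (g y) = μ * grForm Q k x y}
  mul_mem' := by
    rintro a b ⟨ha, ha'⟩ ⟨hb, hb'⟩
    refine ⟨(realGr W).mul_mem ha hb, fun k => ?_⟩
    obtain ⟨c, hc, h⟩ := ha' k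
    obtain ⟨d, hd, h'⟩ := hb' k
    refine ⟨c * d, mul_pos hc hd, fun x hx y hy => ?_⟩
    rw [LinearEquiv.mul_apply, LinearEquiv.mul_apply, h _ (hb.1 k x hx) _ (hb.1 k y hy),
      h' x hx y hy, Complex.ofReal_mul, mul_assoc]
  one_mem' := ⟨(realGr W).one_mem, fun k => ⟨1, one_pos, fun x _ y _ => by
    rw [Complex.ofReal_one, one_mul]; rfl⟩⟩
  inv_mem' := by
    rintro a ⟨ha, ha'⟩
    refine ⟨(realGr W).inv_mem ha, fun k => ?_⟩
    obtain ⟨c, hc, h⟩ := ha' k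
    refine ⟨c⁻¹, inv_pos.2 hc, fun x hx y hy => ?_⟩
    have h1 := h _ ((stabW W).inv_mem ha.1 k x hx) _ ((stabW W).inv_mem ha.1 k y hy)
    rw [GL_apply_inv_self, GL_apply_inv_self] at h1
    rw [h1, Complex.ofReal_inv, inv_mul_cancel_left₀ (by exact_mod_cast hc.ne')]

/-- A mixed Hodge structure polarized on the graded pieces stays polarized under `posSim`. -/
theorem IsSplitting.isPolarizedBy_translate (hB : IsSplitting (gal conjQ) W.cx F B) {k : ℤ}
    (hpol : IsPolarizedBy k (inducedFiltration W F k) (Q.form k)) {g : GLC V}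
    (hg : g ∈ posSim Q) : IsPolarizedBy k (inducedFiltration W (translate g F) k) (Q.form k) := by
  have hB' : IsSplitting (gal conjQ) W.cx (translate g F) (B.conjBy g) := hB.conjBy hg.1
  obtain ⟨μ, hμ, hgμ⟩ := hg.2 k
  have hex : ∀ p, ∀ u ∈ hodgePiece (inducedFiltration W (translate g F) k) p (k - p),
      ∃ x ∈ W.cx k, W.grC k x ∈ hodgePiece (inducedFiltration W F k) p (k - p) ∧
        u = W.grC k (g x) := fun p u hu => by
    obtain ⟨x, rfl⟩ := hB'.exists_proj_of_mem_hodgePiece (by ring) hu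
    exact ⟨B.proj (p, k - p) (g.symm x), hB.proj_mem_W (i := (p, k - p)) (by simp) _,
      hB.grC_proj_mem_hodgePiece (by ring) _, rfl⟩
  have hform : ∀ x ∈ W.cx k, ∀ y ∈ W.cx k,
      (Q.form k).baseChange ℂ (W.grC k (g x)) (gal conjQ (W.grC k (g y))) =
        μ * (Q.form k).baseChange ℂ (W.grC k x) (gal conjQ (W.grC k y)) := fun x hx y hy => by
    rw [WeightFiltration.gal_grC, WeightFiltration.gal_grC, ← grForm_apply, ← grForm_apply,
      ← hgμ x hx _ (WeightFiltration.gal_mem_cx conjQ hy), ← sub_eq_zero, ← map_sub]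
    exact grForm_eq_zero_right (hg.1.2 k y hy) _
  constructor
  · intro p p' hpp u hu v hv
    obtain ⟨x, hx, hxp, rfl⟩ := hex p u hu
    obtain ⟨y, hy, hyp, rfl⟩ := hex p' v hv
    rw [hform x hx y hy, hpol.orthogonal p p' hpp _ hxp _ hyp, mul_zero]
  · intro p u hu hne
    obtain ⟨x, hx, hxp, rfl⟩ := hex p u hu
    obtain ⟨r, hr, hr'⟩ := hpol.positive p _ hxp fun h0 => hne <| by
      rw [WeightFiltration.grC_eq_zero_iff hx] at h0
      rw [WeightFiltration.grC_eq_zero_iff (hg.1.1 k x hx)]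
      exact hg.1.1 _ x h0
    refine ⟨μ * r, mul_pos hμ hr, ?_⟩
    rw [hform x hx x hx, mul_left_comm, hr', Complex.ofReal_mul]

variable (W) in
/-- The mixed Hodge structures with given Hodge numbers and with Mumford-Tate
group inside `𝐆`. -/
def structuresIn (G : Subgroup (GLC V)) (h : ℤ → ℤ → ℕ) : Set (CxFiltration V) :=
  {F | IsMixedHodge W F ∧
    (∀ p q, Module.finrank ℂ (hodgePiece (inducedFiltration W F (p + q)) p q) = h p q) ∧
    mumfordTate W F ≤ G}

theorem IsMixedHodge.torus_mem_of_mumfordTate_le (h : IsMixedHodge W F) {G : Subgroup (GLC V)}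
    (hG : mumfordTate W F ≤ G) (z : ℂˣ × ℂˣ) : h.bigrading.torus z ∈ G := by
  rw [← h.deligneTorus_eq]
  exact hG (deligneTorus_mem_mumfordTate z)

/-- The translated bigrading splits the translated structure and its torus lies in G. It need not be
the Deligne splitting, which is why the bound on the Mumford-Tate group goes through
`IsSplitting.mumfordTate_le`. -/
theorem translate_mem_structuresIn {G : Subgroup (GLC V)} (hG : IsQClosed (G : Set (GLC V)))
    {h : ℤ → ℤ → ℕ} (hF : F ∈ structuresIn W G h) {g : GLC V} (hg : g ∈ G ⊓ realGr W) :
    translate g F ∈ structuresIn W G h := by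
  obtain ⟨hM, hdim, hMT⟩ := hF
  have hB' : IsSplitting (gal conjQ) W.cx (translate g F) (hM.bigrading.conjBy g) :=
    hM.isSplitting.conjBy hg.2
  refine ⟨hB'.isMixedHodge, fun p q => ?_, hB'.mumfordTate_le hG fun z => ?_⟩
  · rw [hB'.finrank_hodgePiece, Bigrading.finrank_range_conjBy_proj,
      ← hM.isSplitting.finrank_hodgePiece, hdim]
  · rw [Bigrading.conjBy_torus]
    exact G.mul_mem (G.mul_mem hg.1 (hM.torus_mem_of_mumfordTate_le hMT z)) (G.inv_mem hg.1)

theorem translate_mem_periodDomain {h : ℤ → ℤ → ℕ} (hF : F ∈ periodDomain W Q h) {g : GLC V}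
    (hg : g ∈ posSim Q) : translate g F ∈ periodDomain W Q h := by
  obtain ⟨hM, hpol, hdim⟩ := hF
  obtain ⟨h1, h2, -⟩ := translate_mem_structuresIn (G := ⊤) (F := F) (h := h)
    ⟨∅, by ext; simp⟩ ⟨hM, hdim, le_top⟩ ⟨Subgroup.mem_top _, hg.1⟩
  exact ⟨h1, fun k => hM.isSplitting.isPolarizedBy_translate (hpol k) hg, h2⟩

theorem mem_hodgeDomain_iff (hM : IsMixedHodge W F) {G : Subgroup (GLC V)}
    (hG : IsQClosed (G : Set (GLC V))) (hst : G ≤ stabW W)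
    (hU : unipotentRadical G = G ⊓ grTriv W) {F' : CxFiltration V} :
    F' ∈ hodgeDomain (conjClass G (deligneTorus W F)) ↔
      ∃ g ∈ G ⊓ realGr W, F' = translate g F := by
  have hχ : ∀ (χ : TorusHom V) (g : GLC V), g ∈ realGr W →
      (∀ z, χ z = g * deligneTorus W F z * g⁻¹) → hodgeFiltrationOf χ = translate g F := by
    intro χ g hg h
    have : χ = (hM.bigrading.conjBy g).torus := MonoidHom.ext fun z => by
      rw [h, Bigrading.conjBy_torus, hM.deligneTorus_eq]
    rw [this]
    exact (hM.isSplitting.conjBy hg).hodgeFiltrationOf_torus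
  constructor
  · rintro ⟨χ, hχX, rfl⟩
    obtain ⟨g, hg, h⟩ := (mem_conjClass_iff hG hst hU).1 hχX
    exact ⟨g, hg, hχ χ g hg.2 h⟩
  · rintro ⟨g, hg, rfl⟩
    refine ⟨(hM.bigrading.conjBy g).torus, (mem_conjClass_iff hG hst hU).2 ⟨g, hg, fun z => ?_⟩,
      hχ _ g hg.2 fun z => ?_⟩
    all_goals rw [Bigrading.conjBy_torus, hM.deligneTorus_eq]

end Orbits

/-! ### Semicontinuity of sums, intersections and conjugates of varying subspaces. -/

section LowerSemicontinuity

open Filter Topology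

theorem continuous_of_map_real_smul {A : Type*} [NormedAddCommGroup A] [NormedSpace ℂ A]
    [FiniteDimensional ℂ A] (f : A →+ A) (hf : ∀ (t : ℝ) x, f ((t : ℂ) • x) = (t : ℂ) • f x) :
    Continuous f := by
  let g : A →ₗ[ℝ] A :=
    { toFun := f
      map_add' := map_add f
      map_smul' := fun t x => by
        rw [RingHom.id_apply, ← Complex.coe_smul, hf, Complex.coe_smul] }
  have : FiniteDimensional ℝ A := FiniteDimensional.complexToReal A
  exact g.continuous_of_finiteDimensional

variable {V : Type*} [AddCommGroup V] [Module ℚ V] [Module.Finite ℚ V]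

attribute [local instance] endNormedRing endNormedAlgebra endCompleteSpace

/-- The subspaces `A i` contain in the limit the subspace `A₀`. -/
def LimContains {ι : Type*} (l : Filter ι) (A : ι → Submodule ℂ (Cx V))
    (A₀ : Submodule ℂ (Cx V)) : Prop :=
  ∃ T : ι → Module.End ℂ (Cx V), Tendsto T l (𝓝 1) ∧ ∀ᶠ i in l, ∀ x ∈ A₀, T i x ∈ A i

namespace LimContains

variable {ι : Type*} {l : Filter ι} {A B : ι → Submodule ℂ (Cx V)} {A₀ B₀ : Submodule ℂ (Cx V)}

theorem const (A₀ : Submodule ℂ (Cx V)) : LimContains l (fun _ => A₀) A₀ :=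
  ⟨fun _ => 1, tendsto_const_nhds, Eventually.of_forall fun _ _ hx => hx⟩

theorem bot : LimContains l A ⊥ :=
  ⟨fun _ => 1, tendsto_const_nhds, Eventually.of_forall fun i x hx => by
    rw [(Submodule.mem_bot ℂ).1 hx, map_zero]; exact Submodule.zero_mem _⟩

theorem mono (h : LimContains l A A₀) (hA : ∀ i, A i ≤ B i) (hB : B₀ ≤ A₀) :
    LimContains l B B₀ := by
  obtain ⟨T, hT, h⟩ := h
  exact ⟨T, hT, h.mono fun i hi x hx => hA i (hi x (hB hx))⟩

-- P is the projection to A₀ along a complement that contains a complement of A₀ ∩ B₀ in B₀. It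
-- splits A₀ + B₀ into an A₀-part and a B₀-part linearly, so maps defined on the two spaces can be
-- glued.
omit [Module.Finite ℚ V] in
theorem exists_projection (A₀ B₀ : Submodule ℂ (Cx V)) : ∃ P : Module.End ℂ (Cx V),
    (∀ x, P x ∈ A₀) ∧ ∀ x ∈ A₀ ⊔ B₀, x - P x ∈ B₀ := by
  obtain ⟨D, hD⟩ := (A₀.comap B₀.subtype).exists_isCompl
  obtain ⟨K, hK⟩ := (A₀ ⊔ B₀).exists_isCompl
  have hc : IsCompl A₀ (D.map B₀.subtype ⊔ K) := by
    have hsup : A₀ ⊔ D.map B₀.subtype = A₀ ⊔ B₀ := by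
      apply le_antisymm
      · exact sup_le_sup_left (Submodule.map_subtype_le B₀ D) _
      · refine sup_le le_sup_left fun x hx => ?_
        have : (⟨x, hx⟩ : B₀) ∈ A₀.comap B₀.subtype ⊔ D := by
          rw [hD.sup_eq_top]; exact Submodule.mem_top
        obtain ⟨y, hy, z, hz, hyz⟩ := Submodule.mem_sup.1 this
        refine Submodule.mem_sup.2 ⟨y, hy, z, Submodule.mem_map_of_mem hz, ?_⟩
        exact congrArg Subtype.val hyz
    refine ⟨?_, codisjoint_iff.2 (by rw [← sup_assoc, hsup, hK.sup_eq_top])⟩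
    rw [Submodule.disjoint_def]
    intro x hx hx'
    obtain ⟨y, hy, z, hz, rfl⟩ := Submodule.mem_sup.1 hx'
    have hyB : y ∈ B₀ := Submodule.map_subtype_le B₀ D hy
    have hz0 : z = 0 := by
      refine Submodule.disjoint_def.1 hK.disjoint z ?_ hz
      have := sub_mem (Submodule.mem_sup_left hx) (Submodule.mem_sup_right (S := A₀) hyB)
      rwa [add_sub_cancel_left] at this
    rw [hz0, add_zero] at hx ⊢
    obtain ⟨w, hw, rfl⟩ := hy
    rw [Submodule.disjoint_def.1 hD.disjoint w hx hw, map_zero]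
  refine ⟨A₀.subtype ∘ₗ Submodule.projectionOnto A₀ _ hc, fun x => Subtype.prop _, ?_⟩
  intro x hx
  obtain ⟨a, ha, b, hb, rfl⟩ := Submodule.mem_sup.1 hx
  have hB : ∀ b ∈ B₀, b - A₀.subtype (Submodule.projectionOnto A₀ _ hc b) ∈ B₀ := by
    intro b hb
    have : (⟨b, hb⟩ : B₀) ∈ A₀.comap B₀.subtype ⊔ D := by
      rw [hD.sup_eq_top]; exact Submodule.mem_top
    obtain ⟨y, hy, z, hz, hyz⟩ := Submodule.mem_sup.1 this
    have hyz' : (y : Cx V) + z = b := congrArg Subtype.val hyz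
    have h1 : Submodule.projectionOnto A₀ _ hc (y : Cx V) = ⟨y, hy⟩ :=
      Submodule.projectionOnto_apply_left hc ⟨y, hy⟩
    have h2 : Submodule.projectionOnto A₀ _ hc (z : Cx V) = 0 :=
      (Submodule.projectionOnto_apply_eq_zero_iff hc).2
        (Submodule.mem_sup_left (Submodule.mem_map_of_mem hz))
    rw [← hyz', map_add, h1, h2, add_zero]
    change (y : Cx V) + z - y ∈ _
    rw [add_sub_cancel_left]
    exact z.2
  have h1 : Submodule.projectionOnto A₀ _ hc a = ⟨a, ha⟩ :=
    Submodule.projectionOnto_apply_left hc ⟨a, ha⟩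
  rw [LinearMap.comp_apply, map_add, h1, map_add]
  change a + b - (a + _) ∈ _
  rw [add_sub_add_left_eq_sub]
  exact hB b hb

theorem tendsto_combine {T T' : ι → Module.End ℂ (Cx V)} (P : Module.End ℂ (Cx V))
    (hT : Tendsto T l (𝓝 1)) (hT' : Tendsto T' l (𝓝 1)) :
    Tendsto (fun i => T i * P + T' i * (1 - P)) l (𝓝 1) := by
  have h1 := (hT.mul_const P).add (hT'.mul_const (1 - P))
  rwa [one_mul, one_mul, add_sub_cancel] at h1

theorem sup (hA : LimContains l A A₀) (hB : LimContains l B B₀) :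
    LimContains l (fun i => A i ⊔ B i) (A₀ ⊔ B₀) := by
  obtain ⟨T, hT, hTA⟩ := hA
  obtain ⟨T', hT', hTB⟩ := hB
  obtain ⟨P, hP, hP'⟩ := exists_projection A₀ B₀
  refine ⟨_, tendsto_combine P hT hT', ?_⟩
  filter_upwards [hTA, hTB] with i hi hi' x hx
  exact Submodule.add_mem_sup (hi _ (hP x)) (hi' _ (hP' x hx))

theorem finset_iSup {κ : Type*} {A : κ → ι → Submodule ℂ (Cx V)} {A₀ : κ → Submodule ℂ (Cx V)}
    (h : ∀ j, LimContains l (A j) (A₀ j)) (s : Finset κ) :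
    LimContains l (fun i => ⨆ j ∈ s, A j i) (⨆ j ∈ s, A₀ j) := by
  classical
  induction s using Finset.induction_on with
  | empty => simpa using bot
  | insert j s _ ih =>
    simp only [Finset.iSup_insert]
    exact (h j).sup ih

theorem iSup {κ : Type*} {A : κ → ι → Submodule ℂ (Cx V)} {A₀ : κ → Submodule ℂ (Cx V)}
    (h : ∀ j, LimContains l (A j) (A₀ j)) :
    LimContains l (fun i => ⨆ j, A j i) (⨆ j, A₀ j) := by
  have hc := (Submodule.fg_iff_compact (⨆ j, A₀ j)).1 (IsNoetherian.noetherian _)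
  obtain ⟨s, hs⟩ := CompleteLattice.IsCompactElement.exists_finset_of_le_iSup _ hc A₀ le_rfl
  exact (finset_iSup h s).mono (fun i => iSup₂_le fun j _ => le_iSup (fun j => A j i) j) hs

/-- Intersections can shrink suddenly only if sums grow. The dimension bound gives A_i + B_i =
S_i(A₀ + B₀) for maps S_i tending to 1, and the small discrepancy between the images of x under T
and T' can then be corrected. -/
theorem inf (hA : LimContains l A A₀) (hB : LimContains l B B₀)
    (hdim : ∀ᶠ i in l, Module.finrank ℂ (A i ⊔ B i : Submodule ℂ (Cx V)) ≤
      Module.finrank ℂ (A₀ ⊔ B₀ : Submodule ℂ (Cx V))) :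
    LimContains l (fun i => A i ⊓ B i) (A₀ ⊓ B₀) := by
  obtain ⟨T, hT, hTA⟩ := hA
  obtain ⟨T', hT', hTB⟩ := hB
  obtain ⟨P, hP, hP'⟩ := exists_projection A₀ B₀
  have hS := tendsto_combine P hT hT'
  set S : ι → Module.End ℂ (Cx V) := fun i => T i * P + T' i * (1 - P) with hSdef
  have hinv : Tendsto (fun i => Ring.inverse (S i)) l (𝓝 1) := by
    have h1 := (NormedRing.inverse_continuousAt (1 : (Module.End ℂ (Cx V))ˣ)).tendsto
    rw [Units.val_one, Ring.inverse_one] at h1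
    exact h1.comp hS
  have hunit : ∀ᶠ i in l, IsUnit (S i) :=
    hS (Units.isOpen.mem_nhds (by exact isUnit_one))
  -- With w = S⁻¹(Tx - T'x) in A₀ + B₀ one has Tx - T'x = TPw + T'(w - Pw). Hence Tx - TPw = T'x +
  -- T'(w - Pw) lies in both A_i and B_i.
  refine ⟨fun i => T i - T i * P * (Ring.inverse (S i)) * (T i - T' i), ?_, ?_⟩
  · have h1 := hT.sub (((hT.mul_const P).mul hinv).mul (hT.sub hT'))
    rwa [sub_self, mul_zero, sub_zero] at h1
  · filter_upwards [hTA, hTB, hunit, hdim] with i hi hi' hu hd x hx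
    have hle : (A₀ ⊔ B₀).map (S i) ≤ A i ⊔ B i := by
      rintro _ ⟨w, hw, rfl⟩
      exact Submodule.add_mem_sup (hi _ (hP w)) (hi' _ (hP' w hw))
    have hinj : Function.Injective (S i) := ((Module.End.isUnit_iff _).1 hu).injective
    have heq : (A₀ ⊔ B₀).map (S i) = A i ⊔ B i := by
      refine Submodule.eq_of_le_of_finrank_le hle (hd.trans (le_of_eq ?_))
      exact (LinearEquiv.finrank_eq (Submodule.equivMapOfInjective _ hinj _))
    have hmem : T i x - T' i x ∈ A i ⊔ B i :=
      sub_mem (Submodule.mem_sup_left (hi x hx.1)) (Submodule.mem_sup_right (hi' x hx.2))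
    rw [← heq] at hmem
    obtain ⟨w, hw, hwx⟩ := hmem
    have hw' : Ring.inverse (S i) (T i x - T' i x) = w := by
      rw [← hwx, ← Module.End.mul_apply, Ring.inverse_mul_cancel _ hu, Module.End.one_apply]
    have hval : (T i - T i * P * (Ring.inverse (S i)) * (T i - T' i)) x = T i x - T i (P w) := by
      rw [LinearMap.sub_apply, Module.End.mul_apply, LinearMap.sub_apply, Module.End.mul_apply, hw']
      rfl
    have hval' : T i x - T i (P w) = T' i x + T' i (w - P w) := by
      have h1 : T i (P w) + T' i (w - P w) = T i x - T' i x := hwx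
      rw [eq_sub_iff_add_eq] at h1
      rw [← h1]
      abel
    constructor
    · rw [hval]
      exact sub_mem (hi x hx.1) (hi _ (hP w))
    · rw [hval, hval']
      exact add_mem (hi' x hx.2) (hi' _ (hP' w hw))

theorem continuous_conjEnd : Continuous (conjEnd (gal conjQ) : Module.End ℂ (Cx V) → _) :=
  continuous_of_map_real_smul (conjEnd (gal conjQ) : Module.End ℂ (Cx V) →ₛₗ[_] _).toAddMonoidHom
    fun t X => by
      have h1 := (conjEnd (gal conjQ) : Module.End ℂ (Cx V) →ₛₗ[_] _).map_smulₛₗ (t : ℂ) X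
      have h2 : conjQ (t : ℂ) = t := by rw [conjQ_apply, Complex.conj_ofReal]
      rw [← h2]
      exact (congrArg _ (congrArg (· • X) h2)).trans h1

theorem conj (hA : LimContains l A A₀) :
    LimContains l (fun i => conjSubmodule (A i)) (conjSubmodule A₀) := by
  obtain ⟨T, hT, hTA⟩ := hA
  refine ⟨fun i => conjEnd (gal conjQ) (T i), ?_, ?_⟩
  · have h1 := (continuous_conjEnd (V := V)).tendsto 1
    have hone : conjEnd (gal conjQ) (1 : Module.End ℂ (Cx V)) = 1 :=
      LinearMap.ext fun x => gal_conjQ_gal_conjQ x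
    rw [hone] at h1
    exact h1.comp hT
  · filter_upwards [hTA] with i hi x hx
    change gal conjQ (gal conjQ (T i (gal conjQ x))) ∈ A i
    rw [gal_conjQ_gal_conjQ]
    exact hi _ hx

/-- The topology is tested on frames. For a frame v near v₀ the endomorphism S(v) is close to 1 and
carries v₀ to v, so S(v)T is close to T and maps A₀ into the span of v. -/
theorem isOpen_setOf_map_le {N : Set (Module.End ℂ (Cx V))} (hN : IsOpen N)
    (A₀ : Submodule ℂ (Cx V)) :
    IsOpen[grassmannTopology (Cx V)] {A | ∃ T ∈ N, A₀.map T ≤ A} := by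
  rw [isOpen_iSup_iff]
  intro d
  let : TopologicalSpace (Cx V) := moduleTopology ℂ (Cx V)
  have : IsModuleTopology ℂ (Cx V) := ⟨rfl⟩
  rw [isOpen_coinduced, isOpen_iff_mem_nhds]
  rintro ⟨v₀, hv₀⟩ ⟨T, hTN, hT⟩
  obtain ⟨g, hg⟩ := (Fintype.linearCombination ℂ v₀).exists_leftInverse_of_injective
    (LinearMap.ker_eq_bot.2 (hv₀.fintypeLinearCombination_injective))
  have hg' : ∀ j k, g (v₀ j) k = if j = k then 1 else 0 := fun j k => by
    have h1 := LinearMap.congr_fun hg (Pi.single j 1)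
    rw [LinearMap.comp_apply, Fintype.linearCombination_apply_single, one_smul] at h1
    rw [h1, LinearMap.id_apply, Pi.single_apply]
    simp only [eq_comm]
  let φ : Fin d → Cx V →ₗ[ℂ] Module.End ℂ (Cx V) := fun j =>
    LinearMap.smulRightₗ (LinearMap.proj j ∘ₗ g)
  let S : (Fin d → Cx V) → Module.End ℂ (Cx V) := fun v => 1 + ∑ j, φ j (v j - v₀ j)
  have hS : ∀ v j, S v (v₀ j) = v j := fun v j => by
    simp only [S, φ, LinearMap.add_apply, Module.End.one_apply, LinearMap.sum_apply]
    rw [Finset.sum_eq_single_of_mem j (Finset.mem_univ _)]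
    · simp [hg']
    · intro k _ hk
      simp [hg', hk.symm]
  have hScont : Continuous fun v : {v : Fin d → Cx V // LinearIndependent ℂ v} => S v.1 * T := by
    have h2 : ∀ j, Continuous (φ j) := fun j => IsModuleTopology.continuous_of_linearMap _
    have h3 : ∀ j, Continuous fun v : {v : Fin d → Cx V // LinearIndependent ℂ v} =>
        φ j (v.1 j) - φ j (v₀ j) := fun j =>
      ((h2 j).comp ((continuous_apply j).comp continuous_subtype_val)).sub continuous_const
    have h4 : (fun v : {v : Fin d → Cx V // LinearIndependent ℂ v} => S v.1 * T) = fun v =>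
        (1 + ∑ j, (φ j (v.1 j) - φ j (v₀ j))) * T := by
      funext v
      simp only [S, map_sub]
    rw [h4]
    exact (continuous_const.add (continuous_finsetSum _ fun j _ => h3 j)).mul continuous_const
  have hS0 : S v₀ * T = T := by
    simp [S]
  have hev := hScont.continuousAt (x := ⟨v₀, hv₀⟩) (hN.mem_nhds (by rw [hS0]; exact hTN))
  refine Filter.mem_of_superset hev fun v hv => ⟨_, hv, ?_⟩
  rintro _ ⟨x, hx, rfl⟩
  have h1 : T x ∈ Submodule.span ℂ (Set.range v₀) := hT (Submodule.mem_map_of_mem hx)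
  have h2 : Submodule.span ℂ (Set.range v₀) ≤ (Submodule.span ℂ (Set.range v.1)).comap (S v.1) := by
    rw [Submodule.span_le]
    rintro _ ⟨j, rfl⟩
    change S v.1 (v₀ j) ∈ Submodule.span ℂ (Set.range v.1)
    rw [hS]
    exact Submodule.subset_span ⟨j, rfl⟩
  exact h2 h1

/-- For each i choose the endomorphism closest to 1 among those that map A₀ into A_i; it exists
because these form a closed subspace of a proper space. -/
theorem of_forall_nhds (h : ∀ N : Set (Module.End ℂ (Cx V)), IsOpen N → 1 ∈ N →
    ∀ᶠ i in l, ∃ T ∈ N, A₀.map T ≤ A i) : LimContains l A A₀ := by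
  let M : ι → Submodule ℂ (Module.End ℂ (Cx V)) := fun i =>
    { carrier := {T | ∀ x ∈ A₀, T x ∈ A i}
      add_mem' := fun ha hb x hx => add_mem (ha x hx) (hb x hx)
      zero_mem' := fun x _ => Submodule.zero_mem _
      smul_mem' := fun a T hT x hx => Submodule.smul_mem _ a (hT x hx) }
  have : ProperSpace (Module.End ℂ (Cx V)) := FiniteDimensional.proper ℂ _
  have hex : ∀ i, ∃ T ∈ (M i : Set (Module.End ℂ (Cx V))),
      Metric.infDist 1 (M i : Set (Module.End ℂ (Cx V))) = dist 1 T := fun i =>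
    (Submodule.closed_of_finiteDimensional (M i)).exists_infDist_eq_dist ⟨0, (M i).zero_mem⟩ 1
  choose T hTM hT using hex
  refine ⟨T, ?_, Eventually.of_forall hTM⟩
  rw [Metric.tendsto_nhds]
  intro ε hε
  filter_upwards [h (Metric.ball 1 ε) Metric.isOpen_ball (Metric.mem_ball_self hε)] with i hi
  obtain ⟨S, hS, hSA⟩ := hi
  rw [dist_comm, ← hT i]
  have hSM : S ∈ (M i : Set (Module.End ℂ (Cx V))) := fun x hx => hSA (Submodule.mem_map_of_mem hx)
  refine (Metric.infDist_le_dist_of_mem hSM).trans_lt ?_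
  rw [dist_comm]
  exact hS

theorem nhds (F₀ : CxFiltration V) (p : ℤ) : LimContains (𝓝 F₀) (fun F => F p) (F₀ p) := by
  refine of_forall_nhds fun N hN hone => ?_
  let : TopologicalSpace (Submodule ℂ (Cx V)) := grassmannTopology (Cx V)
  have hc : Continuous fun F : CxFiltration V => F p := continuous_apply p
  refine hc.continuousAt ((isOpen_setOf_map_le hN (F₀ p)).mem_nhds ⟨1, hone, ?_⟩)
  rw [Module.End.one_eq_id, Submodule.map_id]

theorem of_le {l' : Filter ι} (h : LimContains l A A₀) (hl : l' ≤ l) : LimContains l' A A₀ := by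
  obtain ⟨T, hT, h⟩ := h
  exact ⟨T, hT.mono_left hl, hl h⟩

end LimContains

end LowerSemicontinuity

/-! ### Dimensions of subspaces spanned by summands of a bigrading. -/

section CoordinateSubspaces

variable {E : Type*} [AddCommGroup E] [Module ℂ E] [FiniteDimensional ℂ E]

/-- The dimension is the trace of the projection to U, a sum of traces of projections to summands.
The index set t may exceed the support so that two bigradings can be compared over a common one. -/
theorem Bigrading.finrank_eq_sum (B : Bigrading E) {U : Submodule ℂ E} {S : ℤ × ℤ → Prop}
    [DecidablePred S] (hU : ∀ x, x ∈ U ↔ ∀ i, ¬ S i → B.proj i x = 0) {t : Finset (ℤ × ℤ)}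
    (ht : B.supp ⊆ t) : Module.finrank ℂ U =
      ∑ i ∈ t, if S i then Module.finrank ℂ (LinearMap.range (B.proj i)) else 0 := by
  have htr : ∀ i, LinearMap.trace ℂ E (B.proj i) =
      Module.finrank ℂ (LinearMap.range (B.proj i)) := fun i =>
    LinearMap.IsProj.trace ⟨fun x => ⟨x, rfl⟩, by rintro _ ⟨x, rfl⟩; exact B.proj_self i x⟩
  let f : ℤ × ℤ → ℂ := fun i => if S i then 1 else 0
  have hproj : LinearMap.IsProj U (B.scalar f) := by
    refine ⟨fun x => (hU _).2 fun i hi => ?_, fun x hx => B.ext_proj fun i => ?_⟩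
    · rw [B.proj_scalar]
      simp only [f, if_neg hi, zero_smul]
    · rw [B.proj_scalar]
      by_cases hi : S i
      · simp only [f, if_pos hi, one_smul]
      · rw [(hU x).1 hx i hi, smul_zero]
  have h1 := hproj.trace
  rw [Bigrading.scalar, map_sum] at h1
  have h2 : ∑ i ∈ t, LinearMap.trace ℂ E (f i • B.proj i) =
      ∑ i ∈ B.supp, LinearMap.trace ℂ E (f i • B.proj i) := by
    refine (Finset.sum_subset ht fun i _ hi => ?_).symm
    have : B.proj i = 0 := LinearMap.ext fun x => B.proj_eq_zero hi x
    rw [this, smul_zero, map_zero]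
  rw [← h2] at h1
  have h3 : (Module.finrank ℂ U : ℂ) =
      ((∑ i ∈ t, if S i then Module.finrank ℂ (LinearMap.range (B.proj i)) else 0 : ℕ) : ℂ) := by
    rw [← h1, Nat.cast_sum]
    refine Finset.sum_congr rfl fun i _ => ?_
    rw [map_smul, htr, smul_eq_mul]
    simp only [f]
    split_ifs
    · rw [one_mul]
    · rw [zero_mul, Nat.cast_zero]
  exact_mod_cast h3

theorem Bigrading.finrank_eq_of_finrank_range_eq {B B' : Bigrading E} {U U' : Submodule ℂ E}
    {S : ℤ × ℤ → Prop} (hU : ∀ x, x ∈ U ↔ ∀ i, ¬ S i → B.proj i x = 0)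
    (hU' : ∀ x, x ∈ U' ↔ ∀ i, ¬ S i → B'.proj i x = 0)
    (h : ∀ i, Module.finrank ℂ (LinearMap.range (B.proj i)) =
      Module.finrank ℂ (LinearMap.range (B'.proj i))) :
    Module.finrank ℂ U = Module.finrank ℂ U' := by
  classical
  rw [B.finrank_eq_sum hU (t := B.supp ∪ B'.supp) Finset.subset_union_left,
    B'.finrank_eq_sum hU' (t := B.supp ∪ B'.supp) Finset.subset_union_right]
  simp only [h]

omit [FiniteDimensional ℂ E] in
theorem IsSplitting.mem_sup_iff {σ : ℂ →+* ℂ} {c : E →ₛₗ[σ] E} {W F : ℤ → Submodule ℂ E}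
    {B : Bigrading E} (hB : IsSplitting c W F B) (p k : ℤ) (x : E) :
    x ∈ F p ⊔ W k ↔ ∀ i : ℤ × ℤ, ¬ (p ≤ i.1 ∨ i.1 + i.2 ≤ k) → B.proj i x = 0 := by
  constructor
  · intro hx i hi
    push Not at hi
    obtain ⟨y, hy, z, hz, rfl⟩ := Submodule.mem_sup.1 hx
    rw [map_add, (hB.mem_F p y).1 hy i hi.1, (hB.mem_W k z).1 hz i hi.2, add_zero]
  · intro h
    refine B.mem_of_proj_mem fun i => ?_
    by_cases hp : p ≤ i.1
    · exact Submodule.mem_sup_left (hB.proj_mem_F hp x)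
    · by_cases hk : i.1 + i.2 ≤ k
      · exact Submodule.mem_sup_right (hB.proj_mem_W hk x)
      · rw [h i (by tauto)]
        exact Submodule.zero_mem _

omit [FiniteDimensional ℂ E] in
theorem delI_le_delR {σ : ℂ →+* ℂ} {c : E →ₛₗ[σ] E} {W F : ℤ → Submodule ℂ E}
    (hW : Monotone W) (hF : Antitone F) {p q r s : ℤ} (hr : r < p) (hrs : r + s ≤ p + q) :
    delI c W F r s ≤ delR c W F p q := by
  refine inf_le_right.trans (delR_le_of_forall fun n l hl hn w hw => ?_)
  have hm : 0 ≤ p + q - (r + s) := by omega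
  -- With d = p+q-(r+s), the defect d+n-1 suffices because r < p gives one step of the Hodge
  -- filtration for free. For d = n = 0 the truncated subtraction yields 0, the leading summand.
  refine mem_delR hW ((p + q - (r + s)).toNat + n - 1)
    (b := q - (((p + q - (r + s)).toNat + n - 1 : ℕ) : ℤ)) (l := l) rfl (by omega) (by omega)
    ⟨?_, hw.2⟩
  exact hF (show q - (((p + q - (r + s)).toNat + n - 1 : ℕ) : ℤ) ≤ s - n by omega) hw.1

end CoordinateSubspaces

/-! ### Continuity of the Deligne torus. -/

section Continuity

open Filter Topology

variable {V : Type*} [AddCommGroup V] [Module ℚ V] [Module.Finite ℚ V] {W : WeightFiltration V}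

attribute [local instance] endNormedRing endNormedAlgebra endCompleteSpace

/-- I^{p,q} is the intersection of the two spaces summed here, and the sum does not depend on F.
This is the constancy of dimension that makes the intersection vary well. -/
theorem IsMixedHodge.inf_sup_delR {F : CxFiltration V} (h : IsMixedHodge W F) (p q : ℤ) :
    F p ⊓ W.cx (p + q) ⊔ delR (gal conjQ) W.cx F p q = W.cx (p + q) := by
  apply le_antisymm
  · refine sup_le inf_le_right (delR_le_of_forall fun n l hl _ => ?_)
    exact inf_le_right.trans (WeightFiltration.cx_mono (by omega))
  · intro x hx
    refine h.bigrading.mem_of_proj_mem fun i => ?_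
    by_cases hi : i.1 + i.2 ≤ p + q
    · by_cases hp : p ≤ i.1
      · exact Submodule.mem_sup_left ⟨h.isSplitting.proj_mem_F hp x, h.isSplitting.proj_mem_W hi x⟩
      · exact Submodule.mem_sup_right (delI_le_delR WeightFiltration.cx_mono h.anti
          (not_le.1 hp) hi (h.proj_mem_deligneI i x))
    · rw [(h.isSplitting.mem_W _ x).1 hx i (not_le.1 hi)]
      exact Submodule.zero_mem _

variable {G : Subgroup (GLC V)} {h : ℤ → ℤ → ℕ} {F₀ : CxFiltration V}

theorem finrank_range_eq_of_mem_structuresIn {F : CxFiltration V} (hF : F ∈ structuresIn W G h)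
    (i : ℤ × ℤ) : Module.finrank ℂ (LinearMap.range (hF.1.bigrading.proj i)) = h i.1 i.2 := by
  rw [← hF.2.1, hF.1.isSplitting.finrank_hodgePiece]

/-- F^p + W_k is a sum of summands of the bigrading, so its dimension is given by the Hodge numbers
and is constant on `structuresIn`. -/
theorem limContains_inf (hF₀ : F₀ ∈ structuresIn W G h) (p k : ℤ) :
    LimContains (𝓝[structuresIn W G h] F₀) (fun F => F p ⊓ W.cx k) (F₀ p ⊓ W.cx k) := by
  refine ((LimContains.nhds F₀ p).of_le nhdsWithin_le_nhds).inf (LimContains.const _) ?_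
  filter_upwards [self_mem_nhdsWithin] with F hF
  refine le_of_eq (Bigrading.finrank_eq_of_finrank_range_eq (hF.1.isSplitting.mem_sup_iff p k)
    (hF₀.1.isSplitting.mem_sup_iff p k) fun i => ?_)
  rw [finrank_range_eq_of_mem_structuresIn hF, finrank_range_eq_of_mem_structuresIn hF₀]

theorem limContains_conj_inf (hF₀ : F₀ ∈ structuresIn W G h) (q k : ℤ) :
    LimContains (𝓝[structuresIn W G h] F₀) (fun F => conjSubmodule (F q) ⊓ W.cx k)
      (conjSubmodule (F₀ q) ⊓ W.cx k) := by
  refine (limContains_inf hF₀ q k).conj.mono (fun F x hx => ⟨hx.1, ?_⟩)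
    fun x hx => ⟨hx.1, WeightFiltration.gal_mem_cx conjQ hx.2⟩
  have := WeightFiltration.gal_mem_cx conjQ hx.2
  rwa [gal_conjQ_gal_conjQ] at this

theorem limContains_deligneI (hF₀ : F₀ ∈ structuresIn W G h) (p q : ℤ) :
    LimContains (𝓝[structuresIn W G h] F₀) (fun F => deligneI W F p q) (deligneI W F₀ p q) := by
  refine (limContains_inf hF₀ p (p + q)).inf ((limContains_conj_inf hF₀ q (p + q)).sup
    (LimContains.iSup fun j : ℕ => limContains_conj_inf hF₀ (q - 1 - j) (p + q - 2 - j))) ?_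
  filter_upwards [self_mem_nhdsWithin] with F hF
  exact le_of_eq (congrArg (fun U : Submodule ℂ (Cx V) => Module.finrank ℂ U)
    ((hF.1.inf_sup_delR p q).trans (hF₀.1.inf_sup_delR p q).symm))

/-- The Deligne torus depends continuously on the mixed Hodge structure, as long as the Hodge
numbers are fixed. -/
theorem tendsto_deligneTorus (hF₀ : F₀ ∈ structuresIn W G h) (z : ℂˣ × ℂˣ) :
    Tendsto (fun F => (deligneTorus W F z).toLinearMap) (𝓝[structuresIn W G h] F₀)
      (𝓝 (deligneTorus W F₀ z).toLinearMap) := by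
  set B := hF₀.1.bigrading with hB
  have hlim := fun i : ℤ × ℤ => limContains_deligneI hF₀ i.1 i.2
  choose T hT hTI using hlim
  -- S(F) tends to 1 and carries each summand of the splitting of F₀ into the corresponding one of
  -- F. Once it is invertible it conjugates the torus of F₀ to that of F.
  let S : CxFiltration V → Module.End ℂ (Cx V) := fun F => ∑ i ∈ B.supp, T i F * B.proj i
  have hS : Tendsto S (𝓝[structuresIn W G h] F₀) (𝓝 1) := by
    have h1 := tendsto_finsetSum B.supp fun i _ => (hT i).mul_const (B.proj i)
    have h2 : ∑ i ∈ B.supp, 1 * B.proj i = 1 := by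
      refine LinearMap.ext fun x => ?_
      simp only [one_mul, LinearMap.sum_apply, B.sum_proj, Module.End.one_apply]
    rwa [h2] at h1
  have hinv : Tendsto (fun F => Ring.inverse (S F)) (𝓝[structuresIn W G h] F₀) (𝓝 1) := by
    have h1 := (NormedRing.inverse_continuousAt (1 : (Module.End ℂ (Cx V))ˣ)).tendsto
    rw [Units.val_one, Ring.inverse_one] at h1
    exact h1.comp hS
  have hunit : ∀ᶠ F in 𝓝[structuresIn W G h] F₀, IsUnit (S F) :=
    hS (Units.isOpen.mem_nhds (by exact isUnit_one))
  have hTI' : ∀ᶠ F in 𝓝[structuresIn W G h] F₀, ∀ i ∈ B.supp, ∀ x ∈ deligneI W F₀ i.1 i.2,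
      T i F x ∈ deligneI W F i.1 i.2 := (Filter.eventually_all_finset _).2 fun i _ => hTI i
  have hlim := (hS.mul_const (deligneTorus W F₀ z).toLinearMap).mul hinv
  rw [one_mul, mul_one] at hlim
  refine hlim.congr' ?_
  filter_upwards [hunit, hTI', self_mem_nhdsWithin] with F hu hFI hF
  have hcomm : (deligneTorus W F z).toLinearMap * S F =
      S F * (deligneTorus W F₀ z).toLinearMap := by
    refine B.linearMap_ext fun i x => ?_
    have hSi : S F (B.proj i x) = T i F (B.proj i x) ∨ B.proj i x = 0 := by
      by_cases hi : i ∈ B.supp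
      · left
        simp only [S, LinearMap.sum_apply, Module.End.mul_apply]
        rw [Finset.sum_eq_single_of_mem i hi fun j _ hj => by rw [B.proj_ne hj, map_zero],
          B.proj_self]
      · exact Or.inr (B.proj_eq_zero hi x)
    rw [Module.End.mul_apply, Module.End.mul_apply]
    rcases hSi with hSi | h0
    · by_cases hi : i ∈ B.supp
      · have h1 := hF.1.isDeligneTorus_deligneTorus i.1 i.2 _
          (hFI i hi _ (hF₀.1.proj_mem_deligneI i x)) z
        have h2 := hF₀.1.isDeligneTorus_deligneTorus i.1 i.2 _ (hF₀.1.proj_mem_deligneI i x) z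
        rw [LinearEquiv.coe_coe, LinearEquiv.coe_coe, h2, map_smul, hSi]
        exact h1
      · rw [B.proj_eq_zero hi x, map_zero, map_zero, map_zero, map_zero]
    · rw [h0, map_zero, map_zero, map_zero, map_zero]
  rw [← hcomm, mul_assoc, Ring.mul_inverse_cancel _ hu, mul_one]

end Continuity

/-! ### Endomorphisms real on the graded pieces. -/

section RealLieAlgebra

variable {V : Type*} [AddCommGroup V] [Module ℚ V] [Module.Finite ℚ V] (W : WeightFiltration V)

/-- The endomorphisms which preserve the weight filtration and are real on the graded pieces. -/
def realEnd : Subring (Module.End ℂ (Cx V)) where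
  carrier := {X | ∀ k, ∀ x ∈ W.cx k, X x ∈ W.cx k ∧
    gal conjQ (X x) - X (gal conjQ x) ∈ W.cx (k - 1)}
  mul_mem' := by
    intro X Y hX hY k x hx
    obtain ⟨h1, h2⟩ := hY k x hx
    refine ⟨(hX k _ h1).1, ?_⟩
    have h3 := add_mem (hX k _ h1).2 (hX _ _ h2).1
    rwa [map_sub, sub_add_sub_cancel] at h3
  one_mem' := fun k x hx => ⟨hx, by
    rw [Module.End.one_apply, Module.End.one_apply, sub_self]; exact Submodule.zero_mem _⟩
  add_mem' := by
    intro X Y hX hY k x hx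
    refine ⟨add_mem (hX k x hx).1 (hY k x hx).1, ?_⟩
    have h3 := add_mem (hX k x hx).2 (hY k x hx).2
    rwa [sub_add_sub_comm, ← map_add] at h3
  zero_mem' := fun k x _ => by
    simp
  neg_mem' := by
    intro X hX k x hx
    refine ⟨neg_mem (hX k x hx).1, ?_⟩
    have h3 := neg_mem (hX k x hx).2
    rwa [neg_sub', ← map_neg] at h3

variable {W}

theorem mem_realGr_iff_mem_realEnd {g : GLC V} : g ∈ realGr W ↔ g.toLinearMap ∈ realEnd W :=
  ⟨fun h k x hx => ⟨h.1 k x hx, h.2 k x hx⟩,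
    fun h => ⟨fun k x hx => (h k x hx).1, fun k x hx => (h k x hx).2⟩⟩

omit [Module.Finite ℚ V] in
theorem real_smul_mem_realEnd (t : ℝ) {X : Module.End ℂ (Cx V)} (hX : X ∈ realEnd W) :
    (t : ℂ) • X ∈ realEnd W := fun k x hx => by
  refine ⟨Submodule.smul_mem _ _ (hX k x hx).1, ?_⟩
  have h1 := Submodule.smul_mem _ (t : ℂ) (hX k x hx).2
  rw [smul_sub] at h1
  rw [LinearMap.smul_apply, LinearMap.smul_apply, gal_smul, conjQ_apply, Complex.conj_ofReal]
  exact h1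

attribute [local instance] endNormedRing endNormedAlgebra endCompleteSpace

theorem isClosed_realEnd : IsClosed (realEnd W : Set (Module.End ℂ (Cx V))) := by
  have h1 : (realEnd W : Set (Module.End ℂ (Cx V))) = (endFil W.cx 0 : Set _) ∩
      (fun X => conjEnd (gal conjQ) X - X) ⁻¹' (endFil W.cx (-1) : Set _) := by
    ext X
    constructor
    · intro h
      refine ⟨fun k x hx => mem_of_index_eq (h k x hx).1 (by ring), fun k x hx => ?_⟩
      have := (h k _ (WeightFiltration.gal_mem_cx conjQ hx)).2
      rw [gal_conjQ_gal_conjQ] at this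
      exact this
    · rintro ⟨h, h'⟩ k x hx
      refine ⟨mem_of_index_eq (h k x hx) (by ring), ?_⟩
      have := h' k _ (WeightFiltration.gal_mem_cx conjQ hx)
      rw [LinearMap.sub_apply, conjEnd_apply, gal_conjQ_gal_conjQ] at this
      exact this
  rw [h1]
  exact (Submodule.closed_of_finiteDimensional _).inter
    ((Submodule.closed_of_finiteDimensional (endFil W.cx (-1))).preimage
      (LimContains.continuous_conjEnd.sub continuous_id))

end RealLieAlgebra

/-! ### Local conjugacy inside a closed real subalgebra. -/

section AbstractRealExponential

variable {A : Type*} [NormedRing A] [NormedAlgebra ℂ A] [CompleteSpace A]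

theorem exp_mem_of_isClosed {R : Subring A} (hR : IsClosed (R : Set A))
    (hsmul : ∀ (t : ℝ), ∀ x ∈ R, (t : ℂ) • x ∈ R) {X : A} (hX : X ∈ R) :
    NormedSpace.exp X ∈ R := by
  have h1 := NormedSpace.exp_series_hasSum_exp' (𝕂 := ℝ) X
  refine hR.mem_of_tendsto h1 (Filter.Eventually.of_forall fun s =>
    R.sum_mem fun n _ => ?_)
  rw [← Complex.coe_smul]
  exact hsmul _ _ (R.pow_mem hX n)

theorem exp_half_mul_exp_half (X : A) :
    NormedSpace.exp (((1 / 2 : ℝ) : ℂ) • X) * NormedSpace.exp (((1 / 2 : ℝ) : ℂ) • X) =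
      NormedSpace.exp X := by
  rw [← pow_two, ← exp_nat_smul, two_nsmul, ← add_smul, ← Complex.ofReal_add, add_halves,
    Complex.ofReal_one, one_smul]

/-- A closed real subalgebra, as a real subspace. -/
def realSubmodule (R : Subring A) (hsmul : ∀ (t : ℝ), ∀ x ∈ R, (t : ℂ) • x ∈ R) : Submodule ℝ A where
  carrier := R
  add_mem' := R.add_mem
  zero_mem' := R.zero_mem
  smul_mem' t x hx := by
    rw [← Complex.coe_smul]
    exact hsmul t x hx

/-- Local conjugacy of semisimple elements in the intersection of a group of units `M`, which is
defined by a closed condition, with a closed real subalgebra. -/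
theorem eventually_conj_of_subring [FiniteDimensional ℂ A] {M Z : Set A} (hZ : IsClosed Z)
    (hM : ∀ a, IsUnit a → (a ∈ M ↔ a ∈ Z)) (hone : 1 ∈ M) (hmul : ∀ a ∈ M, ∀ b ∈ M, a * b ∈ M)
    (hinv : ∀ a ∈ M, ∀ b, a * b = 1 → b * a = 1 → b ∈ M) {R : Subring A}
    (hR : IsClosed (R : Set A)) (hsmul : ∀ (t : ℝ), ∀ x ∈ R, (t : ℂ) • x ∈ R)
    (hRinv : ∀ a ∈ R, a ∈ M → ∀ b, a * b = 1 → b * a = 1 → b ∈ R)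
    {𝔪 : Submodule ℂ A} (h𝔪 : ∀ X, X ∈ 𝔪 ↔ ∀ t : ℝ, NormedSpace.exp ((t : ℂ) • X) ∈ M)
    {p : Polynomial ℂ} (hp : p.Separable) {s s' : A} (hs : Polynomial.aeval s p = 0)
    (hss : s * s' = 1) (hss' : s' * s = 1) (hsM : s ∈ M) (hsR : s ∈ R)
    (hAd : ∀ X ∈ 𝔪, s' * X * s ∈ 𝔪) :
    ∀ᶠ a in nhds s, a ∈ M → a ∈ R → Polynomial.aeval a p = 0 →
      ∃ m ∈ 𝔪, m ∈ R ∧ a = NormedSpace.exp m * s * NormedSpace.exp (-m) := by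
  have hs'R : s' ∈ R := hRinv s hsR hsM s' hss hss'
  have hLcl : IsClosed (realSubmodule R hsmul : Set A) := hR
  have hγ : ∀ X, X ∈ 𝔪.restrictScalars ℝ ⊓ realSubmodule R hsmul ↔
      ∀ t : ℝ, NormedSpace.exp (t • X) ∈ M ∩ (R : Set A) := by
    intro X
    constructor
    · rintro ⟨h1, h2⟩ t
      refine ⟨?_, ?_⟩
      · rw [← Complex.coe_smul]; exact (h𝔪 X).1 h1 t
      · rw [← Complex.coe_smul]; exact exp_mem_of_isClosed hR hsmul (hsmul t X h2)
    · intro h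
      refine ⟨(h𝔪 X).2 fun t => ?_, mem_of_exp_sub_one_mem hLcl fun t => ?_⟩
      · rw [Complex.coe_smul]; exact (h t).1
      · rw [Complex.coe_smul]; exact R.sub_mem (h t).2 R.one_mem
  have key := eventually_conj_of_aeval_eq_zero (Γ := M ∩ (R : Set A)) (Z := Z ∩ R)
    (hZ.inter hR) (fun a ha => and_congr_left fun _ => hM a ha) ⟨hone, R.one_mem⟩
    (fun a ha b hb => ⟨hmul a ha.1 b hb.1, R.mul_mem ha.2 hb.2⟩)
    (fun a ha b hab hba => ⟨hinv a ha.1 b hab hba, hRinv a ha.2 ha.1 b hab hba⟩) hγ hp hs hss hss'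
    ⟨hsM, hsR⟩ fun X hX => ⟨hAd X hX.1, R.mul_mem (R.mul_mem hs'R hX.2) hsR⟩
  filter_upwards [key] with a ha haM haR hap
  obtain ⟨m, hm, h⟩ := ha ⟨haM, haR⟩ hap
  exact ⟨m, hm.1, hm.2, h⟩

end AbstractRealExponential

/-! ### Openness of the orbits. -/

section OpenOrbits

open Filter Topology

variable {V : Type*} [AddCommGroup V] [Module ℚ V] [Module.Finite ℚ V] {W : WeightFiltration V}
  {Q : GradedForms W}

/-- The square of a similitude which is real on the graded pieces is a positive similitude. -/
theorem mul_self_mem_posSim {g : GLC V} (hg : g ∈ simGroup Q) (hgr : g ∈ realGr W) :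
    g * g ∈ posSim Q := by
  refine ⟨(realGr W).mul_mem hgr hgr, fun k => ?_⟩
  obtain ⟨a, ha, h⟩ := hg.2 k
  have h2 : ∀ x ∈ W.cx k, ∀ y ∈ W.cx k,
      grForm Q k ((g * g) x) ((g * g) y) = a * a * grForm Q k x y := fun x hx y hy => by
    rw [LinearEquiv.mul_apply, LinearEquiv.mul_apply, h _ (hg.1 k x hx) _ (hg.1 k y hy),
      h x hx y hy, mul_assoc]
  by_cases h0 : ∀ x ∈ W.cx k, ∀ y ∈ W.cx k, grForm Q k x y = 0
  · exact ⟨1, one_pos, fun x hx y hy => by rw [h2 x hx y hy, h0 x hx y hy, mul_zero, mul_zero]⟩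
  · push Not at h0
    obtain ⟨x, hx, y, hy, hne⟩ := h0
    have hcx := WeightFiltration.gal_mem_cx conjQ hx
    have hcy := WeightFiltration.gal_mem_cx conjQ hy
    -- Conjugating the similitude relation shows that the factor a is real, so the factor a² of the
    -- square is positive.
    have h3 : grForm Q k (g (gal conjQ x)) (g (gal conjQ y)) =
        grForm Q k (gal conjQ (g x)) (gal conjQ (g y)) := by
      have e1 := grForm_eq_zero_left (Q := Q) (hgr.2 k x hx) (gal conjQ (g y))
      have e2 := grForm_eq_zero_right (Q := Q) (hgr.2 k y hy) (g (gal conjQ x))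
      rw [map_sub, LinearMap.sub_apply, sub_eq_zero] at e1
      rw [map_sub, sub_eq_zero] at e2
      rw [e1, e2]
    rw [grForm_gal, h _ hcx _ hcy, grForm_gal, h x hx y hy, map_mul] at h3
    have h4 : conjQ a = a :=
      (mul_right_cancel₀ (by simpa using hne) h3).symm
    rw [conjQ_apply, Complex.conj_eq_iff_real] at h4
    obtain ⟨r, rfl⟩ := h4
    refine ⟨r * r, mul_self_pos.2 fun hr => ha (by rw [hr, Complex.ofReal_zero]), ?_⟩
    rw [Complex.ofReal_mul]
    exact h2

/-- The value of the torus at the generic point has distinct eigenvalues on the summands, so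
conjugating it transports the whole bigrading and with it the Hodge filtration. -/
theorem eq_translate_of_conj {F₀ F : CxFiltration V} (h₀ : IsMixedHodge W F₀)
    (h : IsMixedHodge W F) {g : GLC V}
    (hg : deligneTorus W F genericPoint = g * deligneTorus W F₀ genericPoint * g⁻¹) :
    F = translate g F₀ := by
  have hcomm : ∀ x, g (h₀.bigrading.scalar (Bigrading.chr genericPoint) x) =
      h.bigrading.scalar (Bigrading.chr genericPoint) (g x) := fun x => by
    rw [h.deligneTorus_eq, h₀.deligneTorus_eq, eq_mul_inv_iff_mul_eq] at hg
    exact (LinearEquiv.congr_fun hg x).symm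
  have hproj := Bigrading.proj_comm_of_scalar_comm chr_genericPoint_injective g.toLinearMap hcomm
  have hmem : ∀ p x, x ∈ F₀ p ↔ g x ∈ F p := fun p x => by
    rw [h₀.isSplitting.mem_F, h.isSplitting.mem_F]
    refine forall₂_congr fun i _ => ?_
    have h1 : g (h₀.bigrading.proj i x) = h.bigrading.proj i (g x) := hproj i x
    rw [← h1, LinearEquiv.map_eq_zero_iff]
  funext p
  ext x
  constructor
  · intro hx
    refine ⟨g⁻¹ x, (hmem p _).2 (by rwa [GL_apply_inv_self]), GL_apply_inv_self g x⟩
  · rintro ⟨y, hy, rfl⟩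
    exact (hmem p y).1 hy

attribute [local instance] endNormedRing endNormedAlgebra endCompleteSpace

theorem isClosed_setOf_aeval_entries (S : Set (MatPoly V)) :
    IsClosed {X : Module.End ℂ (Cx V) | ∀ P ∈ S, MvPolynomial.aeval (entries X) P = 0} := by
  simp only [Set.ofPred_forall]
  refine isClosed_biInter fun P _ => isClosed_eq ?_ continuous_const
  simp only [entries_eq]
  have : (fun X : Module.End ℂ (Cx V) => MvPolynomial.aeval (fun ij => entryCLM ij X) P) =
      fun X => MvPolynomial.eval (fun ij => entryCLM ij X) (MvPolynomial.map (algebraMap ℚ ℂ) P) := by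
    funext X
    rw [MvPolynomial.eval_map, ← MvPolynomial.aeval_def]
  rw [this]
  exact (MvPolynomial.continuous_eval _).comp (continuous_pi fun ij => (entryCLM ij).continuous)

variable {G : Subgroup (GLC V)} {h : ℤ → ℤ → ℕ} {F₀ : CxFiltration V}

theorem deligneTorus_mem_realGr {F : CxFiltration V} (hF : IsMixedHodge W F) :
    deligneTorus W F genericPoint ∈ realGr W := by
  rw [hF.deligneTorus_eq]
  refine ⟨hF.isSplitting.torus_mem_stabW _, fun k x hx => ?_⟩
  have h1 := hF.isSplitting.galConj_torus_sub_mem genericPoint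
    (WeightFiltration.gal_mem_cx conjQ hx)
  have h2 : ((Units.map (conjQ : ℂ →* ℂ) genericPoint.2, Units.map (conjQ : ℂ →* ℂ) genericPoint.1) :
      ℂˣ × ℂˣ) = genericPoint := Prod.ext (Units.ext (conjQ_conjQ _)) rfl
  rw [h2] at h1
  change gal conjQ (hF.bigrading.torus genericPoint (gal conjQ (gal conjQ x))) -
    hF.bigrading.torus genericPoint (gal conjQ x) ∈ W.cx (k - 1) at h1
  rwa [gal_conjQ_gal_conjQ] at h1

/-- The roots are the values of the generic point on the types (p,q) that occur. They are distinct,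
and the types are the same throughout `structuresIn` because the Hodge numbers are fixed. -/
theorem exists_separable_aeval (hF₀ : F₀ ∈ structuresIn W G h) :
    ∃ p : Polynomial ℂ, p.Separable ∧ ∀ F ∈ structuresIn W G h,
      Polynomial.aeval (deligneTorus W F genericPoint).toLinearMap p = 0 := by
  set B := hF₀.1.bigrading with hB
  refine ⟨∏ i ∈ B.supp, (Polynomial.X - Polynomial.C (Bigrading.chr genericPoint i)),
    Polynomial.separable_prod_X_sub_C_iff'.2 fun i _ j _ hij => chr_genericPoint_injective hij,
    fun F hF => ?_⟩
  rw [hF.1.deligneTorus_eq]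
  change Polynomial.aeval (hF.1.bigrading.scalar (Bigrading.chr genericPoint)) _ = 0
  rw [Bigrading.aeval_scalar]
  refine hF.1.bigrading.linearMap_ext fun i x => ?_
  rw [Bigrading.scalar_proj, LinearMap.zero_apply]
  by_cases hi : i ∈ B.supp
  · rw [Polynomial.eval_prod, Finset.prod_eq_zero hi (by simp), zero_smul]
  · have h1 : B.proj i = 0 := LinearMap.ext fun x => B.proj_eq_zero hi x
    have h2 := finrank_range_eq_of_mem_structuresIn hF₀ i
    rw [← hB, h1, LinearMap.range_zero, finrank_bot,
      ← finrank_range_eq_of_mem_structuresIn hF i] at h2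
    have h3 := Submodule.finrank_eq_zero.1 h2.symm
    rw [LinearMap.range_eq_bot] at h3
    rw [h3, LinearMap.zero_apply, smul_zero]

theorem coe_expGL_inv (X : Module.End ℂ (Cx V)) :
    (expGL X)⁻¹.toLinearMap = NormedSpace.exp (-X) := rfl

omit [Module.Finite ℚ V] in
theorem exists_toLinearMap_eq {a b : Module.End ℂ (Cx V)} (hab : a * b = 1) (hba : b * a = 1) :
    ∃ g : GLC V, g.toLinearMap = a ∧ g⁻¹.toLinearMap = b :=
  ⟨LinearEquiv.ofLinearMap a b hab hba, rfl, rfl⟩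

omit [Module.Finite ℚ V] in
theorem toLinearMap_mul_inv (g : GLC V) : g.toLinearMap * g⁻¹.toLinearMap = 1 := by
  rw [← toLinearMap_mul, mul_inv_cancel]; rfl

omit [Module.Finite ℚ V] in
theorem toLinearMap_inv_mul (g : GLC V) : g⁻¹.toLinearMap * g.toLinearMap = 1 := by
  rw [← toLinearMap_mul, inv_mul_cancel]; rfl

/-- Semisimple elements of `𝐆` which are real on the graded pieces and close to each other are
conjugate. -/
theorem eventually_eq_conj_expGL (hG : IsQClosed (G : Set (GLC V))) {p : Polynomial ℂ}
    (hp : p.Separable) {s : GLC V} (hs : Polynomial.aeval s.toLinearMap p = 0) (hsG : s ∈ G)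
    (hsR : s ∈ realGr W) : ∀ᶠ a in 𝓝 s.toLinearMap, ∀ g ∈ G, g.toLinearMap = a → g ∈ realGr W →
      Polynomial.aeval a p = 0 →
      ∃ m ∈ lieAlg G, m ∈ realEnd W ∧ g = expGL m * s * (expGL m)⁻¹ := by
  obtain ⟨S, hS⟩ := id hG
  have hM : ∀ a : Module.End ℂ (Cx V), IsUnit a → (a ∈ {X | ∃ g ∈ G, g.toLinearMap = X} ↔
      a ∈ {X : Module.End ℂ (Cx V) | ∀ P ∈ S, MvPolynomial.aeval (entries X) P = 0}) := by
    rintro _ ⟨u, rfl⟩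
    obtain ⟨g, hg, -⟩ := exists_toLinearMap_eq u.3 u.4
    change (∃ g ∈ G, g.toLinearMap = u.1) ↔ ∀ P ∈ S, MvPolynomial.aeval (entries u.1) P = 0
    rw [← hg]
    have h1 : g ∈ G ↔ ∀ P ∈ S, MvPolynomial.aeval (entries g.toLinearMap) P = 0 := by
      rw [← SetLike.mem_coe, hS]; rfl
    rw [← h1]
    constructor
    · rintro ⟨g', hg', h2⟩
      rwa [← LinearEquiv.toLinearMap_injective h2]
    · exact fun h => ⟨g, h, rfl⟩
  have hmul : ∀ a ∈ {X | ∃ g ∈ G, g.toLinearMap = X}, ∀ b ∈ {X | ∃ g ∈ G, g.toLinearMap = X},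
      a * b ∈ {X | ∃ g ∈ G, g.toLinearMap = X} := by
    rintro _ ⟨a, ha, rfl⟩ _ ⟨b, hb, rfl⟩
    exact ⟨a * b, G.mul_mem ha hb, toLinearMap_mul a b⟩
  have hinv : ∀ a ∈ {X | ∃ g ∈ G, g.toLinearMap = X}, ∀ b, a * b = 1 → b * a = 1 →
      b ∈ {X | ∃ g ∈ G, g.toLinearMap = X} := by
    rintro _ ⟨a, ha, rfl⟩ b hab hba
    obtain ⟨g, hg, hg'⟩ := exists_toLinearMap_eq hab hba
    rw [LinearEquiv.toLinearMap_injective hg] at hg'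
    exact ⟨a⁻¹, G.inv_mem ha, hg'⟩
  have hRinv : ∀ a ∈ realEnd W, a ∈ {X | ∃ g ∈ G, g.toLinearMap = X} → ∀ b, a * b = 1 →
      b * a = 1 → b ∈ realEnd W := by
    rintro _ haR ⟨a, ha, rfl⟩ b hab hba
    obtain ⟨g, hg, hg'⟩ := exists_toLinearMap_eq hab hba
    rw [LinearEquiv.toLinearMap_injective hg] at hg'
    rw [← hg', ← mem_realGr_iff_mem_realEnd]
    exact (realGr W).inv_mem (mem_realGr_iff_mem_realEnd.2 haR)
  have hL : ∀ X, X ∈ lieAlg G ↔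
      ∀ t : ℝ, NormedSpace.exp ((t : ℂ) • X) ∈ {X | ∃ g ∈ G, g.toLinearMap = X} := by
    intro X
    constructor
    · exact fun hX t => ⟨_, (mem_lieAlg_iff hG).1 hX t, coe_expGL _⟩
    · intro hX
      refine mem_lieAlg_of_expGL fun t => ?_
      obtain ⟨g, hg, hgX⟩ := hX t
      rw [← coe_expGL] at hgX
      rwa [← LinearEquiv.toLinearMap_injective hgX]
  have hAd : ∀ X ∈ lieAlg G, s⁻¹.toLinearMap * X * s.toLinearMap ∈ lieAlg G := fun X hX => by
    have h1 := conj_mem_lieAlg hG (G.inv_mem hsG) hX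
    have h2 : s⁻¹.conj X = s⁻¹.toLinearMap * X * s.toLinearMap := LinearMap.ext fun x => rfl
    rwa [h2] at h1
  have key := eventually_conj_of_subring (isClosed_setOf_aeval_entries S) hM ⟨1, G.one_mem, rfl⟩
    hmul hinv isClosed_realEnd (fun t x hx => real_smul_mem_realEnd t hx) hRinv hL hp hs
    (toLinearMap_mul_inv s) (toLinearMap_inv_mul s) ⟨s, hsG, rfl⟩
    (mem_realGr_iff_mem_realEnd.1 hsR) hAd
  filter_upwards [key] with a ha g hg hga hgR hap
  obtain ⟨m, hm, hmR, heq⟩ := ha ⟨g, hg, hga⟩ (hga ▸ mem_realGr_iff_mem_realEnd.1 hgR) hap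
  refine ⟨m, hm, hmR, LinearEquiv.toLinearMap_injective ?_⟩
  rw [toLinearMap_mul, toLinearMap_mul, coe_expGL, coe_expGL_inv, hga, heq]

theorem expGL_half_mul_expGL_half (X : Module.End ℂ (Cx V)) :
    expGL (((1 / 2 : ℝ) : ℂ) • X) * expGL (((1 / 2 : ℝ) : ℂ) • X) = expGL X := by
  apply LinearEquiv.toLinearMap_injective
  rw [toLinearMap_mul, coe_expGL, coe_expGL]
  exact exp_half_mul_exp_half X

theorem expGL_mem_realGr {m : Module.End ℂ (Cx V)} (hm : m ∈ realEnd W) :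
    expGL m ∈ realGr W := by
  have h1 := exp_mem_of_isClosed (A := Module.End ℂ (Cx V)) (R := realEnd W) isClosed_realEnd
    (fun t x hx => real_smul_mem_realEnd t hx) (X := m) hm
  have h2 := coe_expGL m
  have h3 := mem_realGr_iff_mem_realEnd (W := W) (g := expGL m)
  rw [h2] at h3
  exact h3.2 h1

/-- exp(m) is the square of exp(m/2), an element of G that is a similitude real on the graded
pieces; squares have positive factors. -/
theorem expGL_mem_posSim (hG : IsQClosed (G : Set (GLC V))) (hsim : G ≤ simGroup Q)
    {m : Module.End ℂ (Cx V)} (hm : m ∈ lieAlg G) (hmR : m ∈ realEnd W) :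
    expGL m ∈ G ⊓ posSim Q := by
  have hg : expGL (((1 / 2 : ℝ) : ℂ) • m) ∈ G := expGL_mem hG (Submodule.smul_mem _ _ hm)
  have hgR : expGL (((1 / 2 : ℝ) : ℂ) • m) ∈ realGr W :=
    expGL_mem_realGr (real_smul_mem_realEnd _ hmR)
  rw [← expGL_half_mul_expGL_half]
  exact ⟨G.mul_mem hg hg, mul_self_mem_posSim (hsim hg) hgR⟩

/-- The orbits of the positive similitudes are open. -/
theorem eventually_mem_orbit (hG : IsQClosed (G : Set (GLC V))) (hsim : G ≤ simGroup Q)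
    (hF₀ : F₀ ∈ structuresIn W G h) : ∀ᶠ F in 𝓝[structuresIn W G h] F₀,
      ∃ g ∈ G ⊓ posSim Q, F = translate g F₀ := by
  obtain ⟨p, hp, hpF⟩ := exists_separable_aeval hF₀
  have hmemG : ∀ F ∈ structuresIn W G h, deligneTorus W F genericPoint ∈ G := fun F hF =>
    hF.2.2 (deligneTorus_mem_mumfordTate _)
  have key := eventually_eq_conj_expGL hG hp (hpF F₀ hF₀) (hmemG F₀ hF₀)
    (deligneTorus_mem_realGr hF₀.1)
  -- Continuity brings the torus of a nearby F, at the generic point, into the neighbourhood where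
  -- local conjugacy holds.
  filter_upwards [(tendsto_deligneTorus hF₀ genericPoint).eventually key, self_mem_nhdsWithin]
    with F hF hFΩ
  obtain ⟨m, hm, hmR, heq⟩ := hF _ (hmemG F hFΩ) rfl (deligneTorus_mem_realGr hFΩ.1) (hpF F hFΩ)
  exact ⟨expGL m, expGL_mem_posSim hG hsim hm hmR, eq_translate_of_conj hF₀.1 hFΩ.1 heq⟩

/-- A preconnected set of mixed Hodge structures lies in one orbit. -/
theorem IsPreconnected.subset_orbit (hG : IsQClosed (G : Set (GLC V))) (hsim : G ≤ simGroup Q)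
    {C : Set (CxFiltration V)} (hC : IsPreconnected C) (hCΩ : C ⊆ structuresIn W G h)
    (hF₀ : F₀ ∈ C) : ∀ F ∈ C, ∃ g ∈ G ⊓ posSim Q, F = translate g F₀ := by
  have hloc : ∀ F₁ : CxFiltration V, ∃ U : Set (CxFiltration V), IsOpen U ∧
      (F₁ ∈ structuresIn W G h → F₁ ∈ U ∧ ∀ F ∈ U, F ∈ structuresIn W G h →
        ∃ g ∈ G ⊓ posSim Q, F = translate g F₁) := fun F₁ => by
    by_cases hF₁ : F₁ ∈ structuresIn W G h
    · obtain ⟨U, hU, hU₁, h⟩ := mem_nhdsWithin.1 (eventually_mem_orbit hG hsim hF₁)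
      exact ⟨U, hU, fun _ => ⟨hU₁, fun F hF hFΩ => h ⟨hF, hFΩ⟩⟩⟩
    · exact ⟨∅, isOpen_empty, fun h => (hF₁ h).elim⟩
  choose U hUo hU using hloc
  set O : Set (CxFiltration V) := {F | ∃ g ∈ G ⊓ posSim Q, F = translate g F₀} with hO
  have hinO : ∀ F₁ ∈ C, ∀ F ∈ C, F ∈ U F₁ → (F₁ ∈ O ↔ F ∈ O) := by
    intro F₁ hF₁ F hF hFU
    obtain ⟨g, hg, rfl⟩ := (hU F₁ (hCΩ hF₁)).2 F hFU (hCΩ hF)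
    constructor
    · rintro ⟨g', hg', rfl⟩
      exact ⟨g * g', mul_mem hg hg', (translate_mul _ _ _).symm⟩
    · rintro ⟨g', hg', h'⟩
      refine ⟨g⁻¹ * g', mul_mem (inv_mem hg) hg', ?_⟩
      rw [translate_mul, ← h', ← translate_mul, inv_mul_cancel, translate_one]
  have hF₀O : F₀ ∈ O := ⟨1, one_mem _, (translate_one _).symm⟩
  -- The orbit of F₀ and its complement in C are both relatively open, being covered by
  -- neighbourhoods that stay in one orbit within `structuresIn`.
  have hsub := isPreconnected_iff_subset_of_disjoint.1 hC (⋃ F₁ ∈ C ∩ O, U F₁) (⋃ F₁ ∈ C \ O, U F₁)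
    (isOpen_biUnion fun F₁ _ => hUo F₁) (isOpen_biUnion fun F₁ _ => hUo F₁)
    (fun F hF => by
      have hFU := (hU F (hCΩ hF)).1
      by_cases hFO : F ∈ O
      · exact Or.inl (Set.mem_biUnion (show F ∈ C ∩ O from ⟨hF, hFO⟩) hFU)
      · exact Or.inr (Set.mem_biUnion (show F ∈ C \ O from ⟨hF, hFO⟩) hFU))
    (Set.eq_empty_iff_forall_notMem.2 fun F hF => by
      obtain ⟨hF, h1, h2⟩ := hF
      simp only [Set.mem_iUnion] at h1 h2
      obtain ⟨F₁, hF₁, h1⟩ := h1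
      obtain ⟨F₂, hF₂, h2⟩ := h2
      exact hF₂.2 ((hinO F₂ hF₂.1 F hF h2).2 ((hinO F₁ hF₁.1 F hF h1).1 hF₁.2)))
  rcases hsub with hsub | hsub
  · intro F hF
    have h1 := hsub hF
    simp only [Set.mem_iUnion] at h1
    obtain ⟨F₁, hF₁, h1⟩ := h1
    exact (hinO F₁ hF₁.1 F hF h1).1 hF₁.2
  · have h1 := hsub hF₀
    simp only [Set.mem_iUnion] at h1
    obtain ⟨F₁, hF₁, h1⟩ := h1
    exact (hF₁.2 ((hinO F₁ hF₁.1 F₀ hF₀ h1).2 hF₀O)).elim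

end OpenOrbits

/-! ### The mixed Hodge datum of the Mumford-Tate group and the comparison of components. -/

section MainTheorem

variable {V : Type*} [AddCommGroup V] [Module ℚ V] [Module.Finite ℚ V] {W : WeightFiltration V}
  {Q : GradedForms W} {h : ℤ → ℤ → ℕ} {F : CxFiltration V}

theorem mumfordTate_le_simGroup (hF : F ∈ periodDomain W Q h) : mumfordTate W F ≤ simGroup Q :=
  mumfordTate_le (isQClosed_simGroup Q) fun z => by
    rw [hF.1.deligneTorus_eq]
    exact hF.1.isSplitting.torus_mem_simGroup hF.2.1 z

theorem unipotentRadical_mumfordTate (hF : F ∈ periodDomain W Q h) :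
    unipotentRadical (mumfordTate W F) = mumfordTate W F ⊓ grTriv W :=
  hF.1.isSplitting.unipotentRadical_eq hF.2.1 isQClosed_mumfordTate (mumfordTate_le_simGroup hF)
    (hF.1.torus_mem_of_mumfordTate_le le_rfl)

theorem exists_isSplitting_of_mem_conjClass (hF : F ∈ periodDomain W Q h) {χ : TorusHom V}
    (hχ : χ ∈ conjClass (mumfordTate W F) (deligneTorus W F)) :
    (∀ z, χ z ∈ mumfordTate W F) ∧ ∃ (F' : CxFiltration V) (B : Bigrading (Cx V)),
      IsSplitting (gal conjQ) W.cx F' B ∧ χ = B.torus := by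
  have hst : mumfordTate W F ≤ stabW W := fun g hg => (mumfordTate_le_simGroup hF hg).1
  obtain ⟨g, hg, h⟩ := (mem_conjClass_iff isQClosed_mumfordTate hst
    (unipotentRadical_mumfordTate hF)).1 hχ
  refine ⟨fun z => ?_, _, _, hF.1.isSplitting.conjBy hg.2, MonoidHom.ext fun z => ?_⟩
  · rw [h]
    exact mul_mem (mul_mem hg.1 (deligneTorus_mem_mumfordTate z)) (inv_mem hg.1)
  · rw [h, Bigrading.conjBy_torus, hF.1.deligneTorus_eq]

theorem isMixedHodgeDatum_mumfordTate (hF : F ∈ periodDomain W Q h) :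
    IsMixedHodgeDatum (mumfordTate W F) (conjClass (mumfordTate W F) (deligneTorus W F)) :=
  isMixedHodgeDatum_of_isSplitting ⟨isQClosed_mumfordTate, isQConnected_mumfordTate hF.1⟩
    (unipotentRadical_mumfordTate hF) (fun _ hg => (mumfordTate_le_simGroup hF hg).1) ⟨_, rfl⟩
    fun _ hχ => exists_isSplitting_of_mem_conjClass hF hχ

theorem mem_hodgeDomain_mumfordTate_iff (hF : F ∈ periodDomain W Q h) {F' : CxFiltration V} :
    F' ∈ hodgeDomain (conjClass (mumfordTate W F) (deligneTorus W F)) ↔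
      ∃ g ∈ mumfordTate W F ⊓ realGr W, F' = translate g F :=
  mem_hodgeDomain_iff hF.1 isQClosed_mumfordTate
    (fun _ hg => (mumfordTate_le_simGroup hF hg).1) (unipotentRadical_mumfordTate hF)

theorem mem_hodgeDomain_self (hF : F ∈ periodDomain W Q h) :
    F ∈ hodgeDomain (conjClass (mumfordTate W F) (deligneTorus W F)) :=
  (mem_hodgeDomain_mumfordTate_iff hF).2 ⟨1, one_mem _, (translate_one F).symm⟩

theorem connectedComponentIn_noetherLefschetz (hF : F ∈ periodDomain W Q h) :
    connectedComponentIn (noetherLefschetz W Q h F) F =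
      connectedComponentIn (hodgeDomain (conjClass (mumfordTate W F) (deligneTorus W F))) F := by
  set D := hodgeDomain (conjClass (mumfordTate W F) (deligneTorus W F))
  have hFΩ : F ∈ structuresIn W (mumfordTate W F) h := ⟨hF.1, hF.2.2, le_rfl⟩
  have hNL : F ∈ noetherLefschetz W Q h F := ⟨hF, le_rfl⟩
  have hD : F ∈ D := mem_hodgeDomain_self hF
  have hNLΩ : noetherLefschetz W Q h F ⊆ structuresIn W (mumfordTate W F) h :=
    fun F' hF' => ⟨hF'.1.1, hF'.1.2.2, hF'.2⟩
  have hDΩ : D ⊆ structuresIn W (mumfordTate W F) h := fun F' hF' => by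
    obtain ⟨g, hg, rfl⟩ := (mem_hodgeDomain_mumfordTate_iff hF).1 hF'
    exact translate_mem_structuresIn isQClosed_mumfordTate hFΩ hg
  -- Positive similitudes preserve the period domain, and being real on the graded pieces they also
  -- preserve the mixed Hodge domain; the orbit of F thus lies in both loci.
  have horbit : ∀ C : Set (CxFiltration V), IsPreconnected C →
      C ⊆ structuresIn W (mumfordTate W F) h → F ∈ C →
      C ⊆ noetherLefschetz W Q h F ∧ C ⊆ D := fun C hC hCΩ hFC => by
    have key := IsPreconnected.subset_orbit isQClosed_mumfordTate (mumfordTate_le_simGroup hF) hC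
      hCΩ hFC
    refine ⟨fun F' hF' => ?_, fun F' hF' => ?_⟩
    · obtain ⟨g, hg, h'⟩ := key F' hF'
      exact ⟨h' ▸ translate_mem_periodDomain hF hg.2, (hCΩ hF').2.2⟩
    · obtain ⟨g, hg, h'⟩ := key F' hF'
      exact (mem_hodgeDomain_mumfordTate_iff hF).2 ⟨g, ⟨hg.1, hg.2.1⟩, h'⟩
  apply subset_antisymm
  · exact isPreconnected_connectedComponentIn.subset_connectedComponentIn
      (mem_connectedComponentIn hNL) (horbit _ isPreconnected_connectedComponentIn
        ((connectedComponentIn_subset _ _).trans hNLΩ) (mem_connectedComponentIn hNL)).2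
  · exact isPreconnected_connectedComponentIn.subset_connectedComponentIn
      (mem_connectedComponentIn hD) (horbit _ isPreconnected_connectedComponentIn
        ((connectedComponentIn_subset _ _).trans hDΩ) (mem_connectedComponentIn hD)).1

end MainTheorem

end MixedHodge

end

theorem mainTheorem6 {V : Type*} [AddCommGroup V] [Module ℚ V] [Module.Finite ℚ V]
    (W : MixedHodge.WeightFiltration V) (Q : MixedHodge.GradedForms W) (h : ℤ → ℤ → ℕ)
    (F : MixedHodge.CxFiltration V) (hF : F ∈ MixedHodge.periodDomain W Q h)
    (G : Subgroup (MixedHodge.GLC V)) (hG : G = MixedHodge.mumfordTate W F)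
    (X : Set (MixedHodge.TorusHom V))
    (hX : X = MixedHodge.conjClass G (MixedHodge.deligneTorus W F)) :
    -- the Deligne torus of `(V, W, F)` is what its name says
    MixedHodge.IsDeligneTorus W F (MixedHodge.deligneTorus W F) ∧
    -- `(G, X)` is a mixed Hodge datum, and it induces on `V` the weight filtration `W`
    MixedHodge.IsMixedHodgeDatum G X ∧
    (∀ χ ∈ X, ∀ k, MixedHodge.weightFiltrationOf χ k = W.cx k) ∧
    -- `F` lies in the mixed Hodge domain, and its component there is the component of the
    -- Noether-Lefschetz locus
    F ∈ MixedHodge.hodgeDomain X ∧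
    connectedComponentIn (MixedHodge.noetherLefschetz W Q h F) F =
      connectedComponentIn (MixedHodge.hodgeDomain X) F := by
  subst hG hX
  refine ⟨hF.1.isDeligneTorus_deligneTorus, MixedHodge.isMixedHodgeDatum_mumfordTate hF,
    fun χ hχ k => ?_, MixedHodge.mem_hodgeDomain_self hF,
    MixedHodge.connectedComponentIn_noetherLefschetz hF⟩
  obtain ⟨-, F', B, hB, rfl⟩ := MixedHodge.exists_isSplitting_of_mem_conjClass hF hχ
  exact hB.weightFiltrationOf_torus k
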